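/- **Setting.** Let $m,n\ge 0$ be integers with $m+n\ge 1$, let $D$ be a probability distribution, and consider $\min_{x\in\mathbb R^n}\Phi(x):=f(g(x))+h(x)$ with $g(x)=\mathbb E_{\xi\sim D}[g_\xi(x)]$. Here $f:\mathbb R^m\to\mathbb R$ is convex and $l_f$-Lipschitz; $h:\mathbb R^n\to\mathbb R\cup\{+\infty\}$ is closed, convex and proper; every component $g_\xi:\mathbb R^n\to\mathbb R^m$ is differentiable; $g$ is differentiable and $l_g$-Lipschitz, and its Jacobian $g'$ is $L_g$-Lipschitz in operator norm. There are constants $\sigma_g,\sigma_{g'},\hat l_g,\hat L_g$ such that for $D$-almost every $\xi$ and all $x,y\in\mathbb R^n$: $\|g_\xi(x)-g(x)\|_2\le\sigma_g$, $\|g'_\xi(x)-g'(x)\|_{\rm op}\le\sigma_{g'}$, $\|g_\xi(x)-g_\xi(y)\|_2\le\hat l_g\|x-y\|_2$ and $\|g'_\xi(x)-g'_\xi(y)\|_{\rm op}\le\hat L_g\|x-y\|_2$. Assume $\inf\Phi>-\infty$, let $x_0^0$ be a starting point with $\Phi(x_0^0)-\inf\Phi\le\Gamma<\infty$, and let $M>5\,l_fL_g$.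 The generalized gradient is $\mathcal G_M(x)=M(x-x_+)$, where $x_+$ is the minimizer of $y\mapsto f(g(x)+g'(x)(y-x))+h(y)+\frac M2\|y-x\|_2^2$. **Method.** Given positive integers $K,\tau$, batch sizes $A,B,a,b$ and tolerances $\bar\epsilon,\bar\delta>0$, for $k=0,\dots,K-1$ and $i=0,\dots,\tau-1$ draw two fresh batches $\mathcal A_i^k,\mathcal B_i^k$ of independent samples from $D$, of sizes $A,B$ if $i=0$ and $a,b$ if $i>0$, and set $$\tilde g_0^k=\tfrac1A\sum_{\xi\in\mathcal A_0^k}g_\xi(x_0^k),\qquad \tilde J_0^k=\tfrac1B\sum_{\xi\in\mathcal B_0^k}g'_\xi(x_0^k),$$ and, for $i>0$, $$\tilde g_i^k=\tfrac1a\sum_{\xi\in\mathcal A_i^k}\bigl(g_\xi(x_i^k)-g_\xi(x_0^k)-g'_\xi(x_0^k)(x_i^k-x_0^k)\bigr)+\tilde g_0^k+\tilde J_0^k(x_i^k-x_0^k),\qquad \tilde J_i^k=\tfrac1b\sum_{\xi\in\mathcal B_i^k}\bigl(g'_\xi(x_i^k)-g'_\xi(x_0^k)\bigr)+\tilde J_0^k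 .$$ Then $x_{i+1}^k$ is the output of a randomized solver, run with fresh randomness and tolerances $\bar\epsilon,\bar\delta$, on $s_i^k(y)=f(\tilde g_i^k+\tilde J_i^k(y-x_i^k))+h(y)+\frac M2\|y-x_i^k\|_2^2$; at the end of an epoch $x_0^{k+1}=x_\tau^k$. For all $\bar\epsilon,\bar\delta>0$ and every subproblem $s$ of this form, the solver returns with probability at least $1-\bar\delta$ a point $x$ with $s(x)\le\inf s+\bar\epsilon$. **Claim.** There are positive constants $C_\Sigma,C_A,C_B,C_a,C_b$ and $\epsilon_0<1$, depending only on $l_f,l_g,L_g,\hat l_g,\hat L_g,\sigma_g,\sigma_{g'},M,\Gamma$, such that the following holds for all $\Delta\in(0,1)$, all integers $\tau>0$ and all $\epsilon\in(0,\epsilon_0)$. Set $K=\lceil C_\Sigma\epsilon^{-1}/\tau\rceil$, $A=\lceil C_A\epsilon^{-2}\log\frac{4(m+1)K\tau}{\Delta}\rceil$, $B=\lceil C_B\tau^2\epsilon^{-1}\log\frac{4(m+n)K\tau}{\Delta}\rceil$, $a=\lceil C_a\tau^4\log\frac{4(m+1)K\tau}{\Delta}\rceil$, $b=\lceil C_b\tau^2\log\frac{4(m+n)K\tau}{\Delta}\rceil$,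 $\bar\delta=\Delta/(2K\tau)$, $\bar\epsilon=\epsilon/(5\cdot 30M)$. (i) With probability at least $1-\Delta$, $$\frac1{K\tau}\sum_{k=0}^{K-1}\sum_{i=0}^{\tau-1}\|\mathcal G_M(x_i^k)\|_2^2\le\epsilon .$$ (ii) Provided $\tau=O(\epsilon^{-1})$, the numbers of evaluations of components $g_\xi$ and of Jacobians $g'_\xi$ made by the method are, in every run, respectively $$\widetilde\Theta\bigl((\epsilon^{-3}\tau^{-1}+\epsilon^{-1}\tau^4)\log(1/\Delta)\bigr)\quad\text{and}\quad\widetilde\Theta\bigl((\epsilon^{-2}\tau+\epsilon^{-1}\tau^4)\log(1/\Delta)\bigr).$$ Precisely: for all $c_\tau>0$ and $\Delta_0\in(0,1)$ there are $c,C>0$ and $p\in\mathbb N$, depending only on $c_\tau,\Delta_0,m,n$ and the constants above, such that, whenever $\tau\le c_\tau\epsilon^{-1}$ and $\Delta\le\Delta_0$, each count is at least $c$ times the expression inside $\widetilde\Theta$ and at most $C\log^p(1/\epsilon)$ times it. -/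

import Mathlib

open MeasureTheory
open scoped NNReal

universe u v

noncomputable section

/-- `ℝᵈ` with the Euclidean norm. -/
abbrev Vec (d : ℕ) : Type := EuclideanSpace ℝ (Fin d)

/-- Jacobians, with the operator norm induced by the Euclidean norms (the spectral norm). -/
abbrev Jac (n m : ℕ) : Type := Vec n →L[ℝ] Vec m

/-! ### The composite problem -/

/-- The data of `min_x f (g x) + h x` with `g x = E_{ξ ∼ D} [G ξ x]`. -/
structure CompositeProblem (n m : ℕ) (Ξ : Type u) [MeasurableSpace Ξ] where
  f : Vec m → ℝ
  h : Vec n → EReal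
  G : Ξ → Vec n → Vec m
  D : Measure Ξ

namespace CompositeProblem

variable {n m : ℕ} {Ξ : Type u} [MeasurableSpace Ξ]

/-- The inner mapping `g`, an expectation over the components. -/
def g (P : CompositeProblem n m Ξ) (x : Vec n) : Vec m := ∫ ξ, P.G ξ x ∂P.D

/-- The objective `Φ = f ∘ g + h`, with values in `ℝ ∪ {+∞}`. -/
def Φ (P : CompositeProblem n m Ξ) (x : Vec n) : EReal := ((P.f (P.g x) : ℝ) : EReal) + P.h x

/-- The convex model `y ↦ f (u + J (y - x)) + h y + (M / 2) ‖y - x‖²` around `x`, built from a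
value `u` and a Jacobian `J`. -/
def model (P : CompositeProblem n m Ξ) (M : ℝ) (x : Vec n) (u : Vec m) (J : Jac n m)
    (y : Vec n) : EReal :=
  ((P.f (u + J (y - x)) : ℝ) : EReal) + P.h y + ((M / 2 * ‖y - x‖ ^ 2 : ℝ) : EReal)

/-- The exact prox-linear step from `x`: the minimizer of the model built from `g x` and `g' x`.
(Under the standing assumptions and `M > 0` that model is lower semicontinuous, proper and
`M`-strongly convex, so it has exactly one minimizer.) -/
def proxLinear (P : CompositeProblem n m Ξ) (M : ℝ) (x : Vec n) : Vec n :=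
  Classical.epsilon fun y => ∀ z,
    P.model M x (P.g x) (fderiv ℝ P.g x) y ≤ P.model M x (P.g x) (fderiv ℝ P.g x) z

/-- The generalized gradient `M (x - x₊)`. -/
def genGrad (P : CompositeProblem n m Ξ) (M : ℝ) (x : Vec n) : Vec n :=
  M • (x - P.proxLinear M x)

/-- Standing assumptions on `f`, `g`, `h` and on the random components. -/
structure Standing (P : CompositeProblem n m Ξ) (lf lg Lg : ℝ≥0) : Prop where
  prob : IsProbabilityMeasure P.D
  f_convex : ConvexOn ℝ Set.univ P.f
  f_lipschitz : LipschitzWith lf P.f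
  G_measurable : ∀ x, Measurable fun ξ => P.G ξ x
  G_differentiable : ∀ ξ, Differentiable ℝ (P.G ξ)
  G_integrable : ∀ x, Integrable (fun ξ => P.G ξ x) P.D
  g_differentiable : Differentiable ℝ P.g
  g_lipschitz : LipschitzWith lg P.g
  g_jac_lipschitz : LipschitzWith Lg (fderiv ℝ P.g)
  h_ne_bot : ∀ x, P.h x ≠ ⊥
  h_proper : ∃ x, P.h x ≠ ⊤
  h_closed : LowerSemicontinuous P.h
  h_convex : Convex ℝ {p : Vec n × ℝ | P.h p.1 ≤ (p.2 : EReal)}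

/-- Uniformly bounded deviations of the components and their Jacobians from their means. -/
structure BoundedDeviation (P : CompositeProblem n m Ξ) (σg σJ : ℝ) : Prop where
  value : ∀ᵐ ξ ∂P.D, ∀ x, ‖P.G ξ x - P.g x‖ ≤ σg
  jac : ∀ᵐ ξ ∂P.D, ∀ x, ‖fderiv ℝ (P.G ξ) x - fderiv ℝ P.g x‖ ≤ σJ

/-- Uniformly Lipschitz components with uniformly Lipschitz Jacobians. -/
structure UniformlyLipschitz (P : CompositeProblem n m Ξ) (lhat Lhat : ℝ≥0) : Prop where
  value : ∀ᵐ ξ ∂P.D, LipschitzWith lhat (P.G ξ)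
  jac : ∀ᵐ ξ ∂P.D, LipschitzWith Lhat (fderiv ℝ (P.G ξ))

end CompositeProblem

/-! ### Computations that count their oracle calls -/

/-- A result, with the numbers of evaluations of components and of their Jacobians that were
spent on it. -/
structure Counted (α : Type) where
  val : α
  evals : ℕ
  jacs : ℕ

instance : Monad Counted where
  pure a := ⟨a, 0, 0⟩
  bind c k := ⟨(k c.val).val, c.evals + (k c.val).evals, c.jacs + (k c.val).jacs⟩

/-- Sum of the results of `N` computations. -/
def Counted.sum {α : Type} [AddCommMonoid α] (N : ℕ) (t : ℕ → Counted α) : Counted α :=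
  ⟨∑ r ∈ Finset.range N, (t r).val, ∑ r ∈ Finset.range N, (t r).evals,
    ∑ r ∈ Finset.range N, (t r).jacs⟩

/-! ### The solver -/

/-- A (randomized) subproblem solver: it gets the subproblem, the two tolerances and a random
seed. -/
abbrev Solver (n : ℕ) (S : Type v) : Type v := (Vec n → EReal) → ℝ → ℝ → S → Vec n

/-- With a seed drawn from `ν`, the solver returns an `ε'`-optimal solution of every subproblem
with probability at least `1 - δ'`. -/
structure Solver.Valid {n m : ℕ} {Ξ : Type u} [MeasurableSpace Ξ] {S : Type v} [MeasurableSpace S]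
    (solver : Solver n S) (ν : Measure S) (P : CompositeProblem n m Ξ) (M : ℝ) : Prop where
  measurable : ∀ ε' δ' : ℝ, 0 < ε' → 0 < δ' →
    Measurable fun p : (Vec n × Vec m × Jac n m) × S =>
      solver (P.model M p.1.1 p.1.2.1 p.1.2.2) ε' δ' p.2
  accurate : ∀ ε' δ' : ℝ, 0 < ε' → 0 < δ' → ∀ (x : Vec n) (u : Vec m) (J : Jac n m),
    ENNReal.ofReal (1 - δ') ≤
      ν {s | P.model M x u J (solver (P.model M x u J) ε' δ' s)
        ≤ (⨅ y, P.model M x u J y) + (ε' : EReal)}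

/-! ### The estimator -/

/-- Batch sizes: `A`, `B` at the start of an epoch, `a`, `b` afterwards. -/
structure BatchSizes where
  A : ℕ
  B : ℕ
  a : ℕ
  b : ℕ

/-- The state of the method: the current iterate, and the memory of the first iterate of the
epoch with the value and the Jacobian estimated there. -/
structure PLState (n m : ℕ) where
  x : Vec n
  xref : Vec n
  gref : Vec m
  Jref : Jac n m

section Algorithm

variable {n m : ℕ} {Ξ : Type u} [MeasurableSpace Ξ] {S : Type v}

/-- One evaluation of a component. -/
def evalOracle (P : CompositeProblem n m Ξ) (ξ : Ξ) (x : Vec n) : Counted (Vec m) :=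
  ⟨P.G ξ x, 1, 0⟩

/-- One evaluation of the Jacobian of a component. -/
def jacOracle (P : CompositeProblem n m Ξ) (ξ : Ξ) (x : Vec n) : Counted (Jac n m) :=
  ⟨fderiv ℝ (P.G ξ) x, 0, 1⟩

/-- The estimator with first-order corrected values: sample means at the start of an epoch
(`i = 0`), variance-reduced updates afterwards. `zA` and `zB` list the samples of the two
batches. -/
def estimator (P : CompositeProblem n m Ξ) (θ : BatchSizes) (zA zB : ℕ → Ξ) (i : ℕ)
    (st : PLState n m) : Counted (Vec m × Jac n m) :=
  if i = 0 then do
    let gs ← Counted.sum θ.A fun r => evalOracle P (zA r) st.x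
    let Js ← Counted.sum θ.B fun r => jacOracle P (zB r) st.x
    pure ((θ.A : ℝ)⁻¹ • gs, (θ.B : ℝ)⁻¹ • Js)
  else do
    let gs ← Counted.sum θ.a fun r => do
      let v ← evalOracle P (zA r) st.x
      let w ← evalOracle P (zA r) st.xref
      let J ← jacOracle P (zA r) st.xref
      pure (v - w - J (st.x - st.xref))
    let Js ← Counted.sum θ.b fun r => do
      let J ← jacOracle P (zB r) st.x
      let J' ← jacOracle P (zB r) st.xref
      pure (J - J')
    pure ((θ.a : ℝ)⁻¹ • gs + st.gref + st.Jref (st.x - st.xref), (θ.b : ℝ)⁻¹ • Js + st.Jref)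

/-! ### The variance reduced, inexact prox-linear method -/

/-- All the randomness of a run: the samples `(k, i, r)` of the value batches and of the Jacobian
batches, and the solver's seeds `(k, i)`. -/
abbrev Tape (Ξ : Type u) (S : Type v) : Type (max u v) :=
  (ℕ × ℕ × ℕ → Ξ) × (ℕ × ℕ × ℕ → Ξ) × (ℕ × ℕ → S)

/-- All samples (with law `D`) and all seeds (with law `ν`) are independent. -/
def tapeMeasure [MeasurableSpace S] (D : Measure Ξ) (ν : Measure S) : Measure (Tape Ξ S) :=
  (Measure.infinitePi fun _ : ℕ × ℕ × ℕ => D).prod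
    ((Measure.infinitePi fun _ : ℕ × ℕ × ℕ => D).prod (Measure.infinitePi fun _ : ℕ × ℕ => ν))

/-- The inputs of the method that are not part of the problem: the proximal parameter, the batch
sizes, the solver with its two tolerances, and the starting point. -/
structure PLInput (n : ℕ) (S : Type v) where
  M : ℝ
  θ : BatchSizes
  solver : Solver n S
  εbar : ℝ
  δbar : ℝ
  x₀ : Vec n

/-- Iteration `(k, i)`: estimate, memorize if `i = 0`, and solve the subproblem. -/
def plStep (P : CompositeProblem n m Ξ) (I : PLInput n S) (ω : Tape Ξ S) (k i : ℕ)
    (st : PLState n m) : Counted (PLState n m) := do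
  let e ← estimator P I.θ (fun r => ω.1 (k, i, r)) (fun r => ω.2.1 (k, i, r)) i st
  let x' := I.solver (P.model I.M st.x e.1 e.2) I.εbar I.δbar (ω.2.2 (k, i))
  pure (if i = 0 then ⟨x', st.x, e.1, e.2⟩ else ⟨x', st.xref, st.gref, st.Jref⟩)

/-- The first `i` iterations of epoch `k`. -/
def plInner (P : CompositeProblem n m Ξ) (I : PLInput n S) (ω : Tape Ξ S) (k : ℕ) :
    ℕ → PLState n m → Counted (PLState n m)
  | 0, st => pure st
  | i + 1, st => do
    let st' ← plInner P I ω k i st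
    plStep P I ω k i st'

/-- The first `k` epochs, with epoch lengths `τ 0, τ 1, …`. (The initial memory is never read.) -/
def plOuter (P : CompositeProblem n m Ξ) (I : PLInput n S) (τ : ℕ → ℕ) (ω : Tape Ξ S) :
    ℕ → Counted (PLState n m)
  | 0 => pure ⟨I.x₀, I.x₀, 0, 0⟩
  | k + 1 => do
    let st ← plOuter P I τ ω k
    plInner P I ω k (τ k) st

/-- The iterate `x_i^k`. -/
def plIterate (P : CompositeProblem n m Ξ) (I : PLInput n S) (τ : ℕ → ℕ) (ω : Tape Ξ S)
    (k i : ℕ) : Vec n :=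
  (plInner P I ω k i (plOuter P I τ ω k).val).val.x

end Algorithm

end

/-! The argument has a deterministic half, a probabilistic half and a count.

Deterministic half. The exact prox-linear model is strongly convex and overestimates `Φ` up to `lf *
Lg * ‖y - x‖²`. So a step with inexact value, Jacobian and solver still decreases the objective
(`Standing.inexact_step`), and `5 * lf * Lg < M` leaves a decrease of `M/4 * r² + M/5 * s²`
(`descent_of_young`), where `r` is the length of the exact step, that is `‖𝒢_M‖ / M`, and `s` that
of the actual one. The first-order correction makes the value error quadratic in the distance to the
start of the epoch, and the Jacobian error is linear in it. The batch sizes are tuned so that the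
total error is at most `M/5 * (‖x_i - x_0‖ / τ)²` plus a multiple of `ε` (`error_le`). By
Cauchy–Schwarz the sum of the first part over an epoch is at most `M/5 * ∑ s²`, which the decrease
pays for (`epoch_descent`). Telescoping over the epochs bounds the average of `‖𝒢_M‖²`
(`average_le_of_descent`, `average_genGrad_le`).

Probabilistic half. Batch means of bounded centered matrices are controlled by even trace moments:
with `tr Y^(2p) / (2p)!`, the second derivative along `S + t X` is at most `2σ²` times the preceding
moment. Integrating this hierarchy leaves first-order terms in `X`, which vanish in expectation, and
the rest sums by the binomial theorem (`lintegral_traceMoment_sum_le`). Markov's inequality with `p`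
of the order of the logarithm gives a dimension-dependent exponential tail
(`measure_norm_mean_gt_le`). Batches are drawn at random points, but these points ignore the fresh
samples, so they may be frozen (`measure_fresh_le`). A union bound over the `K * τ` iterations
concludes.

Count. The numbers of oracle calls do not depend on the tape, so the complexity claims are real
inequalities between the batch sizes and the stated rates (`exists_complexity_bounds`). -/

noncomputable section

/-! ### Even trace moments of symmetric operators and their Taylor expansion. -/

section TraceMoments

variable {E : Type*} [NormedAddCommGroup E] [InnerProductSpace ℝ E]

/-- The trace of an endomorphism, as a continuous linear functional. -/
def opTrace (E : Type*) [NormedAddCommGroup E] [InnerProductSpace ℝ E] [FiniteDimensional ℝ E] :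
    (E →L[ℝ] E) →L[ℝ] ℝ :=
  LinearMap.toContinuousLinearMap ((LinearMap.trace ℝ E) ∘ₗ ContinuousLinearMap.coeLM ℝ)

lemma isSymmetric_pow {Y : E →L[ℝ] E} (hY : Y.IsSymmetric) (k : ℕ) : (Y ^ k).IsSymmetric := by
  intro u v
  induction k generalizing u v with
  | zero => rfl
  | succ k ih =>
    have h1 : (Y ^ (k + 1)) u = Y ((Y ^ k) u) := by rw [pow_succ']; rfl
    have h2 : (Y ^ (k + 1)) v = (Y ^ k) (Y v) := by rw [pow_succ]; rfl
    change inner ℝ ((Y ^ (k + 1)) u) v = inner ℝ u ((Y ^ (k + 1)) v)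
    rw [h1, h2]
    exact (hY _ _).trans (ih _ _)

variable [FiniteDimensional ℝ E]

lemma opTrace_apply (T : E →L[ℝ] E) : opTrace E T = LinearMap.trace ℝ E (T : E →ₗ[ℝ] E) := rfl

lemma opTrace_mul_comm (A B : E →L[ℝ] E) : opTrace E (A * B) = opTrace E (B * A) :=
  LinearMap.trace_mul_comm ℝ (A : E →ₗ[ℝ] E) (B : E →ₗ[ℝ] E)

lemma opTrace_eq_sum {ι : Type*} [Fintype ι] (b : OrthonormalBasis ι ℝ E) (T : E →L[ℝ] E) :
    opTrace E T = ∑ i, inner ℝ (b i) (T (b i)) := by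
  rw [opTrace_apply, LinearMap.trace_eq_sum_inner _ b]; rfl

lemma opTrace_one : opTrace E 1 = Module.finrank ℝ E := by
  rw [opTrace_apply]; exact LinearMap.trace_one ℝ E

/-- Spectral data of a symmetric endomorphism. -/
lemma exists_eigenbasis {Y : E →L[ℝ] E} (hY : Y.IsSymmetric) :
    ∃ (b : OrthonormalBasis (Fin (Module.finrank ℝ E)) ℝ E) (l : Fin (Module.finrank ℝ E) → ℝ),
      ∀ (k : ℕ) i, (Y ^ k) (b i) = l i ^ k • b i := by
  refine ⟨hY.eigenvectorBasis rfl, hY.eigenvalues rfl, fun k i => ?_⟩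
  have h := hY.apply_eigenvectorBasis rfl i
  induction k with
  | zero => simp
  | succ k ih =>
    have h1 : (Y ^ (k + 1)) (hY.eigenvectorBasis rfl i) = (Y ^ k) (Y (hY.eigenvectorBasis rfl i)) := by
      rw [pow_succ]; rfl
    have h2 : Y (hY.eigenvectorBasis rfl i) = hY.eigenvalues rfl i • hY.eigenvectorBasis rfl i := h
    rw [h1, h2, map_smul, ih, smul_smul, pow_succ']

lemma opTrace_pow_eq {Y : E →L[ℝ] E} {b : OrthonormalBasis (Fin (Module.finrank ℝ E)) ℝ E}
    {l : Fin (Module.finrank ℝ E) → ℝ} (h : ∀ (k : ℕ) i, (Y ^ k) (b i) = l i ^ k • b i) (k : ℕ) :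
    opTrace E (Y ^ k) = ∑ i, l i ^ k := by
  rw [opTrace_eq_sum b]
  simp [h, inner_smul_right]

lemma opTrace_pow_even_nonneg {Y : E →L[ℝ] E} (hY : Y.IsSymmetric) (q : ℕ) :
    0 ≤ opTrace E (Y ^ (2 * q)) := by
  obtain ⟨b, l, h⟩ := exists_eigenbasis hY
  rw [opTrace_pow_eq h]
  exact Finset.sum_nonneg fun i _ => (even_two_mul q).pow_nonneg _

/-- The larger of `|x|` and `|y|` dominates. Both exponents may be odd, hence the absolute values;
they disappear because `2 * q` is even. This crude form of Young's inequality is the origin of the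
factor 2 in `2 * σ ^ 2`. -/
lemma pow_mul_pow_le_add (x y : ℝ) {j k q : ℕ} (h : j + k = 2 * q) :
    x ^ k * y ^ j ≤ x ^ (2 * q) + y ^ (2 * q) := by
  have hx : |x| ^ (2 * q) = x ^ (2 * q) := (even_two_mul q).pow_abs x
  have hy : |y| ^ (2 * q) = y ^ (2 * q) := (even_two_mul q).pow_abs y
  have h0 : x ^ k * y ^ j ≤ |x| ^ k * |y| ^ j := by
    rw [← abs_pow, ← abs_pow, ← abs_mul]; exact le_abs_self _
  rw [← hx, ← hy]
  refine h0.trans ?_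
  rcases le_total |x| |y| with hxy | hxy
  · calc |x| ^ k * |y| ^ j ≤ |y| ^ k * |y| ^ j := by gcongr
      _ = |y| ^ (2 * q) := by rw [← pow_add, add_comm, h]
      _ ≤ _ := le_add_of_nonneg_left (by positivity)
  · calc |x| ^ k * |y| ^ j ≤ |x| ^ k * |x| ^ j := by gcongr
      _ = |x| ^ (2 * q) := by rw [← pow_add, add_comm, h]
      _ ≤ _ := le_add_of_nonneg_right (by positivity)

/-- Interlacing powers of `Y` with two copies of `X` costs at most `2 ‖X‖²`. -/
lemma opTrace_interlace_le {X Y : E →L[ℝ] E} (hX : X.IsSymmetric) (hY : Y.IsSymmetric) {σ : ℝ}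
    (hσ : ‖X‖ ≤ σ) {j k q : ℕ} (h : j + k = 2 * q) :
    opTrace E (X * Y ^ j * X * Y ^ k) ≤ 2 * σ ^ 2 * opTrace E (Y ^ (2 * q)) := by
  obtain ⟨b, l, hb⟩ := exists_eigenbasis hY
  -- In an eigenbasis of `Y` the trace is a double sum weighted by the squared entries of `X`, whose
  -- row and column sums are at most `σ ^ 2`.
  have hterm : ∀ a, inner ℝ (b a) ((X * Y ^ j * X * Y ^ k) (b a))
      = ∑ c, l a ^ k * l c ^ j * inner ℝ (b c) (X (b a)) ^ 2 := by
    intro a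
    have h1 : (X * Y ^ j * X * Y ^ k) (b a) = X ((Y ^ j) (X ((Y ^ k) (b a)))) := rfl
    have h2 : inner ℝ (b a) (X ((Y ^ j) (X (b a)))) = inner ℝ (X (b a)) ((Y ^ j) (X (b a))) :=
      (hX _ _).symm
    rw [h1, hb, map_smul, map_smul, map_smul, inner_smul_right, h2, ← b.sum_inner_mul_inner,
      Finset.mul_sum]
    refine Finset.sum_congr rfl fun c _ => ?_
    have h3 : inner ℝ (b c) ((Y ^ j) (X (b a))) = inner ℝ ((Y ^ j) (b c)) (X (b a)) :=
      (isSymmetric_pow hY j _ _).symm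
    rw [h3, hb, real_inner_smul_left, real_inner_comm (b c)]
    ring
  have hsum : ∀ a, ∑ c, inner ℝ (b c) (X (b a)) ^ 2 ≤ σ ^ 2 := by
    intro a
    have h1 : ∑ c, inner ℝ (b c) (X (b a)) ^ 2 = ‖X (b a)‖ ^ 2 := by
      rw [← real_inner_self_eq_norm_sq, ← b.sum_inner_mul_inner]
      refine Finset.sum_congr rfl fun c _ => ?_
      rw [real_inner_comm (b c), sq]
    rw [h1]
    have h2 : ‖X (b a)‖ ≤ σ := by
      have := X.le_opNorm (b a)
      rw [b.norm_eq_one, mul_one] at this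
      exact this.trans hσ
    gcongr
  have hsum' : ∀ c, ∑ a, inner ℝ (b c) (X (b a)) ^ 2 ≤ σ ^ 2 := by
    intro c
    refine le_trans (le_of_eq (Finset.sum_congr rfl fun a _ => ?_)) (hsum c)
    have : inner ℝ (b a) (X (b c)) = inner ℝ (X (b a)) (b c) := (hX _ _).symm
    rw [this, real_inner_comm]
  rw [opTrace_eq_sum b, opTrace_pow_eq hb]
  calc ∑ a, inner ℝ (b a) ((X * Y ^ j * X * Y ^ k) (b a))
      = ∑ a, ∑ c, l a ^ k * l c ^ j * inner ℝ (b c) (X (b a)) ^ 2 :=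
        Finset.sum_congr rfl fun a _ => hterm a
    _ ≤ ∑ a, ∑ c, (l a ^ (2 * q) + l c ^ (2 * q)) * inner ℝ (b c) (X (b a)) ^ 2 := by
        refine Finset.sum_le_sum fun a _ => Finset.sum_le_sum fun c _ => ?_
        exact mul_le_mul_of_nonneg_right (pow_mul_pow_le_add _ _ h) (sq_nonneg _)
    _ = (∑ a, l a ^ (2 * q) * ∑ c, inner ℝ (b c) (X (b a)) ^ 2)
        + ∑ c, l c ^ (2 * q) * ∑ a, inner ℝ (b c) (X (b a)) ^ 2 := by
        simp only [add_mul, Finset.sum_add_distrib, Finset.mul_sum]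
        congr 1
        exact Finset.sum_comm
    _ ≤ (∑ a, l a ^ (2 * q) * σ ^ 2) + ∑ c, l c ^ (2 * q) * σ ^ 2 := by
        refine add_le_add (Finset.sum_le_sum fun a _ => ?_) (Finset.sum_le_sum fun c _ => ?_)
        · exact mul_le_mul_of_nonneg_left (hsum a) ((even_two_mul q).pow_nonneg _)
        · exact mul_le_mul_of_nonneg_left (hsum' c) ((even_two_mul q).pow_nonneg _)
    _ = 2 * σ ^ 2 * ∑ i, l i ^ (2 * q) := by rw [← Finset.sum_mul]; ring

/-- Even trace moments control the operator norm. -/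
lemma norm_le_of_opTrace_pow_le {Y : E →L[ℝ] E} (hY : Y.IsSymmetric) {t : ℝ} (ht : 0 ≤ t) {p : ℕ}
    (hp : p ≠ 0) (h : opTrace E (Y ^ (2 * p)) ≤ t ^ (2 * p)) : ‖Y‖ ≤ t := by
  obtain ⟨b, l, hb⟩ := exists_eigenbasis hY
  rw [opTrace_pow_eq hb] at h
  have hl : ∀ i, |l i| ≤ t := by
    intro i
    have h1 : l i ^ (2 * p) ≤ t ^ (2 * p) :=
      (Finset.single_le_sum (f := fun i => l i ^ (2 * p))
        (fun i _ => (even_two_mul p).pow_nonneg _) (Finset.mem_univ i)).trans h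
    rw [← (even_two_mul p).pow_abs] at h1
    exact le_of_pow_le_pow_left₀ (by omega) ht h1
  refine ContinuousLinearMap.opNorm_le_bound _ ht fun v => ?_
  have key : ‖Y v‖ ^ 2 ≤ (t * ‖v‖) ^ 2 := by
    have h1 : ∀ u : E, ‖u‖ ^ 2 = ∑ c, inner ℝ (b c) u ^ 2 := by
      intro u
      rw [← real_inner_self_eq_norm_sq, ← b.sum_inner_mul_inner]
      refine Finset.sum_congr rfl fun c _ => ?_
      rw [real_inner_comm (b c), sq]
    rw [mul_pow, h1, h1, Finset.mul_sum]
    refine Finset.sum_le_sum fun c _ => ?_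
    have h2 : inner ℝ (b c) (Y v) = l c * inner ℝ (b c) v := by
      have h3 : inner ℝ (b c) (Y v) = inner ℝ (Y (b c)) v := (hY _ _).symm
      have h4 := hb 1 c
      rw [pow_one, pow_one] at h4
      rw [h3, h4, real_inner_smul_left]
    rw [h2, mul_pow]
    refine mul_le_mul_of_nonneg_right ?_ (sq_nonneg _)
    rw [← sq_abs (l c)]
    exact pow_le_pow_left₀ (abs_nonneg _) (hl c) 2
  exact le_of_sq_le_sq key (by positivity)

/-- `X` need not commute with `S`, but cyclicity of the trace makes the `k` terms of the product
rule equal. At second order this no longer works, which is why `opTrace_interlace_le` is needed. -/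
lemma hasDerivAt_opTrace_pow (S X : E →L[ℝ] E) (k : ℕ) (t : ℝ) :
    HasDerivAt (fun t : ℝ => opTrace E ((S + t • X) ^ k))
      (k * opTrace E (X * (S + t • X) ^ (k - 1))) t := by
  have h1 : HasDerivAt (fun t : ℝ => S + t • X) X t := by
    simpa using ((hasDerivAt_id t).smul_const X).const_add S
  have h2 := (opTrace E).hasFDerivAt.comp_hasDerivAt t (h1.fun_pow' k)
  refine h2.congr_deriv ?_
  rw [map_sum]
  rw [Finset.sum_congr rfl (g := fun _ => opTrace E (X * (S + t • X) ^ (k - 1)))]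
  · simp
  · intro i hi
    have hi : i < k := Finset.mem_range.1 hi
    rw [mul_assoc, opTrace_mul_comm, mul_assoc, ← pow_add]
    congr 3
    simp only [Nat.pred_eq_sub_one]
    omega

lemma hasDerivAt_opTrace_mul_pow (S X : E →L[ℝ] E) (k : ℕ) (t : ℝ) :
    HasDerivAt (fun t : ℝ => opTrace E (X * (S + t • X) ^ k))
      (∑ i ∈ Finset.range k, opTrace E (X * (S + t • X) ^ (k - 1 - i) * X * (S + t • X) ^ i)) t := by
  have h1 : HasDerivAt (fun t : ℝ => S + t • X) X t := by
    simpa using ((hasDerivAt_id t).smul_const X).const_add S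
  have h2 := (opTrace E).hasFDerivAt.comp_hasDerivAt t ((h1.fun_pow' k).const_mul X)
  refine h2.congr_deriv ?_
  rw [Finset.mul_sum, map_sum]
  refine Finset.sum_congr rfl fun i hi => ?_
  simp only [Nat.pred_eq_sub_one, mul_assoc]

/-- Comparison of functions through their second derivatives. -/
lemma le_of_second_deriv_le {f f' f'' g g' g'' : ℝ → ℝ} (hf : ∀ t, HasDerivAt f (f' t) t)
    (hf' : ∀ t, HasDerivAt f' (f'' t) t) (hg : ∀ t, HasDerivAt g (g' t) t)
    (hg' : ∀ t, HasDerivAt g' (g'' t) t) (h0 : f 0 = g 0) (h1 : f' 0 = g' 0)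
    (h2 : ∀ t, 0 ≤ t → f'' t ≤ g'' t) {t : ℝ} (ht : 0 ≤ t) : f t ≤ g t := by
  have aux : ∀ {u u' : ℝ → ℝ}, (∀ t, HasDerivAt u (u' t) t) → (∀ t, 0 ≤ t → 0 ≤ u' t) →
      u 0 = 0 → ∀ t, 0 ≤ t → 0 ≤ u t := by
    intro u u' hu hpos hu0 t ht
    have hm : MonotoneOn u (Set.Ici 0) := by
      refine monotoneOn_of_deriv_nonneg (convex_Ici 0)
        (fun t _ => (hu t).continuousAt.continuousWithinAt)
        (fun t _ => (hu t).differentiableAt.differentiableWithinAt) fun t ht => ?_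
      rw [interior_Ici] at ht
      rw [(hu t).deriv]
      exact hpos t (le_of_lt ht)
    have := hm (Set.self_mem_Ici) ht ht
    rwa [hu0] at this
  have hd : ∀ t, 0 ≤ t → 0 ≤ g' t - f' t :=
    aux (u := fun t => g' t - f' t) (fun t => (hg' t).sub (hf' t))
      (fun t ht => sub_nonneg.2 (h2 t ht)) (by simp [h1])
  have := aux (u := fun t => g t - f t) (fun t => (hg t).sub (hf t)) hd (by simp [h0]) t ht
  linarith

/-- Taylor comparison for a hierarchy of functions each of whose second derivatives is controlled by
the previous function. -/
lemma hierarchy_taylor_le {ψ ψ' ψ'' : ℕ → ℝ → ℝ} {c : ℝ} (hc : 0 ≤ c)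
    (h1 : ∀ p t, HasDerivAt (ψ p) (ψ' p t) t) (h2 : ∀ p t, HasDerivAt (ψ' p) (ψ'' p t) t)
    (hz : ∀ t, ψ'' 0 t ≤ 0) (hs : ∀ p t, ψ'' (p + 1) t ≤ c * ψ p t) (p : ℕ) :
    ∀ {t : ℝ}, 0 ≤ t → ψ p t ≤ ∑ j ∈ Finset.range (p + 1),
      (c ^ j * t ^ (2 * j) / (2 * j).factorial * ψ (p - j) 0
        + c ^ j * t ^ (2 * j + 1) / (2 * j + 1).factorial * ψ' (p - j) 0) := by
  induction p with
  | zero =>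
    intro t ht
    have := le_of_second_deriv_le (f := ψ 0) (g := fun t => ψ 0 0 + t * ψ' 0 0)
      (g' := fun _ => ψ' 0 0) (g'' := fun _ => 0) (h1 0) (h2 0)
      (fun t => by simpa using ((hasDerivAt_id t).mul_const (ψ' 0 0)).const_add (ψ 0 0))
      (fun t => hasDerivAt_const _ _) (by simp) rfl (fun t _ => hz t) ht
    simpa using this
  | succ p ih =>
    intro t ht
    set Q : ℝ → ℝ := fun t => ∑ j ∈ Finset.range (p + 1),
      (c ^ j * t ^ (2 * j) / (2 * j).factorial * ψ (p - j) 0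
        + c ^ j * t ^ (2 * j + 1) / (2 * j + 1).factorial * ψ' (p - j) 0) with hQ
    have dpow : ∀ (k : ℕ) (a b t : ℝ), HasDerivAt (fun t : ℝ => a * t ^ (k + 1) / (k + 1).factorial * b)
        (a * t ^ k / k.factorial * b) t := by
      intro k a b t
      have := (((hasDerivAt_pow (k + 1) t).const_mul a).div_const ((k + 1).factorial : ℝ)).mul_const b
      refine this.congr_deriv ?_
      rw [Nat.factorial_succ]
      have : (k.factorial : ℝ) ≠ 0 := by positivity
      push_cast
      field_simp
    -- The comparison function integrates `c * Q` twice from the initial data of `ψ (p + 1)`, so the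
    -- term of index `j` becomes that of index `j + 1`.
    have := le_of_second_deriv_le (f := ψ (p + 1)) (f' := ψ' (p + 1)) (f'' := ψ'' (p + 1))
      (g := fun t => (∑ j ∈ Finset.range (p + 1),
        (c ^ (j + 1) * t ^ (2 * j + 1 + 1) / (2 * j + 1 + 1).factorial * ψ (p - j) 0
        + c ^ (j + 1) * t ^ (2 * j + 1 + 1 + 1) / (2 * j + 1 + 1 + 1).factorial * ψ' (p - j) 0))
        + (ψ (p + 1) 0 + t * ψ' (p + 1) 0))
      (g' := fun t => (∑ j ∈ Finset.range (p + 1),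
        (c ^ (j + 1) * t ^ (2 * j + 1) / (2 * j + 1).factorial * ψ (p - j) 0
        + c ^ (j + 1) * t ^ (2 * j + 1 + 1) / (2 * j + 1 + 1).factorial * ψ' (p - j) 0))
        + ψ' (p + 1) 0)
      (g'' := fun t => c * Q t) (h1 (p + 1)) (h2 (p + 1))
      (fun t => (HasDerivAt.fun_sum fun j _ => (dpow _ _ _ t).add (dpow _ _ _ t)).add
        (by simpa using ((hasDerivAt_id t).mul_const (ψ' (p + 1) 0)).const_add (ψ (p + 1) 0)))
      (fun t => by
        have h := (HasDerivAt.fun_sum (u := Finset.range (p + 1)) fun j _ =>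
          (dpow (2 * j) (c ^ (j + 1)) (ψ (p - j) 0) t).add
            (dpow (2 * j + 1) (c ^ (j + 1)) (ψ' (p - j) 0) t)).add_const (ψ' (p + 1) 0)
        refine h.congr_deriv ?_
        rw [hQ, Finset.mul_sum]
        refine Finset.sum_congr rfl fun j _ => ?_
        ring)
      (by simp) (by simp)
      (fun t ht => (hs p t).trans (mul_le_mul_of_nonneg_left (ih ht) hc)) ht
    refine this.trans (le_of_eq ?_)
    rw [Finset.sum_range_succ' _ (p + 1)]
    simp [mul_add, add_assoc]

/-- Normalized even trace moments. -/
def traceMoment (p : ℕ) (Y : E →L[ℝ] E) : ℝ := opTrace E (Y ^ (2 * p)) / (2 * p).factorial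

lemma traceMoment_nonneg {Y : E →L[ℝ] E} (hY : Y.IsSymmetric) (p : ℕ) : 0 ≤ traceMoment p Y :=
  div_nonneg (opTrace_pow_even_nonneg hY p) (by positivity)

/-- The first-order term in the expansion of `traceMoment p` around `S`. -/
def traceMomentDeriv (p : ℕ) (S : E →L[ℝ] E) : (E →L[ℝ] E) →L[ℝ] ℝ :=
  ((2 * p : ℕ) / ((2 * p).factorial : ℝ)) •
    (opTrace E).comp ((ContinuousLinearMap.mul ℝ (E →L[ℝ] E)).flip (S ^ (2 * p - 1)))

lemma traceMomentDeriv_apply (p : ℕ) (S X : E →L[ℝ] E) : traceMomentDeriv p S X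
    = ((2 * p : ℕ) / ((2 * p).factorial : ℝ)) * opTrace E (X * S ^ (2 * p - 1)) := rfl

/-- The point of this bound is its dependence on `X`: linear in `X` itself, and otherwise only
through `σ`. Averaging over a centered `X` therefore removes the derivative terms. -/
lemma traceMoment_add_le {S X : E →L[ℝ] E} (hS : S.IsSymmetric) (hX : X.IsSymmetric) {σ : ℝ}
    (hσ : ‖X‖ ≤ σ) (p : ℕ) :
    traceMoment p (S + X) ≤ ∑ j ∈ Finset.range (p + 1),
      ((2 * σ ^ 2) ^ j / (2 * j).factorial * traceMoment (p - j) S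
        + (2 * σ ^ 2) ^ j / (2 * j + 1).factorial * traceMomentDeriv (p - j) S X) := by
  have hsym : ∀ t : ℝ, (S + t • X).IsSymmetric := by
    intro t u v
    have h1 : inner ℝ (S u) v = inner ℝ u (S v) := hS u v
    have h2 : inner ℝ (X u) v = inner ℝ u (X v) := hX u v
    simp [inner_add_left, inner_add_right, inner_smul_left, inner_smul_right, h1, h2]
  have key := hierarchy_taylor_le (c := 2 * σ ^ 2) (by positivity)
    (ψ := fun p t => traceMoment p (S + t • X))
    (ψ' := fun p t => (2 * p : ℕ) / ((2 * p).factorial : ℝ) *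
      opTrace E (X * (S + t • X) ^ (2 * p - 1)))
    (ψ'' := fun p t => (2 * p : ℕ) / ((2 * p).factorial : ℝ) *
      ∑ i ∈ Finset.range (2 * p - 1),
        opTrace E (X * (S + t • X) ^ (2 * p - 1 - 1 - i) * X * (S + t • X) ^ i))
    (fun p t => by
      refine ((hasDerivAt_opTrace_pow S X (2 * p) t).div_const _).congr_deriv ?_
      ring)
    (fun p t => (hasDerivAt_opTrace_mul_pow S X (2 * p - 1) t).const_mul _)
    -- For `p = 0` the factor `2 * p` vanishes, so the hierarchy stops.
    (fun t => by simp)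
    (fun p t => by
      have hsum : ∑ i ∈ Finset.range (2 * (p + 1) - 1),
          opTrace E (X * (S + t • X) ^ (2 * (p + 1) - 1 - 1 - i) * X * (S + t • X) ^ i)
          ≤ (2 * p + 1 : ℕ) * (2 * σ ^ 2 * opTrace E ((S + t • X) ^ (2 * p))) := by
        refine (Finset.sum_le_card_nsmul _ _
          (2 * σ ^ 2 * opTrace E ((S + t • X) ^ (2 * p))) fun i hi => ?_).trans (le_of_eq ?_)
        · have hi := Finset.mem_range.1 hi
          exact opTrace_interlace_le hX (hsym t) hσ (by omega)
        · rw [Finset.card_range, nsmul_eq_mul]; rfl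
      refine (mul_le_mul_of_nonneg_left hsum (by positivity)).trans (le_of_eq ?_)
      have : ((2 * p).factorial : ℝ) ≠ 0 := by positivity
      rw [traceMoment, show 2 * (p + 1) = 2 * p + 1 + 1 by ring, Nat.factorial_succ,
        Nat.factorial_succ]
      push_cast
      field_simp)
    p (t := 1) zero_le_one
  simpa [traceMomentDeriv_apply] using key

end TraceMoments

/-! ### Resampling coordinates of an i.i.d. sequence. -/

section Resampling

variable {ι Ξ : Type*} [MeasurableSpace Ξ]

/-- Replace the coordinates in `s` of the first sequence by those of the second. -/
def resample (s : Set ι) [DecidablePred (· ∈ s)] (p : (ι → Ξ) × (ι → Ξ)) : ι → Ξ :=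
  fun i => if i ∈ s then p.2 i else p.1 i

lemma measurable_resample (s : Set ι) [DecidablePred (· ∈ s)] :
    Measurable (resample s : (ι → Ξ) × (ι → Ξ) → ι → Ξ) := by
  refine measurable_pi_lambda _ fun i => ?_
  unfold resample
  split_ifs
  · exact (measurable_pi_apply i).comp measurable_snd
  · exact (measurable_pi_apply i).comp measurable_fst

/-- It suffices to test finite boxes. The preimage of a box is a product of two boxes over
complementary coordinates, and their measures multiply to that of the box. -/
lemma measurePreserving_resample (D : Measure Ξ) [IsProbabilityMeasure D] (s : Set ι)
    [DecidablePred (· ∈ s)] :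
    MeasurePreserving (resample s) ((Measure.infinitePi fun _ : ι => D).prod
      (Measure.infinitePi fun _ : ι => D)) (Measure.infinitePi fun _ : ι => D) := by
  classical
  refine ⟨measurable_resample s, Measure.eq_infinitePi _ fun T t ht => ?_⟩
  have hpi : MeasurableSet (Set.pi (T : Set ι) t) :=
    MeasurableSet.pi T.countable_toSet fun i _ => ht i
  rw [Measure.map_apply (measurable_resample s) hpi]
  have : resample s ⁻¹' (Set.pi (T : Set ι) t)
      = (Set.pi ((T.filter (· ∉ s) : Finset ι) : Set ι) t) ×ˢ
        (Set.pi ((T.filter (· ∈ s) : Finset ι) : Set ι) t) := by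
    ext p
    simp only [Set.mem_preimage, Set.mem_pi, Set.mem_prod, Finset.coe_filter, Set.mem_ofPred_eq,
      resample, Finset.mem_coe]
    constructor
    · intro h
      refine ⟨fun i hi => ?_, fun i hi => ?_⟩
      · simpa [hi.2] using h i hi.1
      · simpa [hi.2] using h i hi.1
    · intro h i hi
      by_cases his : i ∈ s
      · simpa [his] using h.2 i ⟨hi, his⟩
      · simpa [his] using h.1 i ⟨hi, his⟩
  rw [this, Measure.prod_prod, Measure.infinitePi_pi _ fun i _ => ht i,
    Measure.infinitePi_pi _ fun i _ => ht i, mul_comm,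
    Finset.prod_filter_mul_prod_filter_not]

end Resampling

/-! ### Moment and tail bounds for sums of independent symmetric operators. -/

section MomentBound

variable {E : Type*} [NormedAddCommGroup E] [InnerProductSpace ℝ E]

lemma isSymmetric_sum {N : ℕ} {Y : ℕ → E →L[ℝ] E} (h : ∀ r, (Y r).IsSymmetric) :
    (∑ r ∈ Finset.range N, Y r).IsSymmetric := by
  intro u v
  have h' : ∀ r, inner ℝ (Y r u) v = inner ℝ u (Y r v) := fun r => h r u v
  simp [sum_inner, inner_sum, h']

variable [FiniteDimensional ℝ E]
variable {Ξ : Type*} [MeasurableSpace Ξ] {D : Measure Ξ} [IsProbabilityMeasure D]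

/-- The gap between `(2 * j)!` and `j!` absorbs the powers of 2 lost in `opTrace_interlace_le`. -/
lemma two_sq_pow_div_factorial_le (σ : ℝ) (j : ℕ) :
    (2 * σ ^ 2) ^ j / (2 * j).factorial ≤ (σ ^ 2) ^ j / j.factorial := by
  have h : (2 : ℝ) ^ j * j.factorial ≤ (2 * j).factorial := by
    exact_mod_cast Nat.two_pow_mul_factorial_le_factorial_two_mul j
  rw [div_le_div_iff₀ (by positivity) (by positivity), mul_pow]
  calc 2 ^ j * (σ ^ 2) ^ j * j.factorial = (σ ^ 2) ^ j * (2 ^ j * j.factorial) := by ring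
    _ ≤ _ := by gcongr

lemma continuous_traceMoment (p : ℕ) : Continuous (traceMoment p : (E →L[ℝ] E) → ℝ) :=
  ((opTrace E).continuous.comp (continuous_id.pow _)).div_const _

/-- Adding a centered bounded random term to a fixed symmetric operator. -/
lemma lintegral_traceMoment_add_le {X : Ξ → E →L[ℝ] E} (hX : StronglyMeasurable X)
    (hsym : ∀ ξ, (X ξ).IsSymmetric) {σ : ℝ} (hσ : ∀ᵐ ξ ∂D, ‖X ξ‖ ≤ σ) (h0 : ∫ ξ, X ξ ∂D = 0)
    {S : E →L[ℝ] E} (hS : S.IsSymmetric) (p : ℕ) :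
    ∫⁻ ξ, ENNReal.ofReal (traceMoment p (S + X ξ)) ∂D ≤ ∑ j ∈ Finset.range (p + 1),
      ENNReal.ofReal ((σ ^ 2) ^ j / j.factorial) * ENNReal.ofReal (traceMoment (p - j) S) := by
  have hint : Integrable X D := Integrable.of_bound hX.aestronglyMeasurable σ hσ
  set g : Ξ → ℝ := fun ξ => ∑ j ∈ Finset.range (p + 1),
      ((2 * σ ^ 2) ^ j / (2 * j).factorial * traceMoment (p - j) S
        + (2 * σ ^ 2) ^ j / (2 * j + 1).factorial * traceMomentDeriv (p - j) S (X ξ)) with hg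
  have hle : ∀ᵐ ξ ∂D, traceMoment p (S + X ξ) ≤ g ξ := by
    filter_upwards [hσ] with ξ hξ
    exact traceMoment_add_le hS (hsym ξ) hξ p
  have hpos : 0 ≤ᵐ[D] g := by
    filter_upwards [hle] with ξ hξ
    refine (traceMoment_nonneg (fun u v => ?_) p).trans hξ
    have h1 : inner ℝ (S u) v = inner ℝ u (S v) := hS u v
    have h2 : inner ℝ (X ξ u) v = inner ℝ u (X ξ v) := hsym ξ u v
    simp [inner_add_left, inner_add_right, h1, h2]
  have hterm : ∀ j, Integrable (fun ξ => (2 * σ ^ 2) ^ j / (2 * j).factorial * traceMoment (p - j) S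
        + (2 * σ ^ 2) ^ j / (2 * j + 1).factorial * traceMomentDeriv (p - j) S (X ξ)) D := fun j =>
    (integrable_const _).add (((traceMomentDeriv (p - j) S).integrable_comp hint).const_mul _)
  have hgint : Integrable g D := integrable_finsetSum _ fun j _ => hterm j
  have hI : ∫ ξ, g ξ ∂D = ∑ j ∈ Finset.range (p + 1),
      (2 * σ ^ 2) ^ j / (2 * j).factorial * traceMoment (p - j) S := by
    rw [hg, integral_finsetSum _ fun j _ => hterm j]
    refine Finset.sum_congr rfl fun j _ => ?_
    -- The derivative term is a continuous linear functional of `X ξ`, so its integral is its value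
    -- at the mean, which is zero.
    rw [integral_add (integrable_const _)
      (((traceMomentDeriv (p - j) S).integrable_comp hint).const_mul _),
      integral_const_mul _ (fun ξ => traceMomentDeriv (p - j) S (X ξ)),
      (traceMomentDeriv (p - j) S).integral_comp_comm hint, h0]
    simp
  calc ∫⁻ ξ, ENNReal.ofReal (traceMoment p (S + X ξ)) ∂D
      ≤ ∫⁻ ξ, ENNReal.ofReal (g ξ) ∂D :=
        lintegral_mono_ae (hle.mono fun ξ h => ENNReal.ofReal_le_ofReal h)
    _ = ENNReal.ofReal (∫ ξ, g ξ ∂D) := (ofReal_integral_eq_lintegral_ofReal hgint hpos).symm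
    _ ≤ ENNReal.ofReal (∑ j ∈ Finset.range (p + 1),
          (σ ^ 2) ^ j / j.factorial * traceMoment (p - j) S) := by
        rw [hI]
        refine ENNReal.ofReal_le_ofReal (Finset.sum_le_sum fun j _ => ?_)
        exact mul_le_mul_of_nonneg_right (two_sq_pow_div_factorial_le σ j)
          (traceMoment_nonneg hS _)
    _ = _ := by
        rw [ENNReal.ofReal_sum_of_nonneg fun j _ =>
          mul_nonneg (by positivity) (traceMoment_nonneg hS _)]
        refine Finset.sum_congr rfl fun j _ => ENNReal.ofReal_mul (by positivity)

/-- The binomial theorem in factorial normalization. Applied with `x = σ ^ 2` and `y = N * σ ^ 2`,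
it closes the induction on the number of summands. -/
lemma sum_pow_div_factorial (x y : ℝ) (p : ℕ) : ∑ j ∈ Finset.range (p + 1),
    x ^ j / j.factorial * (y ^ (p - j) / (p - j).factorial) = (x + y) ^ p / p.factorial := by
  rw [add_pow, Finset.sum_div]
  refine Finset.sum_congr rfl fun j hj => ?_
  have hj : j ≤ p := Nat.lt_succ_iff.1 (Finset.mem_range.1 hj)
  rw [Nat.cast_choose ℝ hj]
  field_simp

/-- Even trace moments of a sum of independent centered bounded symmetric operators. -/
lemma lintegral_traceMoment_sum_le {ι : Type*} {X : Ξ → E →L[ℝ] E} (hX : StronglyMeasurable X)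
    (hsym : ∀ ξ, (X ξ).IsSymmetric) {σ : ℝ} (hσ : ∀ᵐ ξ ∂D, ‖X ξ‖ ≤ σ) (h0 : ∫ ξ, X ξ ∂D = 0)
    {idx : ℕ → ι} (hidx : Function.Injective idx) (N p : ℕ) :
    ∫⁻ z, ENNReal.ofReal (traceMoment p (∑ r ∈ Finset.range N, X (z (idx r))))
      ∂(Measure.infinitePi fun _ : ι => D)
      ≤ ENNReal.ofReal (Module.finrank ℝ E * ((N * σ ^ 2) ^ p / p.factorial)) := by
  classical
  have hsm : ∀ N, StronglyMeasurable fun z : ι → Ξ => ∑ r ∈ Finset.range N, X (z (idx r)) :=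
    fun N => Finset.stronglyMeasurable_fun_sum _ fun r _ =>
      hX.comp_measurable (measurable_pi_apply _)
  have hmeas : ∀ N p, Measurable fun z : ι → Ξ =>
      ENNReal.ofReal (traceMoment p (∑ r ∈ Finset.range N, X (z (idx r)))) := fun N p =>
    ((continuous_traceMoment p).comp_stronglyMeasurable (hsm N)).measurable.ennreal_ofReal
  induction N generalizing p with
  | zero =>
    rw [Finset.range_zero]
    simp only [Finset.sum_empty, lintegral_const, measure_univ, mul_one]
    refine ENNReal.ofReal_le_ofReal (le_of_eq ?_)
    rcases Nat.eq_zero_or_pos p with rfl | hp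
    · simp [traceMoment, opTrace_one]
    · simp [traceMoment, hp.ne']
  | succ N ih =>
    -- Taking the last sample from an independent copy turns the expectation into an iterated
    -- integral, with the first `N` terms fixed inside.
    have hmp := measurePreserving_resample (ι := ι) D {idx N}
    have hres : ∀ q : (ι → Ξ) × (ι → Ξ),
        ∑ r ∈ Finset.range (N + 1), X (resample {idx N} q (idx r))
          = (∑ r ∈ Finset.range N, X (q.1 (idx r))) + X (q.2 (idx N)) := by
      intro q
      rw [Finset.sum_range_succ]
      congr 1
      · refine Finset.sum_congr rfl fun r hr => ?_
        have : idx r ≠ idx N := fun h => (Finset.mem_range.1 hr).ne (hidx h)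
        simp [resample, this]
      · simp [resample]
    rw [← hmp.lintegral_comp (hmeas (N + 1) p)]
    simp only [hres]
    have hm2 : Measurable fun q : (ι → Ξ) × (ι → Ξ) => ENNReal.ofReal (traceMoment p
        ((∑ r ∈ Finset.range N, X (q.1 (idx r))) + X (q.2 (idx N)))) := by
      have := (hmeas (N + 1) p).comp (measurable_resample (Ξ := Ξ) {idx N})
      simpa only [Function.comp_def, hres] using this
    rw [lintegral_prod _ hm2.aemeasurable]
    calc ∫⁻ z, ∫⁻ z', ENNReal.ofReal (traceMoment p
          ((∑ r ∈ Finset.range N, X (z (idx r))) + X (z' (idx N))))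
          ∂(Measure.infinitePi fun _ : ι => D) ∂(Measure.infinitePi fun _ : ι => D)
        ≤ ∫⁻ z, ∑ j ∈ Finset.range (p + 1), ENNReal.ofReal ((σ ^ 2) ^ j / j.factorial) *
            ENNReal.ofReal (traceMoment (p - j) (∑ r ∈ Finset.range N, X (z (idx r))))
            ∂(Measure.infinitePi fun _ : ι => D) := by
          refine lintegral_mono fun z => ?_
          have hf : Measurable fun ξ => ENNReal.ofReal (traceMoment p
              ((∑ r ∈ Finset.range N, X (z (idx r))) + X ξ)) :=
            ((continuous_traceMoment p).comp_stronglyMeasurable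
              (stronglyMeasurable_const.add hX)).measurable.ennreal_ofReal
          have := (measurePreserving_eval_infinitePi (fun _ : ι => D) (idx N)).lintegral_comp hf
          refine (le_of_eq this).trans ?_
          exact lintegral_traceMoment_add_le hX hsym hσ h0 (isSymmetric_sum fun r => hsym _) p
      _ ≤ ∑ j ∈ Finset.range (p + 1), ENNReal.ofReal ((σ ^ 2) ^ j / j.factorial) *
            ENNReal.ofReal (Module.finrank ℝ E * ((N * σ ^ 2) ^ (p - j) / (p - j).factorial)) := by
          rw [lintegral_finsetSum _ fun j _ => (hmeas N (p - j)).const_mul _]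
          refine Finset.sum_le_sum fun j _ => ?_
          rw [lintegral_const_mul _ (hmeas N (p - j))]
          exact mul_le_mul_right (ih (p - j)) _
      _ = _ := by
          rw [Finset.sum_congr rfl fun j _ => (ENNReal.ofReal_mul (by positivity)).symm,
            ← ENNReal.ofReal_sum_of_nonneg fun j _ => by positivity]
          congr 1
          rw [show ((N + 1 : ℕ) : ℝ) * σ ^ 2 = σ ^ 2 + N * σ ^ 2 by push_cast; ring,
            ← sum_pow_div_factorial, Finset.mul_sum]
          refine Finset.sum_congr rfl fun j _ => ?_
          ring

lemma factorial_two_mul_div_le (p : ℕ) : ((2 * p).factorial : ℝ) / p.factorial ≤ (2 * p : ℝ) ^ p := by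
  rw [div_le_iff₀ (by positivity)]
  have h1 := Nat.factorial_mul_descFactorial (show p ≤ 2 * p by omega)
  rw [show 2 * p - p = p by omega] at h1
  have h2 : (2 * p).factorial ≤ (2 * p) ^ p * p.factorial := by
    rw [← h1, mul_comm]
    exact Nat.mul_le_mul_right _ (Nat.descFactorial_le_pow _ _)
  exact_mod_cast h2

/-- Tail bound for sums of independent centered bounded symmetric operators. -/
lemma measure_norm_sum_symm_gt_le {ι : Type*} {X : Ξ → E →L[ℝ] E} (hX : StronglyMeasurable X)
    (hsym : ∀ ξ, (X ξ).IsSymmetric) {σ : ℝ} (hσ : ∀ᵐ ξ ∂D, ‖X ξ‖ ≤ σ) (h0 : ∫ ξ, X ξ ∂D = 0)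
    {idx : ℕ → ι} (hidx : Function.Injective idx) (N : ℕ) {p : ℕ} (hp : p ≠ 0) :
    (Measure.infinitePi fun _ : ι => D)
      {z | 6 * p * N * σ ^ 2 < ‖∑ r ∈ Finset.range N, X (z (idx r))‖ ^ 2}
      ≤ ENNReal.ofReal (Module.finrank ℝ E * (1 / 3) ^ p) := by
  set μ := Measure.infinitePi fun _ : ι => D
  set f : (ι → Ξ) → ENNReal := fun z =>
    ENNReal.ofReal (traceMoment p (∑ r ∈ Finset.range N, X (z (idx r)))) with hf
  have hfm : Measurable f :=
    ((continuous_traceMoment p).comp_stronglyMeasurable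
      (Finset.stronglyMeasurable_fun_sum _ fun r _ =>
        hX.comp_measurable (measurable_pi_apply (idx r)))).measurable.ennreal_ofReal
  have hmom := lintegral_traceMoment_sum_le hX hsym hσ h0 hidx N p
  set T : ℝ := 6 * p * N * σ ^ 2 with hT
  have hT0 : 0 ≤ T := by positivity
  have hsub : {z : ι → Ξ | T < ‖∑ r ∈ Finset.range N, X (z (idx r))‖ ^ 2}
      ⊆ {z | ENNReal.ofReal (T ^ p / (2 * p).factorial) < f z} := by
    intro z hz
    have hs : (∑ r ∈ Finset.range N, X (z (idx r))).IsSymmetric := isSymmetric_sum fun r => hsym _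
    have hz' : √T < ‖∑ r ∈ Finset.range N, X (z (idx r))‖ :=
      (Real.sqrt_lt' (by
        by_contra h
        have h1 : ‖∑ r ∈ Finset.range N, X (z (idx r))‖ = 0 :=
          le_antisymm (not_lt.1 h) (norm_nonneg _)
        have hz : T < ‖∑ r ∈ Finset.range N, X (z (idx r))‖ ^ 2 := hz
        rw [h1] at hz
        norm_num at hz
        linarith)).2 hz
    have h1 : T ^ p < opTrace E ((∑ r ∈ Finset.range N, X (z (idx r))) ^ (2 * p)) := by
      by_contra h
      have := norm_le_of_opTrace_pow_le hs (Real.sqrt_nonneg T) hp (by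
        rw [pow_mul (√T), Real.sq_sqrt hT0]; exact not_lt.1 h)
      linarith
    have h2 : T ^ p / (2 * p).factorial
        < traceMoment p (∑ r ∈ Finset.range N, X (z (idx r))) := by
      unfold traceMoment
      gcongr
    exact (ENNReal.ofReal_lt_ofReal_iff_of_nonneg (by positivity)).2 h2
  refine (measure_mono hsub).trans ?_
  -- For a zero threshold Markov's inequality is unavailable. Then `N * σ ^ 2 = 0`, so the moment
  -- integral vanishes and the event is null.
  rcases hT0.eq_or_lt with hT1 | hT1
  · have hz : ((N : ℝ) * σ ^ 2) ^ p = 0 := by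
      have : (N : ℝ) * σ ^ 2 = 0 := by
        have h6 : (6 * (p : ℝ)) ≠ 0 := by positivity
        have : (6 * (p : ℝ)) * (N * σ ^ 2) = 0 := by rw [hT1, hT]; ring
        exact (mul_eq_zero.1 this).resolve_left h6
      rw [this, zero_pow hp]
    rw [hz] at hmom
    have h3 : ∫⁻ z, f z ∂μ = 0 := by simpa using hmom
    rw [lintegral_eq_zero_iff hfm] at h3
    refine le_trans (le_of_eq ?_) zero_le
    rw [← hT1, zero_pow hp]
    refine measure_mono_null (t := {z | ¬ f z = (0 : (ι → Ξ) → ENNReal) z}) ?_ h3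
    intro z hz
    simpa [pos_iff_ne_zero] using hz
  · have hb : (0 : ℝ) < T ^ p / (2 * p).factorial := by positivity
    have hb' : ENNReal.ofReal (T ^ p / (2 * p).factorial) ≠ 0 := by simpa using hb
    calc μ {z | ENNReal.ofReal (T ^ p / (2 * p).factorial) < f z}
        ≤ μ {z | ENNReal.ofReal (T ^ p / (2 * p).factorial) ≤ f z} :=
          measure_mono fun z hz => by
            rw [Set.mem_ofPred_eq] at hz ⊢
            exact hz.le
      _ ≤ (∫⁻ z, f z ∂μ) / ENNReal.ofReal (T ^ p / (2 * p).factorial) :=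
          meas_ge_le_lintegral_div hfm.aemeasurable hb' ENNReal.ofReal_ne_top
      _ ≤ ENNReal.ofReal (Module.finrank ℝ E * ((N * σ ^ 2) ^ p / p.factorial))
          / ENNReal.ofReal (T ^ p / (2 * p).factorial) := by gcongr
      _ = ENNReal.ofReal (Module.finrank ℝ E * ((N * σ ^ 2) ^ p / p.factorial)
          / (T ^ p / (2 * p).factorial)) := (ENNReal.ofReal_div_of_pos hb).symm
      _ ≤ _ := by
        refine ENNReal.ofReal_le_ofReal ?_
        have hNs : 0 < (N : ℝ) * σ ^ 2 := by
          by_contra h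
          have h0 : (N : ℝ) * σ ^ 2 = 0 := le_antisymm (not_lt.1 h) (by positivity)
          have : T = (6 * (p : ℝ)) * (N * σ ^ 2) := by rw [hT]; ring
          rw [this, h0] at hT1
          simp at hT1
        have hp' : (0 : ℝ) < p := by positivity
        -- The constant 6 splits as `3 * 2`: the factor `(2 * p) ^ p` beats `(2p)! / p!`, and `3 ^
        -- p` is the gain.
        have e1 : T ^ p = (3 : ℝ) ^ p * (2 * p) ^ p * (N * σ ^ 2) ^ p := by
          rw [hT, ← mul_pow, ← mul_pow]; ring_nf
        rw [e1]
        have e2 : (Module.finrank ℝ E : ℝ) * ((N * σ ^ 2) ^ p / p.factorial)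
            / ((3 : ℝ) ^ p * (2 * p) ^ p * (N * σ ^ 2) ^ p / (2 * p).factorial)
            = Module.finrank ℝ E * (1 / 3) ^ p *
              (((2 * p).factorial : ℝ) / p.factorial / (2 * p) ^ p) := by
          rw [div_pow, one_pow]
          field_simp
        rw [e2]
        refine mul_le_of_le_one_right (by positivity) ?_
        rw [div_le_one (by positivity)]
        exact factorial_two_mul_div_le p

end MomentBound

/-! ### From rectangular to symmetric operators. -/

section Dilation

variable {F G : Type*} [NormedAddCommGroup F] [InnerProductSpace ℝ F] [FiniteDimensional ℝ F]
  [NormedAddCommGroup G] [InnerProductSpace ℝ G] [FiniteDimensional ℝ G]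

/-- The self-adjoint dilation `(u, v) ↦ (J v, J† u)`. -/
def dilation : (F →L[ℝ] G) →L[ℝ] (WithLp 2 (G × F) →L[ℝ] WithLp 2 (G × F)) :=
  LinearMap.toContinuousLinearMap
    { toFun := fun J =>
        ((WithLp.prodContinuousLinearEquiv 2 ℝ G F).symm : G × F →L[ℝ] WithLp 2 (G × F)) ∘L
          ((J ∘L ContinuousLinearMap.snd ℝ G F).prod
            ((ContinuousLinearMap.adjoint J) ∘L ContinuousLinearMap.fst ℝ G F)) ∘L
          (WithLp.prodContinuousLinearEquiv 2 ℝ G F : WithLp 2 (G × F) →L[ℝ] G × F)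
      map_add' := fun J J' => by ext x; simp; rfl
      map_smul' := fun c J => by ext x; simp; rfl }

lemma dilation_apply (J : F →L[ℝ] G) (w : WithLp 2 (G × F)) :
    dilation J w = WithLp.toLp 2 (J w.snd, ContinuousLinearMap.adjoint J w.fst) := rfl

lemma dilation_isSymmetric (J : F →L[ℝ] G) : (dilation J).IsSymmetric := by
  intro u v
  change inner ℝ (dilation J u) v = inner ℝ u (dilation J v)
  rw [dilation_apply, dilation_apply, WithLp.prod_inner_apply, WithLp.prod_inner_apply]
  simp only [ContinuousLinearMap.adjoint_inner_left, ContinuousLinearMap.adjoint_inner_right]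
  exact add_comm _ _

/-- `J` and its adjoint have equal norms and act on orthogonal components. With
`norm_le_norm_dilation` this transfers bounds on summands and tails of sums in both directions
without loss. -/
lemma norm_dilation_le (J : F →L[ℝ] G) : ‖dilation J‖ ≤ ‖J‖ := by
  refine ContinuousLinearMap.opNorm_le_bound _ (norm_nonneg _) fun w => ?_
  refine le_of_sq_le_sq ?_ (by positivity)
  rw [dilation_apply, WithLp.prod_norm_sq_eq_of_L2, mul_pow, WithLp.prod_norm_sq_eq_of_L2]
  have h1 := J.le_opNorm w.snd
  have h2 := (ContinuousLinearMap.adjoint J).le_opNorm w.fst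
  rw [LinearIsometryEquiv.norm_map] at h2
  have h3 := pow_le_pow_left₀ (norm_nonneg _) h1 2
  have h4 := pow_le_pow_left₀ (norm_nonneg _) h2 2
  rw [mul_pow] at h3 h4
  change ‖J w.snd‖ ^ 2 + ‖ContinuousLinearMap.adjoint J w.fst‖ ^ 2 ≤ _
  linarith

lemma norm_le_norm_dilation (J : F →L[ℝ] G) : ‖J‖ ≤ ‖dilation J‖ := by
  refine ContinuousLinearMap.opNorm_le_bound J (norm_nonneg (dilation J)) fun v => ?_
  have h := (dilation J).le_opNorm (WithLp.toLp 2 (0, v))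
  rw [dilation_apply] at h
  simpa using h

lemma finrank_withLp_prod :
    Module.finrank ℝ (WithLp 2 (G × F)) = Module.finrank ℝ G + Module.finrank ℝ F := by
  rw [(WithLp.linearEquiv 2 ℝ (G × F)).finrank_eq, Module.finrank_prod]

end Dilation

/-! ### Tail bounds for batch means of random matrices and vectors. -/

section BatchTail

variable {Ξ : Type*} [MeasurableSpace Ξ] {D : Measure Ξ} [IsProbabilityMeasure D]

/-- Deviation of a batch mean of random matrices. -/
lemma measure_norm_mean_gt_le {F G : Type*} [NormedAddCommGroup F] [InnerProductSpace ℝ F]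
    [FiniteDimensional ℝ F] [NormedAddCommGroup G] [InnerProductSpace ℝ G] [FiniteDimensional ℝ G]
    {ι : Type*} {X : Ξ → F →L[ℝ] G} (hX : StronglyMeasurable X)
    {R : ℝ} (hR : ∀ᵐ ξ ∂D, ‖X ξ‖ ≤ R) (h0 : ∫ ξ, X ξ ∂D = 0)
    {idx : ℕ → ι} (hidx : Function.Injective idx) {N : ℕ} {C L : ℝ} (hC : 0 < C) (hL : 1 ≤ L)
    (hN : C * L ≤ N) :
    (Measure.infinitePi fun _ : ι => D)
      {z | 12 * R ^ 2 / C < ‖(N : ℝ)⁻¹ • ∑ r ∈ Finset.range N, X (z (idx r))‖ ^ 2}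
      ≤ ENNReal.ofReal ((Module.finrank ℝ G + Module.finrank ℝ F) * Real.exp (-L)) := by
  have hNpos : (0 : ℝ) < N := lt_of_lt_of_le (by positivity) hN
  -- As `1 ≤ L`, also `p ≤ 2 * L`, so `6 * p * N ≤ 12 * N ^ 2 / C`. In the other direction `L ≤ p`
  -- and `1 / 3 ≤ exp (-1)` turn the tail into `exp (-L)`.
  set p := ⌈L⌉₊ with hp
  have hLp : L ≤ p := Nat.le_ceil L
  have hpL : (p : ℝ) ≤ 2 * L := by have := Nat.ceil_lt_add_one (zero_le_one.trans hL); linarith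
  have hp0 : p ≠ 0 := (Nat.ceil_pos.2 (by linarith)).ne'
  have hR' : ∀ᵐ ξ ∂D, ‖dilation (X ξ)‖ ≤ R := hR.mono fun ξ h => (norm_dilation_le _).trans h
  have hint : Integrable X D := Integrable.of_bound hX.aestronglyMeasurable R hR
  have h0' : ∫ ξ, dilation (X ξ) ∂D = 0 := by
    have h := ContinuousLinearMap.integral_comp_comm (𝕜 := ℝ)
      (Fₗ := WithLp 2 (G × F) →L[ℝ] WithLp 2 (G × F)) (dilation (F := F) (G := G)) hint
    rw [h, h0, map_zero]
  have key := measure_norm_sum_symm_gt_le (dilation.continuous.comp_stronglyMeasurable hX)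
    (fun ξ => dilation_isSymmetric (X ξ)) hR' h0' hidx N hp0
  refine (measure_mono ?_).trans (key.trans (ENNReal.ofReal_le_ofReal ?_))
  · intro z hz
    have hz : 12 * R ^ 2 / C < ‖(N : ℝ)⁻¹ • ∑ r ∈ Finset.range N, X (z (idx r))‖ ^ 2 := hz
    change 6 * p * N * R ^ 2 < ‖∑ r ∈ Finset.range N, dilation (X (z (idx r)))‖ ^ 2
    rw [← map_sum]
    refine lt_of_lt_of_le ?_ (pow_le_pow_left₀ (norm_nonneg _) (norm_le_norm_dilation _) 2)
    rw [norm_smul, mul_pow, norm_inv, Real.norm_natCast, inv_pow, inv_mul_eq_div,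
      lt_div_iff₀ (by positivity)] at hz
    refine lt_of_le_of_lt ?_ hz
    have h1 : (6 : ℝ) * p ≤ 12 * N / C := by
      rw [le_div_iff₀ hC]
      nlinarith
    calc 6 * (p : ℝ) * N * R ^ 2 ≤ (12 * N / C) * N * R ^ 2 := by gcongr
      _ = _ := by ring
  · rw [finrank_withLp_prod]
    push_cast
    refine mul_le_mul_of_nonneg_left ?_ (by positivity)
    calc (1 / 3 : ℝ) ^ p ≤ (Real.exp (-1)) ^ p := by
          gcongr
          rw [Real.exp_neg, one_div]
          exact inv_anti₀ (Real.exp_pos 1) (by linarith [Real.exp_one_lt_d9])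
      _ = Real.exp (-p) := by rw [← Real.exp_nat_mul]; simp
      _ ≤ Real.exp (-L) := Real.exp_le_exp.2 (by linarith)

/-- Deviation of a batch mean of random vectors. -/
lemma measure_norm_mean_vec_gt_le {m : ℕ} {ι : Type*} {X : Ξ → Vec m} (hX : StronglyMeasurable X)
    {R : ℝ} (hR : ∀ᵐ ξ ∂D, ‖X ξ‖ ≤ R) (h0 : ∫ ξ, X ξ ∂D = 0)
    {idx : ℕ → ι} (hidx : Function.Injective idx) {N : ℕ} {C L : ℝ} (hC : 0 < C) (hL : 1 ≤ L)
    (hN : C * L ≤ N) :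
    (Measure.infinitePi fun _ : ι => D)
      {z | 12 * R ^ 2 / C < ‖(N : ℝ)⁻¹ • ∑ r ∈ Finset.range N, X (z (idx r))‖ ^ 2}
      ≤ ENNReal.ofReal ((m + 1) * Real.exp (-L)) := by
  -- A vector is an operator from `ℝ` with the same norm, so the dimension factor is `m + 1`.
  set T : Vec m →L[ℝ] (ℝ →L[ℝ] Vec m) :=
    (ContinuousLinearMap.smulRightL ℝ ℝ (Vec m)) (ContinuousLinearMap.id ℝ ℝ) with hT
  have hTn : ∀ v, ‖T v‖ = ‖v‖ := by
    intro v
    simp [hT, ContinuousLinearMap.norm_smulRight_apply]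
  have hint : Integrable X D := Integrable.of_bound hX.aestronglyMeasurable R hR
  have key := measure_norm_mean_gt_le (T.continuous.comp_stronglyMeasurable hX)
    (hR.mono fun ξ h => (hTn _).trans_le h)
    (by rw [T.integral_comp_comm hint, h0, map_zero]) hidx hC hL hN
  simp only [← map_sum, ← map_smul, hTn] at key
  simpa using key

end BatchTail

/-! ### The prox-linear step and its inexact version. -/

section ProxLinear

/-- Mean value inequality on the ball of radius `‖y - x‖` around `x`. It gives the constant `L`
instead of the sharp `L / 2`, which suffices because `M` exceeds `5 * lf * Lg`. -/
lemma norm_sub_linearization_le {n m : ℕ} {F : Vec n → Vec m} {L : ℝ≥0} (hF : Differentiable ℝ F)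
    (hL : LipschitzWith L (fderiv ℝ F)) (x y : Vec n) :
    ‖F y - F x - fderiv ℝ F x (y - x)‖ ≤ L * ‖y - x‖ ^ 2 := by
  have h := (convex_closedBall x ‖y - x‖).norm_image_sub_le_of_norm_fderiv_le'
    (𝕜 := ℝ) (f := F) (φ := fderiv ℝ F x) (C := L * ‖y - x‖) (fun z _ => hF z)
    (fun z hz => by
      refine (hL.norm_sub_le z x).trans ?_
      have : ‖z - x‖ ≤ ‖y - x‖ := by simpa [dist_eq_norm] using hz
      gcongr)
    (Metric.mem_closedBall_self (norm_nonneg _)) (y := y) (by simp [dist_eq_norm])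
  rw [sq, ← mul_assoc]
  exact h

namespace CompositeProblem

variable {n m : ℕ} {Ξ : Type u} [MeasurableSpace Ξ] {P : CompositeProblem n m Ξ} {lf lg Lg : ℝ≥0}

/-- The objective as a real number (meaningful on the domain of `h`). -/
def realΦ (P : CompositeProblem n m Ξ) (x : Vec n) : ℝ := P.f (P.g x) + (P.h x).toReal

lemma Standing.coe_toReal_h (hP : P.Standing lf lg Lg) {x : Vec n} (hx : P.h x ≠ ⊤) :
    ((P.h x).toReal : EReal) = P.h x := EReal.coe_toReal hx (hP.h_ne_bot x)

lemma Standing.coe_realΦ (hP : P.Standing lf lg Lg) {x : Vec n} (hx : P.h x ≠ ⊤) :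
    (P.realΦ x : EReal) = P.Φ x := by
  rw [realΦ, EReal.coe_add, hP.coe_toReal_h hx]; rfl

lemma Standing.model_eq_coe (hP : P.Standing lf lg Lg) (M : ℝ) (x : Vec n) (u : Vec m) (J : Jac n m)
    {y : Vec n} (hy : P.h y ≠ ⊤) :
    P.model M x u J y = ((P.f (u + J (y - x)) + (P.h y).toReal + M / 2 * ‖y - x‖ ^ 2 : ℝ) : EReal) := by
  rw [EReal.coe_add, EReal.coe_add, hP.coe_toReal_h hy]; rfl

lemma model_eq_top (M : ℝ) (x : Vec n) (u : Vec m) (J : Jac n m)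
    {y : Vec n} (hy : P.h y = ⊤) : P.model M x u J y = ⊤ := by
  rw [model, hy, EReal.coe_add_top, EReal.top_add_coe]

lemma h_ne_top_of_Φ {x : Vec n} (hx : P.Φ x ≠ ⊤) :
    P.h x ≠ ⊤ := by
  intro h
  exact hx (by rw [Φ, h, EReal.coe_add_top])

/-- The infimum of the objective is a real number. -/
lemma Standing.exists_iInf_eq (hP : P.Standing lf lg Lg) (hinf : ⊥ < ⨅ x, P.Φ x) :
    ∃ c : ℝ, (⨅ x, P.Φ x) = c ∧ ∀ x, P.h x ≠ ⊤ → c ≤ P.realΦ x := by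
  obtain ⟨y, hy⟩ := hP.h_proper
  have hle := iInf_le P.Φ y
  rw [← hP.coe_realΦ hy] at hle
  have hne : (⨅ x, P.Φ x) ≠ ⊤ := fun h => by rw [h] at hle; exact EReal.coe_ne_top _ (top_le_iff.1 hle)
  refine ⟨(⨅ x, P.Φ x).toReal, (EReal.coe_toReal hne hinf.ne').symm, fun x hx => ?_⟩
  have h := iInf_le P.Φ x
  rw [← hP.coe_realΦ hx, ← EReal.coe_toReal hne hinf.ne'] at h
  exact EReal.coe_le_coe_iff.1 h

lemma Standing.continuous_f (hP : P.Standing lf lg Lg) : Continuous P.f := hP.f_lipschitz.continuous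

lemma Standing.f_le (hP : P.Standing lf lg Lg) (u v : Vec m) : P.f u ≤ P.f v + lf * ‖u - v‖ := by
  have h := hP.f_lipschitz.dist_le_mul u v
  rw [Real.dist_eq, dist_eq_norm] at h
  linarith [le_abs_self (P.f u - P.f v)]

lemma Standing.f_g_le (hP : P.Standing lf lg Lg) (x y : Vec n) :
    P.f (P.g y) ≤ P.f (P.g x + fderiv ℝ P.g x (y - x)) + lf * (Lg * ‖y - x‖ ^ 2) := by
  refine (hP.f_le _ (P.g x + fderiv ℝ P.g x (y - x))).trans ?_
  have := norm_sub_linearization_le hP.g_differentiable hP.g_jac_lipschitz x y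
  rw [sub_sub] at this
  gcongr

lemma Standing.lowerSemicontinuous_model (hP : P.Standing lf lg Lg) (M : ℝ) (x : Vec n) (u : Vec m)
    (J : Jac n m) : LowerSemicontinuous (P.model M x u J) := by
  have hf := hP.continuous_f
  have c1 : Continuous fun y : Vec n => ((P.f (u + J (y - x)) : ℝ) : EReal) :=
    continuous_coe_real_ereal.comp (by fun_prop)
  have c2 : Continuous fun y : Vec n => ((M / 2 * ‖y - x‖ ^ 2 : ℝ) : EReal) :=
    continuous_coe_real_ereal.comp (by fun_prop)
  refine (c1.lowerSemicontinuous.add' hP.h_closed fun y => ?_).add' c2.lowerSemicontinuous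
    fun y => ?_
  · exact EReal.continuousAt_add (Or.inl (EReal.coe_ne_top _)) (Or.inl (EReal.coe_ne_bot _))
  · exact EReal.continuousAt_add (Or.inr (EReal.coe_ne_bot _)) (Or.inr (EReal.coe_ne_top _))

/-- The exact model has a minimizer. -/
lemma Standing.exists_isMin_model (hP : P.Standing lf lg Lg) (hinf : ⊥ < ⨅ x, P.Φ x) {M : ℝ}
    (hM : 2 * (lf : ℝ) * Lg < M) (x : Vec n) :
    ∃ y, ∀ z, P.model M x (P.g x) (fderiv ℝ P.g x) y ≤ P.model M x (P.g x) (fderiv ℝ P.g x) z := by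
  obtain ⟨c, -, hc⟩ := hP.exists_iInf_eq hinf
  obtain ⟨y₀, hy₀⟩ := hP.h_proper
  set φ := P.model M x (P.g x) (fderiv ℝ P.g x) with hφ
  obtain ⟨v, hv⟩ : ∃ v : ℝ, φ y₀ = v := ⟨_, hP.model_eq_coe M x _ _ hy₀⟩
  -- By `f_g_le` the model is at least `Φ y + κ * ‖y - x‖ ^ 2`. Since `Φ` is bounded below, the
  -- model is coercive, and a minimizer over a large closed ball is global.
  set κ : ℝ := M / 2 - lf * Lg with hκ
  have hκ0 : 0 < κ := by rw [hκ]; linarith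
  have hlow : ∀ y, ((c + κ * ‖y - x‖ ^ 2 : ℝ) : EReal) ≤ φ y := by
    intro y
    by_cases hy : P.h y = ⊤
    · rw [hφ, model_eq_top M x _ _ hy]; exact le_top
    · rw [hφ, hP.model_eq_coe M x _ _ hy, EReal.coe_le_coe_iff]
      have h1 := hc y hy
      have h2 := hP.f_g_le x y
      rw [realΦ] at h1
      rw [hκ]
      linarith
  set R : ℝ := max ‖y₀ - x‖ (√((|v - c| + 1) / κ)) with hR
  have hy₀R : y₀ ∈ Metric.closedBall x R := by
    rw [mem_closedBall_iff_norm]; exact le_max_left _ _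
  obtain ⟨y, hyR, hy⟩ := ((hP.lowerSemicontinuous_model M x _ _).lowerSemicontinuousOn
    (Metric.closedBall x R)).exists_isMinOn ⟨y₀, hy₀R⟩ (isCompact_closedBall x R)
  refine ⟨y, fun z => ?_⟩
  by_cases hz : z ∈ Metric.closedBall x R
  · exact hy hz
  · refine (hy hy₀R).trans ?_
    refine le_trans ?_ (hlow z)
    change φ y₀ ≤ _
    rw [hv, EReal.coe_le_coe_iff]
    rw [mem_closedBall_iff_norm, not_le] at hz
    have h1 : √((|v - c| + 1) / κ) ≤ ‖z - x‖ := (le_max_right _ _).trans hz.le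
    have h2 := (Real.sqrt_le_left (norm_nonneg _)).1 h1
    rw [div_le_iff₀ hκ0] at h2
    linarith [le_abs_self (v - c)]

lemma Standing.proxLinear_spec (hP : P.Standing lf lg Lg) (hinf : ⊥ < ⨅ x, P.Φ x) {M : ℝ}
    (hM : 2 * (lf : ℝ) * Lg < M) (x z : Vec n) :
    P.model M x (P.g x) (fderiv ℝ P.g x) (P.proxLinear M x)
      ≤ P.model M x (P.g x) (fderiv ℝ P.g x) z :=
  Classical.epsilon_spec (hP.exists_isMin_model hinf hM x) z

lemma Standing.h_proxLinear_ne_top (hP : P.Standing lf lg Lg) (hinf : ⊥ < ⨅ x, P.Φ x) {M : ℝ}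
    (hM : 2 * (lf : ℝ) * Lg < M) (x : Vec n) : P.h (P.proxLinear M x) ≠ ⊤ := by
  intro h
  obtain ⟨y, hy⟩ := hP.h_proper
  have := hP.proxLinear_spec hinf hM x y
  rw [model_eq_top M x _ _ h, hP.model_eq_coe M x _ _ hy] at this
  exact EReal.coe_ne_top _ (top_le_iff.1 this)

/-- The model decreases by strong convexity along the exact prox-linear step. -/
lemma Standing.proxLinear_decrease (hP : P.Standing lf lg Lg) (hinf : ⊥ < ⨅ x, P.Φ x) {M : ℝ}
    (hM : 2 * (lf : ℝ) * Lg < M) {x : Vec n} (hx : P.h x ≠ ⊤) :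
    P.f (P.g x + fderiv ℝ P.g x (P.proxLinear M x - x)) + (P.h (P.proxLinear M x)).toReal
      + M * ‖P.proxLinear M x - x‖ ^ 2 ≤ P.realΦ x := by
  set w := P.proxLinear M x with hw
  set J := fderiv ℝ P.g x
  have hwt : P.h w ≠ ⊤ := hP.h_proxLinear_ne_top hinf hM x
  -- The minimizer `w` is compared with the point a fraction `t` of the way to `x`. Convexity bounds
  -- the nonquadratic part, and `t` can be divided out.
  have key : ∀ t : ℝ, 0 < t → t < 1 →
      P.f (P.g x + J (w - x)) + (P.h w).toReal + M / 2 * ‖w - x‖ ^ 2 * (2 - t) ≤ P.realΦ x := by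
    intro t ht0 ht1
    set z := (1 - t) • w + t • x with hz
    have hzx : z - x = (1 - t) • (w - x) := by rw [hz]; module
    have hmem : ∀ {y : Vec n}, P.h y ≠ ⊤ →
        (y, (P.h y).toReal) ∈ {p : Vec n × ℝ | P.h p.1 ≤ (p.2 : EReal)} := fun {y} hy => by
      rw [Set.mem_ofPred_eq, hP.coe_toReal_h hy]
    have hconv := hP.h_convex (hmem hwt) (hmem hx) (show (0 : ℝ) ≤ 1 - t by linarith) ht0.le
      (by ring)
    rw [Set.mem_ofPred_eq] at hconv
    have hconv : P.h z ≤ (((1 - t) * (P.h w).toReal + t * (P.h x).toReal : ℝ) : EReal) := hconv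
    have hzt : P.h z ≠ ⊤ := fun h => by
      rw [h] at hconv; exact EReal.coe_ne_top _ (top_le_iff.1 hconv)
    rw [← hP.coe_toReal_h hzt, EReal.coe_le_coe_iff] at hconv
    have hf := hP.f_convex.2 (Set.mem_univ (P.g x + J (w - x))) (Set.mem_univ (P.g x))
      (show (0 : ℝ) ≤ 1 - t by linarith) ht0.le (by ring)
    have harg : (1 - t) • (P.g x + J (w - x)) + t • P.g x = P.g x + J (z - x) := by
      rw [hzx, map_smul]; module
    rw [harg, smul_eq_mul, smul_eq_mul] at hf
    have hmin := hP.proxLinear_spec hinf hM x z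
    rw [← hw, hP.model_eq_coe M x _ _ hwt, hP.model_eq_coe M x _ _ hzt,
      EReal.coe_le_coe_iff] at hmin
    have hn : ‖z - x‖ ^ 2 = (1 - t) ^ 2 * ‖w - x‖ ^ 2 := by
      rw [hzx, norm_smul, mul_pow, Real.norm_eq_abs, sq_abs]
    rw [hn] at hmin
    rw [realΦ]
    have : t * (P.f (P.g x + J (w - x)) + (P.h w).toReal + M / 2 * ‖w - x‖ ^ 2 * (2 - t))
        ≤ t * (P.f (P.g x) + (P.h x).toReal) := by
      linear_combination hmin + hf + hconv
    exact le_of_mul_le_mul_left this ht0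
  by_contra hcon
  rw [not_le] at hcon
  set a := P.f (P.g x + J (w - x)) + (P.h w).toReal
  set b := M / 2 * ‖w - x‖ ^ 2 with hb
  have hb0 : 0 ≤ b := by
    have : 0 ≤ M := le_trans (by positivity) hM.le
    positivity
  set d := a + M * ‖w - x‖ ^ 2 - P.realΦ x with hd
  have hd0 : 0 < d := by linarith
  -- In place of a limit `t → 0`: this `t` makes the loss `b * t` at most half of the supposed
  -- violation `d`. The `+ 1` covers `b = 0`.
  have hk := key (min (1 / 2) (d / (2 * (b + 1)))) (by positivity)
    (lt_of_le_of_lt (min_le_left _ _) (by norm_num))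
  have h1 : b * min (1 / 2) (d / (2 * (b + 1))) ≤ d / 2 := by
    calc b * min (1 / 2) (d / (2 * (b + 1))) ≤ (b + 1) * (d / (2 * (b + 1))) := by
          gcongr
          · linarith
          · exact min_le_right _ _
      _ = d / 2 := by field_simp
  have h2 : M * ‖w - x‖ ^ 2 = 2 * b := by rw [hb]; ring
  rw [h2] at hd
  nlinarith

/-- Descent of one inexact prox-linear step with inexact value `u` and Jacobian `J`. -/
lemma Standing.inexact_step (hP : P.Standing lf lg Lg) (hinf : ⊥ < ⨅ x, P.Φ x) {M : ℝ}
    (hM : 2 * (lf : ℝ) * Lg < M) {x x' : Vec n} (hx : P.h x ≠ ⊤) {u : Vec m} {J : Jac n m} {η : ℝ}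
    (hx' : P.model M x u J x' ≤ (⨅ y, P.model M x u J y) + (η : EReal)) :
    P.h x' ≠ ⊤ ∧ P.realΦ x' ≤ P.realΦ x - M / 2 * ‖P.proxLinear M x - x‖ ^ 2
      + 2 * lf * ‖u - P.g x‖
      + lf * ‖J - fderiv ℝ P.g x‖ * (‖P.proxLinear M x - x‖ + ‖x' - x‖)
      - (M / 2 - lf * Lg) * ‖x' - x‖ ^ 2 + η := by
  set w := P.proxLinear M x with hw
  have hwt : P.h w ≠ ⊤ := hP.h_proxLinear_ne_top hinf hM x
  have hle : P.model M x u J x' ≤ P.model M x u J w + (η : EReal) :=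
    hx'.trans (add_le_add_left (iInf_le _ _) _)
  rw [hP.model_eq_coe M x _ _ hwt, ← EReal.coe_add] at hle
  have hxt : P.h x' ≠ ⊤ := fun h => by
    rw [model_eq_top M x _ _ h] at hle; exact EReal.coe_ne_top _ (top_le_iff.1 hle)
  refine ⟨hxt, ?_⟩
  rw [hP.model_eq_coe M x _ _ hxt, EReal.coe_le_coe_iff] at hle
  have hdec := hP.proxLinear_decrease hinf hM hx
  rw [← hw] at hdec
  -- Exact and inexact models are exchanged twice, at `w` and at `x'`. Hence the value error counts
  -- twice and the Jacobian error is multiplied by the sum of both step lengths.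
  have hlin : ∀ y, ‖(u + J (y - x)) - (P.g x + fderiv ℝ P.g x (y - x))‖
      ≤ ‖u - P.g x‖ + ‖J - fderiv ℝ P.g x‖ * ‖y - x‖ := by
    intro y
    have : (u + J (y - x)) - (P.g x + fderiv ℝ P.g x (y - x))
        = (u - P.g x) + (J - fderiv ℝ P.g x) (y - x) := by
      rw [sub_apply]; abel
    rw [this]
    exact (norm_add_le _ _).trans (add_le_add_right (ContinuousLinearMap.le_opNorm _ _) _)
  have h1 := hP.f_le (u + J (w - x)) (P.g x + fderiv ℝ P.g x (w - x))
  have h2 := hP.f_le (P.g x + fderiv ℝ P.g x (x' - x)) (u + J (x' - x))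
  rw [norm_sub_rev] at h2
  have h3 := hP.f_g_le x x'
  have h4 := mul_le_mul_of_nonneg_left (hlin w) lf.coe_nonneg
  have h5 := mul_le_mul_of_nonneg_left (hlin x') lf.coe_nonneg
  rw [realΦ]
  linear_combination hle + hdec + h1 + h2 + h3 + h4 + h5

end CompositeProblem

end ProxLinear

/-! ### Descent over an epoch and over the whole run. -/

section EpochDescent

/-- Young's inequality applied to the descent of one inexact step. -/
lemma descent_of_young {φ φ' M lf Lg r s eg eJ η : ℝ} (hM0 : 0 < M) (hM : 5 * lf * Lg < M)
    (h : φ' ≤ φ - M / 2 * r ^ 2 + 2 * lf * eg + lf * eJ * (r + s) - (M / 2 - lf * Lg) * s ^ 2 + η) :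
    φ' ≤ φ - M / 4 * r ^ 2 - M / 5 * s ^ 2 + (2 * lf * eg + 7 / 2 * lf ^ 2 * eJ ^ 2 / M) + η := by
  have h1 : lf * eJ * r ≤ M / 4 * r ^ 2 + lf ^ 2 * eJ ^ 2 / M := by
    have : M / 4 * r ^ 2 + lf ^ 2 * eJ ^ 2 / M - lf * eJ * r = (M * r / 2 - lf * eJ) ^ 2 / M := by
      field_simp; ring
    have : 0 ≤ (M * r / 2 - lf * eJ) ^ 2 / M := by positivity
    linarith
  have h2 : lf * eJ * s ≤ M / 10 * s ^ 2 + 5 / 2 * (lf ^ 2 * eJ ^ 2 / M) := by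
    have : M / 10 * s ^ 2 + 5 / 2 * (lf ^ 2 * eJ ^ 2 / M) - lf * eJ * s
        = (M * s - 5 * (lf * eJ)) ^ 2 / (10 * M) := by
      field_simp; ring
    have : 0 ≤ (M * s - 5 * (lf * eJ)) ^ 2 / (10 * M) := by positivity
    linarith
  -- The origin of the 5: Young's inequality uses `M / 10` and the conclusion keeps `M / 5`, so `M /
  -- 5 - lf * Lg` remains of `M / 2 - lf * Lg`.
  have h3 : 0 ≤ (M / 5 - lf * Lg) * s ^ 2 := mul_nonneg (by linarith) (sq_nonneg _)
  have h4 : 7 / 2 * lf ^ 2 * eJ ^ 2 / M = lf ^ 2 * eJ ^ 2 / M + 5 / 2 * (lf ^ 2 * eJ ^ 2 / M) := by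
    ring
  rw [h4]
  linarith

/-- The estimation errors are dominated by the squared distance `δ²` (scaled by the epoch length)
to the reference point and by the accuracy. -/
lemma error_le {M lf ε δ j τ eg eJ e₀g e₀J : ℝ} (hM : 0 < M) (hlf : 0 ≤ lf) (hδ : 0 ≤ δ)
    (hτ : 1 ≤ τ) (heJ0 : 0 ≤ eJ) (he₀J : 0 ≤ e₀J) (hj : j = τ * e₀J)
    (hg : eg ≤ M / (40 * (lf + 1)) * δ ^ 2 + e₀g + e₀J * (τ * δ))
    (hJ : eJ ≤ M / (9 * (lf + 1)) * δ + e₀J) (h₀g : e₀g ≤ ε / (80 * M * (lf + 1)))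
    (h₀J : j ^ 2 ≤ ε / (1080 * (lf + 1) ^ 2)) :
    2 * lf * eg + 7 / 2 * lf ^ 2 * eJ ^ 2 / M ≤ M / 5 * δ ^ 2 + ε / (20 * M) := by
  -- `lf` may vanish; `lf + 1` is a positive upper bound that can be divided by.
  obtain ⟨l, hl⟩ : ∃ l, l = lf + 1 := ⟨_, rfl⟩
  rw [← hl] at hg hJ h₀g h₀J
  have hl0 : 0 < l := by linarith
  have hj0 : 0 ≤ j := by rw [hj]; positivity
  have hjJ : e₀J ≤ j := by rw [hj]; nlinarith
  have h₀g0 : 0 ≤ ε := by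
    have : 0 ≤ ε / (1080 * l ^ 2) := (sq_nonneg j).trans h₀J
    by_contra h
    have : ε / (1080 * l ^ 2) < 0 := div_neg_of_neg_of_pos (not_le.1 h) (by positivity)
    linarith
  have hb : (0 : ℝ) ≤ M / (40 * l) * δ ^ 2 + ε / (80 * M * l) + j * δ := by positivity
  have h1 : 2 * lf * eg ≤ M / 20 * δ ^ 2 + ε / (40 * M) + 2 * l * (j * δ) := by
    calc 2 * lf * eg ≤ 2 * lf * (M / (40 * l) * δ ^ 2 + ε / (80 * M * l) + j * δ) := by
          gcongr
          rw [hj]; linarith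
      _ ≤ 2 * l * (M / (40 * l) * δ ^ 2 + ε / (80 * M * l) + j * δ) := by
          gcongr; linarith
      _ = _ := by field_simp; ring
  -- The stored Jacobian error acts on the full distance `τ * δ`. Young's inequality therefore needs
  -- `(τ * e₀J) ^ 2` of order `ε`, which is the reason for `τ ^ 2` in the batch size `B`.
  have h2 : 2 * l * (j * δ) ≤ M / 20 * δ ^ 2 + 20 * l ^ 2 * j ^ 2 / M := by
    have : M / 20 * δ ^ 2 + 20 * l ^ 2 * j ^ 2 / M - 2 * l * (j * δ)
        = (M * δ - 20 * l * j) ^ 2 / (20 * M) := by field_simp; ring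
    have : 0 ≤ (M * δ - 20 * l * j) ^ 2 / (20 * M) := by positivity
    linarith
  have h3 : eJ ^ 2 ≤ 2 * (M / (9 * l) * δ) ^ 2 + 2 * j ^ 2 := by
    have : eJ ^ 2 ≤ (M / (9 * l) * δ + j) ^ 2 := pow_le_pow_left₀ heJ0 (by linarith) 2
    nlinarith [sq_nonneg (M / (9 * l) * δ - j)]
  have h4 : 7 / 2 * lf ^ 2 * eJ ^ 2 / M ≤ M / 10 * δ ^ 2 + 7 * l ^ 2 * j ^ 2 / M := by
    calc 7 / 2 * lf ^ 2 * eJ ^ 2 / M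
        ≤ 7 / 2 * l ^ 2 * (2 * (M / (9 * l) * δ) ^ 2 + 2 * j ^ 2) / M := by
          gcongr; linarith
      _ = 7 / 81 * M * δ ^ 2 + 7 * l ^ 2 * j ^ 2 / M := by field_simp; ring
      _ ≤ _ := by nlinarith [mul_nonneg hM.le (sq_nonneg δ)]
  have h5 : 20 * l ^ 2 * j ^ 2 / M + 7 * l ^ 2 * j ^ 2 / M ≤ ε / (40 * M) := by
    calc 20 * l ^ 2 * j ^ 2 / M + 7 * l ^ 2 * j ^ 2 / M = 27 * l ^ 2 / M * j ^ 2 := by ring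
      _ ≤ 27 * l ^ 2 / M * (ε / (1080 * l ^ 2)) := by gcongr
      _ = ε / (40 * M) := by field_simp; ring
  have h6 : ε / (20 * M) = ε / (40 * M) + ε / (40 * M) := by field_simp; ring
  rw [h6]
  linarith

/-- Squared distances to the start of a path, in terms of its squared steps. -/
lemma sum_sq_dist_le {V : Type*} [NormedAddCommGroup V] (y : ℕ → V) (τ : ℕ) :
    ∑ i ∈ Finset.range τ, ‖y i - y 0‖ ^ 2
      ≤ (τ : ℝ) ^ 2 * ∑ i ∈ Finset.range τ, ‖y (i + 1) - y i‖ ^ 2 := by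
  have h : ∀ i ∈ Finset.range τ, ‖y i - y 0‖ ^ 2
      ≤ τ * ∑ j ∈ Finset.range τ, ‖y (j + 1) - y j‖ ^ 2 := by
    intro i hi
    have hi := (Finset.mem_range.1 hi).le
    have h1 : ‖y i - y 0‖ ≤ ∑ j ∈ Finset.range i, ‖y (j + 1) - y j‖ := by
      rw [← Finset.sum_range_sub]; exact norm_sum_le _ _
    calc ‖y i - y 0‖ ^ 2 ≤ (∑ j ∈ Finset.range i, ‖y (j + 1) - y j‖) ^ 2 := by gcongr
      _ ≤ i * ∑ j ∈ Finset.range i, ‖y (j + 1) - y j‖ ^ 2 := by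
          simpa using sq_sum_le_card_mul_sum_sq (s := Finset.range i)
            (f := fun j => ‖y (j + 1) - y j‖)
      _ ≤ τ * ∑ j ∈ Finset.range τ, ‖y (j + 1) - y j‖ ^ 2 := by
          gcongr
  refine (Finset.sum_le_card_nsmul _ _ _ h).trans (le_of_eq ?_)
  rw [Finset.card_range, nsmul_eq_mul]
  ring

/-- After division by `τ ^ 2`, the summed squared distances are at most the summed squared steps
(`sum_sq_dist_le`), so the two terms with `M / 5` cancel over a whole epoch, though not step by
step. -/
lemma epoch_descent {V : Type*} [NormedAddCommGroup V] {M e : ℝ} (hM : 0 < M) {τ : ℕ}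
    (hτ : 0 < τ) (y : ℕ → V) (φ : V → ℝ) (r : ℕ → ℝ)
    (h : ∀ i < τ, φ (y (i + 1)) ≤ φ (y i) - M / 4 * r i ^ 2 - M / 5 * ‖y (i + 1) - y i‖ ^ 2
      + M / 5 * (‖y i - y 0‖ / τ) ^ 2 + e) :
    φ (y τ) ≤ φ (y 0) - M / 4 * ∑ i ∈ Finset.range τ, r i ^ 2 + τ * e := by
  have h1 : ∑ i ∈ Finset.range τ, (φ (y (i + 1)) - φ (y i)) ≤ ∑ i ∈ Finset.range τ,
      (-(M / 4 * r i ^ 2) - M / 5 * ‖y (i + 1) - y i‖ ^ 2 + M / 5 * (‖y i - y 0‖ / τ) ^ 2 + e) :=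
    Finset.sum_le_sum fun i hi => by linarith [h i (Finset.mem_range.1 hi)]
  rw [Finset.sum_range_sub (fun i => φ (y i))] at h1
  simp only [Finset.sum_add_distrib, Finset.sum_sub_distrib, Finset.sum_neg_distrib,
    ← Finset.mul_sum, Finset.sum_const, Finset.card_range, nsmul_eq_mul, div_pow,
    ← Finset.sum_div] at h1
  have hτ' : (0 : ℝ) < (τ : ℝ) ^ 2 := by positivity
  have h2 : (∑ i ∈ Finset.range τ, ‖y i - y 0‖ ^ 2) / (τ : ℝ) ^ 2
      ≤ ∑ i ∈ Finset.range τ, ‖y (i + 1) - y i‖ ^ 2 := by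
    rw [div_le_iff₀' hτ']; exact sum_sq_dist_le y τ
  have h3 := mul_le_mul_of_nonneg_left h2 (show 0 ≤ M / 5 by positivity)
  linarith

/-- Average stationarity from the descent over all epochs. -/
lemma average_le_of_descent {M gap ε : ℝ} (hM : 0 < M) (hε : 0 < ε) {K τ : ℕ}
    (hKτ : 8 * M * (|gap| + 1) * ε⁻¹ ≤ K * τ) (φ : ℕ → ℝ) (r : ℕ → ℕ → ℝ)
    (hgap : φ 0 - φ K ≤ gap)
    (h : ∀ k < K, φ (k + 1) ≤ φ k - M / 4 * ∑ i ∈ Finset.range τ, r k i ^ 2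
      + τ * (ε / (20 * M) + ε / (150 * M))) :
    1 / ((K : ℝ) * τ) * ∑ k ∈ Finset.range K, ∑ i ∈ Finset.range τ, (M * r k i) ^ 2 ≤ ε := by
  have h1 : ∑ k ∈ Finset.range K, (φ (k + 1) - φ k) ≤ ∑ k ∈ Finset.range K,
      (-(M / 4 * ∑ i ∈ Finset.range τ, r k i ^ 2) + τ * (ε / (20 * M) + ε / (150 * M))) :=
    Finset.sum_le_sum fun k hk => by linarith [h k (Finset.mem_range.1 hk)]
  rw [Finset.sum_range_sub] at h1
  simp only [Finset.sum_add_distrib, Finset.sum_neg_distrib, ← Finset.mul_sum, Finset.sum_const,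
    Finset.card_range, nsmul_eq_mul] at h1
  set S := ∑ k ∈ Finset.range K, ∑ i ∈ Finset.range τ, r k i ^ 2 with hS
  have hpos : 0 < (K : ℝ) * τ := lt_of_lt_of_le (by positivity) hKτ
  have h2 : ∑ k ∈ Finset.range K, ∑ i ∈ Finset.range τ, (M * r k i) ^ 2 = M ^ 2 * S := by
    simp only [mul_pow, ← Finset.mul_sum, hS]
  rw [h2, one_div, inv_mul_le_iff₀ hpos]
  have h3 : M * |gap| * 8 ≤ K * τ * ε := by
    have : 8 * M * (|gap| + 1) * ε⁻¹ * ε ≤ K * τ * ε := by gcongr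
    rw [inv_mul_cancel_right₀ hε.ne'] at this
    nlinarith [abs_nonneg gap]
  have h4 : M / 4 * S ≤ |gap| + K * τ * (ε / (20 * M) + ε / (150 * M)) := by
    linarith [le_abs_self gap]
  have h5 := mul_le_mul_of_nonneg_left h4 (show 0 ≤ 4 * M by positivity)
  have h6 : 4 * M * (|gap| + K * τ * (ε / (20 * M) + ε / (150 * M)))
      = 4 * (M * |gap|) + (K * τ * ε) * (4 * (1 / 20 + 1 / 150)) := by
    field_simp
  rw [h6] at h5
  have h7 : 0 < K * τ * ε := by positivity
  -- The gap uses at most half of `K * τ * ε`, and the error terms use `4 * (1 / 20 + 1 / 150)` of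
  -- it; together this is less than 1.
  nlinarith

end EpochDescent

/-! ### Numbers of oracle calls. -/

section OracleCounts

variable {n m : ℕ} {Ξ : Type u} [MeasurableSpace Ξ] {S : Type v}

@[simp] lemma Counted.evals_bind {α β : Type} (c : Counted α) (k : α → Counted β) :
    (c >>= k).evals = c.evals + (k c.val).evals := rfl

@[simp] lemma Counted.jacs_bind {α β : Type} (c : Counted α) (k : α → Counted β) :
    (c >>= k).jacs = c.jacs + (k c.val).jacs := rfl

@[simp] lemma Counted.val_bind {α β : Type} (c : Counted α) (k : α → Counted β) :
    (c >>= k).val = (k c.val).val := rfl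

@[simp] lemma Counted.evals_pure {α : Type} (a : α) : (pure a : Counted α).evals = 0 := rfl

@[simp] lemma Counted.jacs_pure {α : Type} (a : α) : (pure a : Counted α).jacs = 0 := rfl

@[simp] lemma Counted.val_pure {α : Type} (a : α) : (pure a : Counted α).val = a := rfl

/-- After the start of an epoch, each value sample costs two evaluations and, for its correction,
one Jacobian; each Jacobian sample costs two Jacobians. Nothing depends on the samples, so the
counts hold in every run. -/
lemma estimator_evals (P : CompositeProblem n m Ξ) (θ : BatchSizes) (zA zB : ℕ → Ξ) (i : ℕ)
    (st : PLState n m) :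
    (estimator P θ zA zB i st).evals = if i = 0 then θ.A else 2 * θ.a := by
  unfold estimator
  split_ifs <;> simp [Counted.sum, evalOracle, jacOracle, mul_comm]

lemma estimator_jacs (P : CompositeProblem n m Ξ) (θ : BatchSizes) (zA zB : ℕ → Ξ) (i : ℕ)
    (st : PLState n m) :
    (estimator P θ zA zB i st).jacs = if i = 0 then θ.B else θ.a + 2 * θ.b := by
  unfold estimator
  split_ifs <;> simp [Counted.sum, evalOracle, jacOracle, mul_comm]

lemma plInner_evals (P : CompositeProblem n m Ξ) (I : PLInput n S) (ω : Tape Ξ S) (k i : ℕ)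
    (st : PLState n m) :
    (plInner P I ω k (i + 1) st).evals = I.θ.A + 2 * I.θ.a * i := by
  induction i with
  | zero => simp [plInner, plStep, estimator_evals]
  | succ i ih =>
    rw [plInner, Counted.evals_bind, ih]
    simp [plStep, estimator_evals]
    ring

lemma plInner_jacs (P : CompositeProblem n m Ξ) (I : PLInput n S) (ω : Tape Ξ S) (k i : ℕ)
    (st : PLState n m) :
    (plInner P I ω k (i + 1) st).jacs = I.θ.B + (I.θ.a + 2 * I.θ.b) * i := by
  induction i with
  | zero => simp [plInner, plStep, estimator_jacs]
  | succ i ih =>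
    rw [plInner, Counted.jacs_bind, ih]
    simp [plStep, estimator_jacs]
    ring

lemma plOuter_evals (P : CompositeProblem n m Ξ) (I : PLInput n S) {τ : ℕ} (hτ : 0 < τ)
    (ω : Tape Ξ S) (K : ℕ) :
    ((plOuter P I (fun _ => τ) ω K).evals : ℝ) = K * (I.θ.A + 2 * I.θ.a * (τ - 1)) := by
  obtain ⟨t, rfl⟩ := Nat.exists_eq_succ_of_ne_zero hτ.ne'
  induction K with
  | zero => simp [plOuter]
  | succ K ih =>
    rw [plOuter, Counted.evals_bind, plInner_evals, Nat.cast_add, ih]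
    push_cast
    ring

lemma plOuter_jacs (P : CompositeProblem n m Ξ) (I : PLInput n S) {τ : ℕ} (hτ : 0 < τ)
    (ω : Tape Ξ S) (K : ℕ) :
    ((plOuter P I (fun _ => τ) ω K).jacs : ℝ) = K * (I.θ.B + (I.θ.a + 2 * I.θ.b) * (τ - 1)) := by
  obtain ⟨t, rfl⟩ := Nat.exists_eq_succ_of_ne_zero hτ.ne'
  induction K with
  | zero => simp [plOuter]
  | succ K ih =>
    rw [plOuter, Counted.jacs_bind, plInner_jacs, Nat.cast_add, ih]
    push_cast
    ring

end OracleCounts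

/-! ### Real inequalities behind the asymptotic rates. -/

section Asymptotics

/-- The logarithmic factors in the batch sizes. -/
lemma log_factor_bounds {d Q N Δ ε Δ₀ : ℝ} (hd : 1 ≤ d) (hN1 : 1 ≤ N) (hNQ : N ≤ Q * ε⁻¹)
    (hΔ : 0 < Δ) (hΔ₀ : Δ ≤ Δ₀) (hΔ₁ : Δ₀ < 1) (hε : 0 < ε) (hε' : ε < 1 / 2) :
    Real.log (4 * d * N / Δ) ≤ (|Real.log (4 * d * Q)| / (Real.log (1 / Δ₀) * Real.log 2)
      + 1 / Real.log (1 / Δ₀) + 1 / Real.log 2) * (Real.log (1 / Δ) * Real.log (1 / ε)) := by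
  have hΔ₀' : 0 < Δ₀ := hΔ.trans_le hΔ₀
  have l0 : 0 < Real.log (1 / Δ₀) := Real.log_pos (by rw [lt_div_iff₀ hΔ₀']; linarith)
  have l1 : Real.log (1 / Δ₀) ≤ Real.log (1 / Δ) :=
    Real.log_le_log (by positivity) (one_div_le_one_div_of_le hΔ hΔ₀)
  have e0 : 0 < Real.log 2 := Real.log_pos (by norm_num)
  have e1 : Real.log 2 ≤ Real.log (1 / ε) :=
    Real.log_le_log (by norm_num) (by rw [le_div_iff₀ hε]; linarith)
  have hQ : 0 < Q := by
    by_contra h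
    have : Q * ε⁻¹ ≤ 0 := mul_nonpos_of_nonpos_of_nonneg (not_lt.1 h) (by positivity)
    linarith
  have h1 : Real.log (4 * d * N / Δ)
      ≤ |Real.log (4 * d * Q)| + Real.log (1 / ε) + Real.log (1 / Δ) := by
    calc Real.log (4 * d * N / Δ) ≤ Real.log (4 * d * Q * (1 / ε) * (1 / Δ)) := by
          refine Real.log_le_log (by positivity) ?_
          calc 4 * d * N / Δ ≤ 4 * d * (Q * ε⁻¹) / Δ := by gcongr
            _ = _ := by ring
      _ = Real.log (4 * d * Q) + Real.log (1 / ε) + Real.log (1 / Δ) := by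
          rw [Real.log_mul (by positivity) (by positivity), Real.log_mul (by positivity)
            (by positivity)]
      _ ≤ _ := by gcongr; exact le_abs_self _
  set a := |Real.log (4 * d * Q)|
  set l := Real.log (1 / Δ)
  set e := Real.log (1 / ε)
  set b := Real.log (1 / Δ₀)
  set g := Real.log 2
  have hl : 0 < l := l0.trans_le l1
  have he : 0 < e := e0.trans_le e1
  have ha : 0 ≤ a := abs_nonneg _
  -- Both `l` and `e` are bounded away from zero, because `Δ ≤ Δ₀ < 1` and `ε < 1 / 2`. Hence a
  -- constant, `e` and `l` are each dominated by the product `l * e`.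
  have h2 : a ≤ a / (b * g) * (l * e) := by
    rw [div_mul_eq_mul_div, le_div_iff₀ (by positivity)]
    gcongr
  have h3 : e ≤ 1 / b * (l * e) := by
    rw [div_mul_eq_mul_div, le_div_iff₀ (by positivity)]
    nlinarith
  have h4 : l ≤ 1 / g * (l * e) := by
    rw [div_mul_eq_mul_div, le_div_iff₀ (by positivity)]
    nlinarith
  linarith

lemma natCeil_le_of_one_le {x y : ℝ} (hx : 0 ≤ x) (hy : 1 ≤ y) : (⌈x * y⌉₊ : ℝ) ≤ (x + 1) * y := by
  have := (Nat.ceil_lt_add_one (show 0 ≤ x * y by positivity)).le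
  linarith

/-- Lower bound of an oracle complexity: `N₀` calls at the start of each of `K` epochs and `N` in
each of the other `τ - 1` iterations. -/
lemma complexity_lower {CK C₀ C₁ u t l T K N₀ N : ℝ} {τ : ℕ} (hτ : 0 < τ) (ht : t = τ)
    (hCK : 0 < CK) (hC₀ : 0 < C₀) (hC₁ : 0 < C₁) (hu : 0 < u) (hl : 0 ≤ l) (hT0 : 0 ≤ T)
    (hT1 : τ = 1 → u ≤ T) (hK : CK * (u / t) ≤ K) (hN₀ : C₀ * (T * t / u) * l ≤ N₀)
    (hN : C₁ * t ^ 4 * l ≤ N) :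
    CK * min (C₀ / 2) (C₁ / 2) * ((T + u * t ^ 4) * l) ≤ K * (N₀ + N * (t - 1)) := by
  have ht0 : 0 < t := by rw [ht]; exact_mod_cast hτ
  have ht1 : 0 ≤ t - 1 := by rw [ht, sub_nonneg]; exact_mod_cast hτ
  have hN0 : 0 ≤ N := le_trans (by positivity) hN
  have hK0 : 0 ≤ K := le_trans (by positivity) hK
  have hN₀0 : 0 ≤ N₀ := le_trans (by positivity) hN₀
  have h1 : CK * C₀ * (T * l) ≤ K * N₀ := by
    calc CK * C₀ * (T * l) = CK * (u / t) * (C₀ * (T * t / u) * l) := by field_simp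
      _ ≤ K * N₀ := by gcongr
  have h2 : 0 ≤ K * (N * (t - 1)) := by positivity
  have hmin0 : 0 ≤ min (C₀ / 2) (C₁ / 2) := by positivity
  -- For `τ = 1` the inner iterations are absent, and the term `u * t ^ 4` must be covered by `T`.
  -- For `τ ≥ 2` one has `τ - 1 ≥ τ / 2`.
  rcases (Nat.succ_le_of_lt hτ).eq_or_lt with h | h
  · have ht' : t = 1 := by rw [ht, ← h]; norm_num
    have hTu : u * t ^ 4 ≤ T := by rw [ht', one_pow, mul_one]; exact hT1 h.symm
    calc CK * min (C₀ / 2) (C₁ / 2) * ((T + u * t ^ 4) * l) ≤ CK * (C₀ / 2) * ((T + T) * l) := by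
          gcongr
          exact min_le_left _ _
      _ = CK * C₀ * (T * l) := by ring
      _ ≤ K * N₀ := h1
      _ ≤ _ := by rw [mul_add]; linarith
  · have ht2 : t / 2 ≤ t - 1 := by
      have : (2 : ℝ) ≤ t := by rw [ht]; exact_mod_cast h
      linarith
    have h3 : CK * (C₁ / 2) * (u * t ^ 4 * l) ≤ K * (N * (t - 1)) := by
      calc CK * (C₁ / 2) * (u * t ^ 4 * l) = CK * (u / t) * (C₁ * t ^ 4 * l * (t / 2)) := by
            field_simp
        _ ≤ K * (N * (t - 1)) := by gcongr
    calc CK * min (C₀ / 2) (C₁ / 2) * ((T + u * t ^ 4) * l)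
        = CK * min (C₀ / 2) (C₁ / 2) * (T * l) + CK * min (C₀ / 2) (C₁ / 2) * (u * t ^ 4 * l) := by
          ring
      _ ≤ CK * (C₀ / 2) * (T * l) + CK * (C₁ / 2) * (u * t ^ 4 * l) := by
          gcongr
          · exact min_le_left _ _
          · exact min_le_right _ _
      _ ≤ K * N₀ + K * (N * (t - 1)) := by
          have : CK * (C₀ / 2) * (T * l) ≤ CK * C₀ * (T * l) := by gcongr; linarith
          linarith
      _ = _ := by ring

/-- Upper bound matching `complexity_lower`. -/
lemma complexity_upper {CK C₀ C₁ u t l T K N₀ N : ℝ} (ht : 1 ≤ t) (hCK : 0 < CK) (hC₀ : 0 ≤ C₀)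
    (hC₁ : 0 ≤ C₁) (hu : 0 < u) (hl : 0 ≤ l) (hT0 : 0 ≤ T) (hK0 : 0 ≤ K) (hK : K ≤ CK * (u / t))
    (hN₀ : N₀ ≤ C₀ * (T * t / u) * l) (hN : N ≤ C₁ * t ^ 4 * l) :
    K * (N₀ + N * (t - 1)) ≤ CK * (C₀ + C₁) * ((T + u * t ^ 4) * l) := by
  have ht0 : 0 < t := by linarith
  calc K * (N₀ + N * (t - 1)) ≤ K * (C₀ * (T * t / u) * l + C₁ * t ^ 4 * l * t) := by
        gcongr
        linarith
    _ ≤ CK * (u / t) * (C₀ * (T * t / u) * l + C₁ * t ^ 4 * l * t) := by gcongr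
    _ = CK * (C₀ * T + C₁ * (u * t ^ 4)) * l := by field_simp
    _ ≤ CK * (C₀ * T + C₁ * T + (C₀ * (u * t ^ 4) + C₁ * (u * t ^ 4))) * l := by
        gcongr
        · exact le_add_of_nonneg_right (by positivity)
        · exact le_add_of_nonneg_left (by positivity)
    _ = _ := by ring

end Asymptotics

/-! ### Measurability, unbiasedness and noise bounds for components and subproblems. -/

section Regularity

namespace CompositeProblem

variable {n m : ℕ} {Ξ : Type u} [MeasurableSpace Ξ] {P : CompositeProblem n m Ξ}
  {lf lg Lg lhat Lhat : ℝ≥0}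

lemma Standing.measurable_G (hP : P.Standing lf lg Lg) :
    Measurable fun p : Ξ × Vec n => P.G p.1 p.2 := by
  have h := measurable_uncurry_of_continuous_of_measurable (u := fun (x : Vec n) ξ => P.G ξ x)
    (fun ξ => (hP.G_differentiable ξ).continuous) hP.G_measurable
  exact h.comp measurable_swap

/-- A Jacobian is a continuous function of its finitely many columns. -/
lemma measurable_of_apply {α : Type*} [MeasurableSpace α] {J : α → Jac n m}
    (h : ∀ v, Measurable fun a => J a v) : Measurable J := by
  let T : (Fin n → Vec m) → Jac n m := fun w =>
    ∑ i, ((EuclideanSpace.proj i : Vec n →L[ℝ] ℝ)).smulRight (w i)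
  have hT : Continuous T := by
    refine continuous_finsetSum _ fun i _ => ?_
    exact ((ContinuousLinearMap.smulRightL ℝ (Vec n) (Vec m))
      (EuclideanSpace.proj i : Vec n →L[ℝ] ℝ)).continuous.comp (continuous_apply i)
  have hJ : J = T ∘ fun a i => J a (EuclideanSpace.basisFun (Fin n) ℝ i) := by
    funext a
    ext v : 1
    conv_lhs => rw [← (EuclideanSpace.basisFun (Fin n) ℝ).sum_repr v]
    simp [T]
  rw [hJ]
  exact hT.measurable.comp (measurable_pi_lambda _ fun i => h _)

/-- Directional derivatives are pointwise limits of the difference quotients with step `1 / k`,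
which are jointly measurable by `measurable_G`. -/
lemma Standing.measurable_jac (hP : P.Standing lf lg Lg) :
    Measurable fun p : Ξ × Vec n => fderiv ℝ (P.G p.1) p.2 := by
  refine measurable_of_apply fun v => ?_
  refine measurable_of_tendsto_metrizable
    (f := fun (k : ℕ) (p : Ξ × Vec n) => (k : ℝ) • (P.G p.1 (p.2 + (k : ℝ)⁻¹ • v) - P.G p.1 p.2))
    (fun k => ?_) ?_
  · have h1 : Measurable fun p : Ξ × Vec n => P.G p.1 (p.2 + (k : ℝ)⁻¹ • v) :=
      hP.measurable_G.comp (measurable_fst.prodMk (measurable_snd.add_const _))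
    exact (h1.sub hP.measurable_G).const_smul (k : ℝ)
  · rw [tendsto_pi_nhds]
    intro p
    exact ((hP.G_differentiable p.1 p.2).hasFDerivAt.lim_real v).comp tendsto_natCast_atTop_atTop

lemma UniformlyLipschitz.norm_jac_le (hU : P.UniformlyLipschitz lhat Lhat) :
    ∀ᵐ ξ ∂P.D, ∀ x, ‖fderiv ℝ (P.G ξ) x‖ ≤ lhat := by
  filter_upwards [hU.value] with ξ h x
  exact norm_fderiv_le_of_lipschitz ℝ h

lemma Standing.integrable_jac (hP : P.Standing lf lg Lg) (hU : P.UniformlyLipschitz lhat Lhat)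
    (x : Vec n) : Integrable (fun ξ => fderiv ℝ (P.G ξ) x) P.D := by
  have := hP.prob
  refine Integrable.of_bound (C := lhat) ?_ (hU.norm_jac_le.mono fun ξ h => h x)
  exact (hP.measurable_jac.comp (measurable_id.prodMk measurable_const)).aestronglyMeasurable

/-- The Jacobians of the components are unbiased. -/
lemma Standing.integral_jac (hP : P.Standing lf lg Lg) (hU : P.UniformlyLipschitz lhat Lhat)
    (x : Vec n) : ∫ ξ, fderiv ℝ (P.G ξ) x ∂P.D = fderiv ℝ P.g x := by
  have := hP.prob
  have h := hasFDerivAt_integral_of_dominated_of_fderiv_le (𝕜 := ℝ) (μ := P.D)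
    (F := fun x ξ => P.G ξ x) (F' := fun x ξ => fderiv ℝ (P.G ξ) x) (x₀ := x) (s := Set.univ)
    (bound := fun _ => (lhat : ℝ)) Filter.univ_mem
    (Filter.Eventually.of_forall fun y => (hP.G_measurable y).aestronglyMeasurable)
    (hP.G_integrable x) (hP.integrable_jac hU x).aestronglyMeasurable
    (hU.norm_jac_le.mono fun ξ h x _ => h x) (integrable_const _)
    (Filter.Eventually.of_forall fun ξ y _ => (hP.G_differentiable ξ y).hasFDerivAt)
  exact h.fderiv.symm

lemma Standing.measurable_g (hP : P.Standing lf lg Lg) : Measurable P.g :=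
  hP.g_lipschitz.continuous.measurable

lemma Standing.measurable_fderiv_g (hP : P.Standing lf lg Lg) : Measurable (fderiv ℝ P.g) :=
  hP.g_jac_lipschitz.continuous.measurable

/-- Error of the linearization of a component around `p.2`, relative to the same error of `g`. -/
def valueNoise (P : CompositeProblem n m Ξ) (p : Vec n × Vec n) (ξ : Ξ) : Vec m :=
  (P.G ξ p.1 - P.G ξ p.2 - fderiv ℝ (P.G ξ) p.2 (p.1 - p.2))
    - (P.g p.1 - P.g p.2 - fderiv ℝ P.g p.2 (p.1 - p.2))

/-- Change of the Jacobian of a component, relative to the change of `g'`. -/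
def jacNoise (P : CompositeProblem n m Ξ) (p : Vec n × Vec n) (ξ : Ξ) : Jac n m :=
  (fderiv ℝ (P.G ξ) p.1 - fderiv ℝ (P.G ξ) p.2) - (fderiv ℝ P.g p.1 - fderiv ℝ P.g p.2)

lemma Standing.measurable_value_sub (hP : P.Standing lf lg Lg) :
    Measurable fun q : (Vec n × Vec n) × Ξ => P.G q.2 q.1.1 - P.g q.1.1 :=
  (hP.measurable_G.comp (measurable_snd.prodMk (measurable_fst.comp measurable_fst))).sub
    (hP.measurable_g.comp (measurable_fst.comp measurable_fst))

lemma Standing.measurable_jac_sub (hP : P.Standing lf lg Lg) :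
    Measurable fun q : (Vec n × Vec n) × Ξ => fderiv ℝ (P.G q.2) q.1.1 - fderiv ℝ P.g q.1.1 :=
  (hP.measurable_jac.comp (measurable_snd.prodMk (measurable_fst.comp measurable_fst))).sub
    (hP.measurable_fderiv_g.comp (measurable_fst.comp measurable_fst))

lemma measurable_clm_apply {α : Type*} [MeasurableSpace α] {J : α → Jac n m} {v : α → Vec n}
    (hJ : Measurable J) (hv : Measurable v) : Measurable fun a => J a (v a) := by
  have hc : Continuous fun p : Jac n m × Vec n => p.1 p.2 := by fun_prop
  exact hc.measurable.comp (hJ.prodMk hv)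

lemma Standing.measurable_valueNoise (hP : P.Standing lf lg Lg) :
    Measurable fun q : (Vec n × Vec n) × Ξ => P.valueNoise q.1 q.2 := by
  have h1 : Measurable fun q : (Vec n × Vec n) × Ξ => q.1.1 := measurable_fst.comp measurable_fst
  have h2 : Measurable fun q : (Vec n × Vec n) × Ξ => q.1.2 := measurable_snd.comp measurable_fst
  have hG1 := hP.measurable_G.comp (measurable_snd.prodMk h1)
  have hG2 := hP.measurable_G.comp (measurable_snd.prodMk h2)
  have hJ := measurable_clm_apply (hP.measurable_jac.comp (measurable_snd.prodMk h2)) (h1.sub h2)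
  have hJ' := measurable_clm_apply (hP.measurable_fderiv_g.comp h2) (h1.sub h2)
  exact ((hG1.sub hG2).sub hJ).sub (((hP.measurable_g.comp h1).sub (hP.measurable_g.comp h2)).sub hJ')

lemma Standing.measurable_jacNoise (hP : P.Standing lf lg Lg) :
    Measurable fun q : (Vec n × Vec n) × Ξ => P.jacNoise q.1 q.2 := by
  have h1 : Measurable fun q : (Vec n × Vec n) × Ξ => q.1.1 := measurable_fst.comp measurable_fst
  have h2 : Measurable fun q : (Vec n × Vec n) × Ξ => q.1.2 := measurable_snd.comp measurable_fst
  exact ((hP.measurable_jac.comp (measurable_snd.prodMk h1)).sub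
    (hP.measurable_jac.comp (measurable_snd.prodMk h2))).sub
    ((hP.measurable_fderiv_g.comp h1).sub (hP.measurable_fderiv_g.comp h2))

lemma Standing.integral_value_sub (hP : P.Standing lf lg Lg) (x : Vec n) :
    ∫ ξ, (P.G ξ x - P.g x) ∂P.D = 0 := by
  have := hP.prob
  rw [integral_sub (hP.G_integrable x) (integrable_const _), integral_const, probReal_univ,
    one_smul]
  exact sub_self (P.g x)

lemma Standing.integral_jac_sub (hP : P.Standing lf lg Lg) (hU : P.UniformlyLipschitz lhat Lhat)
    (x : Vec n) : ∫ ξ, (fderiv ℝ (P.G ξ) x - fderiv ℝ P.g x) ∂P.D = 0 := by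
  have := hP.prob
  rw [integral_sub (hP.integrable_jac hU x) (integrable_const _), integral_const, probReal_univ,
    one_smul, hP.integral_jac hU, sub_self]

lemma Standing.integral_jacNoise (hP : P.Standing lf lg Lg) (hU : P.UniformlyLipschitz lhat Lhat)
    (p : Vec n × Vec n) : ∫ ξ, P.jacNoise p ξ ∂P.D = 0 := by
  have := hP.prob
  have he : ∀ ξ, P.jacNoise p ξ = (fderiv ℝ (P.G ξ) p.1 - fderiv ℝ P.g p.1)
      - (fderiv ℝ (P.G ξ) p.2 - fderiv ℝ P.g p.2) := fun ξ => by rw [jacNoise]; abel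
  have i1 : ∀ x, Integrable (fun ξ => fderiv ℝ (P.G ξ) x - fderiv ℝ P.g x) P.D := fun x =>
    (hP.integrable_jac hU x).sub (integrable_const _)
  simp only [he]
  rw [integral_sub (i1 _) (i1 _), hP.integral_jac_sub hU,
    hP.integral_jac_sub hU, sub_self]

lemma Standing.integral_valueNoise (hP : P.Standing lf lg Lg) (hU : P.UniformlyLipschitz lhat Lhat)
    (p : Vec n × Vec n) : ∫ ξ, P.valueNoise p ξ ∂P.D = 0 := by
  have := hP.prob
  let T : Jac n m →L[ℝ] Vec m := ContinuousLinearMap.apply ℝ (Vec m) (p.1 - p.2)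
  have he : ∀ ξ, P.valueNoise p ξ = (P.G ξ p.1 - P.g p.1) - (P.G ξ p.2 - P.g p.2)
      - T (fderiv ℝ (P.G ξ) p.2 - fderiv ℝ P.g p.2) := fun ξ => by
    simp only [valueNoise, T, ContinuousLinearMap.apply_apply, sub_apply]
    abel
  have i1 : ∀ x, Integrable (fun ξ => P.G ξ x - P.g x) P.D := fun x =>
    (hP.G_integrable x).sub (integrable_const _)
  have i2 : Integrable (fun ξ => fderiv ℝ (P.G ξ) p.2 - fderiv ℝ P.g p.2) P.D :=
    (hP.integrable_jac hU _).sub (integrable_const _)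
  have h1 := ContinuousLinearMap.integral_comp_comm T i2
  simp only [he]
  have i3 : Integrable (fun ξ => (P.G ξ p.1 - P.g p.1) - (P.G ξ p.2 - P.g p.2)) P.D :=
    (i1 _).sub (i1 _)
  rw [integral_sub i3 (T.integrable_comp i2), integral_sub (i1 _) (i1 _), h1,
    hP.integral_jac_sub hU, hP.integral_value_sub, hP.integral_value_sub, map_zero, sub_self,
    sub_self]

/-- The first-order correction pays off here: the noise is quadratic in the distance to the
reference point. A batch of order `τ ^ 4` then scales its mean down by `τ ^ 2`. -/
lemma Standing.norm_valueNoise_le (hP : P.Standing lf lg Lg) (hU : P.UniformlyLipschitz lhat Lhat)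
    (p : Vec n × Vec n) : ∀ᵐ ξ ∂P.D, ‖P.valueNoise p ξ‖ ≤ (Lhat + Lg) * ‖p.1 - p.2‖ ^ 2 := by
  filter_upwards [hU.jac] with ξ h
  rw [add_mul]
  exact (norm_sub_le _ _).trans (add_le_add
    (norm_sub_linearization_le (hP.G_differentiable ξ) h _ _)
    (norm_sub_linearization_le hP.g_differentiable hP.g_jac_lipschitz _ _))

lemma Standing.norm_jacNoise_le (hP : P.Standing lf lg Lg) (hU : P.UniformlyLipschitz lhat Lhat)
    (p : Vec n × Vec n) : ∀ᵐ ξ ∂P.D, ‖P.jacNoise p ξ‖ ≤ (Lhat + Lg) * ‖p.1 - p.2‖ := by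
  filter_upwards [hU.jac] with ξ h
  rw [add_mul]
  exact (norm_sub_le _ _).trans (add_le_add (h.norm_sub_le _ _) (hP.g_jac_lipschitz.norm_sub_le _ _))

/-! ### The subproblems -/

lemma Standing.measurable_model (hP : P.Standing lf lg Lg) (M : ℝ) :
    Measurable fun q : (Vec n × Vec m × Jac n m) × Vec n =>
      P.model M q.1.1 q.1.2.1 q.1.2.2 q.2 := by
  have hf := hP.continuous_f
  have c1 : Continuous fun q : (Vec n × Vec m × Jac n m) × Vec n =>
      ((P.f (q.1.2.1 + q.1.2.2 (q.2 - q.1.1)) : ℝ) : EReal) :=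
    continuous_coe_real_ereal.comp (by fun_prop)
  have c2 : Continuous fun q : (Vec n × Vec m × Jac n m) × Vec n =>
      ((M / 2 * ‖q.2 - q.1.1‖ ^ 2 : ℝ) : EReal) :=
    continuous_coe_real_ereal.comp (by fun_prop)
  have c3 : LowerSemicontinuous fun q : (Vec n × Vec m × Jac n m) × Vec n => P.h q.2 :=
    fun q y hy =>
    continuous_snd.continuousAt.eventually (hP.h_closed q.2 y hy)
  refine LowerSemicontinuous.measurable ((c1.lowerSemicontinuous.add' c3 fun y => ?_).add'
    c2.lowerSemicontinuous fun y => ?_)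
  · exact EReal.continuousAt_add (Or.inl (EReal.coe_ne_top _)) (Or.inl (EReal.coe_ne_bot _))
  · exact EReal.continuousAt_add (Or.inr (EReal.coe_ne_bot _)) (Or.inr (EReal.coe_ne_top _))

/-- The infimum is over uncountably many `y`. For fixed `y` the model is upper semicontinuous in the
data, with `h y` a constant, and infima preserve this. -/
lemma Standing.measurable_iInf_model (hP : P.Standing lf lg Lg) (M : ℝ) :
    Measurable fun q : Vec n × Vec m × Jac n m => ⨅ y, P.model M q.1 q.2.1 q.2.2 y := by
  have hf := hP.continuous_f
  refine UpperSemicontinuous.measurable (δ := Vec n × Vec m × Jac n m)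
    (upperSemicontinuous_iInf fun y => ?_)
  have c1 : Continuous fun q : Vec n × Vec m × Jac n m =>
      ((P.f (q.2.1 + q.2.2 (y - q.1)) : ℝ) : EReal) :=
    continuous_coe_real_ereal.comp (by fun_prop)
  have c2 : Continuous fun q : Vec n × Vec m × Jac n m =>
      ((M / 2 * ‖y - q.1‖ ^ 2 : ℝ) : EReal) :=
    continuous_coe_real_ereal.comp (by fun_prop)
  refine (c1.upperSemicontinuous.add' upperSemicontinuous_const fun y => ?_).add'
    c2.upperSemicontinuous fun y => ?_
  · exact EReal.continuousAt_add (Or.inl (EReal.coe_ne_top _)) (Or.inl (EReal.coe_ne_bot _))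
  · exact EReal.continuousAt_add (Or.inr (EReal.coe_ne_bot _)) (Or.inr (EReal.coe_ne_top _))

variable {S : Type v} [MeasurableSpace S] {ν : Measure S} {solver : Solver n S} {M : ℝ}

/-- The runs of the solver that miss the tolerance. -/
def solverFailure (P : CompositeProblem n m Ξ) (M : ℝ) (solver : Solver n S) (ε' δ' : ℝ) :
    Set ((Vec n × Vec m × Jac n m) × S) :=
  {q | ¬ P.model M q.1.1 q.1.2.1 q.1.2.2
      (solver (P.model M q.1.1 q.1.2.1 q.1.2.2) ε' δ' q.2)
    ≤ (⨅ y, P.model M q.1.1 q.1.2.1 q.1.2.2 y) + (ε' : EReal)}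

lemma Standing.measurableSet_solverFailure (hP : P.Standing lf lg Lg)
    (hS : solver.Valid ν P M) {ε' δ' : ℝ} (hε : 0 < ε') (hδ : 0 < δ') :
    MeasurableSet (P.solverFailure M solver ε' δ') := by
  have hl : Measurable fun q : (Vec n × Vec m × Jac n m) × S => P.model M q.1.1 q.1.2.1 q.1.2.2
      (solver (P.model M q.1.1 q.1.2.1 q.1.2.2) ε' δ' q.2) := by
    have hs := hS.measurable ε' δ' hε hδ
    have hp : Measurable fun q : (Vec n × Vec m × Jac n m) × S =>
        (q.1, solver (P.model M q.1.1 q.1.2.1 q.1.2.2) ε' δ' q.2) := measurable_fst.prodMk hs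
    have h := (hP.measurable_model M).comp hp
    simpa only [Function.comp_def] using h
  have hc : Continuous fun a : EReal => a + (ε' : EReal) :=
    continuous_iff_continuousAt.2 fun a =>
      ContinuousAt.comp (g := fun p : EReal × EReal => p.1 + p.2) (f := fun a => (a, (ε' : EReal)))
        (EReal.continuousAt_add (Or.inr (EReal.coe_ne_bot _)) (Or.inr (EReal.coe_ne_top _)))
        (by fun_prop)
  have hr : Measurable fun q : (Vec n × Vec m × Jac n m) × S =>
      (⨅ y, P.model M q.1.1 q.1.2.1 q.1.2.2 y) + (ε' : EReal) :=
    hc.measurable.comp ((hP.measurable_iInf_model M).comp measurable_fst)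
  exact (measurableSet_le hl hr).compl

lemma Standing.measure_solverFailure_le [IsProbabilityMeasure ν] (hP : P.Standing lf lg Lg)
    (hS : solver.Valid ν P M) {ε' δ' : ℝ} (hε : 0 < ε') (hδ : 0 < δ')
    (q : Vec n × Vec m × Jac n m) :
    ν {s | (q, s) ∈ P.solverFailure M solver ε' δ'} ≤ ENNReal.ofReal δ' := by
  have hmeas : MeasurableSet {s | (q, s) ∈ P.solverFailure M solver ε' δ'} :=
    measurable_prodMk_left (hP.measurableSet_solverFailure hS hε hδ)
  have h1 := hS.accurate ε' δ' hε hδ q.1 q.2.1 q.2.2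
  have h2 : {s | (q, s) ∈ P.solverFailure M solver ε' δ'}ᶜ
      = {s | P.model M q.1 q.2.1 q.2.2 (solver (P.model M q.1 q.2.1 q.2.2) ε' δ' s)
        ≤ (⨅ y, P.model M q.1 q.2.1 q.2.2 y) + (ε' : EReal)} := by
    ext s
    simp [solverFailure]
  rw [← h2, prob_compl_eq_one_sub hmeas] at h1
  set a := ν {s | (q, s) ∈ P.solverFailure M solver ε' δ'} with ha
  have ha1 : a ≤ 1 := prob_le_one
  have h3 : a + ENNReal.ofReal (1 - δ') ≤ 1 := by
    calc a + ENNReal.ofReal (1 - δ') ≤ a + (1 - a) := by gcongr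
      _ = 1 := add_tsub_cancel_of_le ha1
  -- Only an inequality, since `1 - δ'` is truncated at zero when `1 < δ'`.
  have h4 : (1 : ENNReal) ≤ ENNReal.ofReal (1 - δ') + ENNReal.ofReal δ' := by
    rw [← ENNReal.ofReal_one]
    refine le_trans (ENNReal.ofReal_le_ofReal ?_) ENNReal.ofReal_add_le
    linarith
  refine ENNReal.le_of_add_le_add_right (a := ENNReal.ofReal (1 - δ')) ENNReal.ofReal_ne_top ?_
  rw [add_comm (ENNReal.ofReal δ')]
  exact h3.trans h4

end CompositeProblem

end Regularity

/-! ### Conditioning on everything but the fresh randomness. -/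

section Freshness

variable {ι Ξ Z : Type*} [MeasurableSpace Ξ] [MeasurableSpace Z]

/-- If `Y` ignores the coordinates in `s` and the event `B z` only looks at them, then `Y` can be
treated as a constant. -/
lemma measure_fresh_le (D : Measure Ξ) [IsProbabilityMeasure D] (s : Set ι)
    {Y : (ι → Ξ) → Z} (hY : Measurable Y) (hYs : ∀ a a', (∀ j ∉ s, a j = a' j) → Y a = Y a')
    {B : Set (Z × (ι → Ξ))} (hB : MeasurableSet B)
    (hBs : ∀ z a a', (∀ j ∈ s, a j = a' j) → (z, a) ∈ B → (z, a') ∈ B) {δ : ENNReal}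
    (hδ : ∀ z, (Measure.infinitePi fun _ : ι => D) {a | (z, a) ∈ B} ≤ δ) :
    (Measure.infinitePi fun _ : ι => D) {a | (Y a, a) ∈ B} ≤ δ := by
  classical
  set μ := Measure.infinitePi fun _ : ι => D
  have hset : MeasurableSet {a | (Y a, a) ∈ B} := (hY.prodMk measurable_id) hB
  have hmp := measurePreserving_resample (ι := ι) D s
  have hset2 : MeasurableSet {q : (ι → Ξ) × (ι → Ξ) | (Y q.1, q.2) ∈ B} :=
    ((hY.comp measurable_fst).prodMk measurable_snd) hB
  calc μ {a | (Y a, a) ∈ B} = (μ.prod μ) (resample s ⁻¹' {a | (Y a, a) ∈ B}) :=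
        (hmp.measure_preimage hset.nullMeasurableSet).symm
    _ ≤ (μ.prod μ) {q | (Y q.1, q.2) ∈ B} := by
        refine measure_mono fun q hq => ?_
        have h1 : (Y (resample s q), resample s q) ∈ B := hq
        rw [hYs (resample s q) q.1 fun j hj => by simp [resample, hj]] at h1
        exact hBs _ _ _ (fun j hj => by simp [resample, hj]) h1
    _ = ∫⁻ a, μ {a' | (Y a, a') ∈ B} ∂μ := Measure.prod_apply hset2
    _ ≤ ∫⁻ _, δ ∂μ := lintegral_mono fun a => hδ (Y a)
    _ = δ := by simp

lemma measure_prod_le_of_right {α β : Type*} [MeasurableSpace α] [MeasurableSpace β] (μ : Measure α)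
    [IsProbabilityMeasure μ] (ρ : Measure β) [IsProbabilityMeasure ρ] {B : Set (α × β)}
    (hB : MeasurableSet B) {δ : ENNReal} (h : ∀ a, ρ {b | (a, b) ∈ B} ≤ δ) :
    (μ.prod ρ) B ≤ δ := by
  rw [Measure.prod_apply hB]
  calc ∫⁻ a, ρ (Prod.mk a ⁻¹' B) ∂μ ≤ ∫⁻ _, δ ∂μ := lintegral_mono fun a => h a
    _ = δ := by simp

lemma measure_prod_le_of_left {α β : Type*} [MeasurableSpace α] [MeasurableSpace β] (μ : Measure α)
    [IsProbabilityMeasure μ] (ρ : Measure β) [IsProbabilityMeasure ρ] {B : Set (α × β)}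
    (hB : MeasurableSet B) {δ : ENNReal} (h : ∀ b, μ {a | (a, b) ∈ B} ≤ δ) :
    (μ.prod ρ) B ≤ δ := by
  rw [Measure.prod_apply_symm hB]
  calc ∫⁻ b, μ ((fun a => (a, b)) ⁻¹' B) ∂ρ ≤ ∫⁻ _, δ ∂ρ := lintegral_mono fun b => h b
    _ = δ := by simp

end Freshness

/-! ### The run as a function of the tape. -/

section Trajectory

variable {n m : ℕ} {Ξ : Type u} [MeasurableSpace Ξ] {S : Type v}

/-- The state before iteration `(k, i)`. -/
def plState (P : CompositeProblem n m Ξ) (I : PLInput n S) (τ : ℕ → ℕ) (ω : Tape Ξ S) (k i : ℕ) :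
    PLState n m :=
  (plInner P I ω k i (plOuter P I τ ω k).val).val

/-- The estimates of iteration `(k, i)`. -/
def plEstimate (P : CompositeProblem n m Ξ) (I : PLInput n S) (τ : ℕ → ℕ) (ω : Tape Ξ S)
    (k i : ℕ) : Vec m × Jac n m :=
  (estimator P I.θ (fun r => ω.1 (k, i, r)) (fun r => ω.2.1 (k, i, r)) i (plState P I τ ω k i)).val

variable (P : CompositeProblem n m Ξ) (I : PLInput n S) (τ : ℕ → ℕ)

lemma plState_succ (ω : Tape Ξ S) (k i : ℕ) :
    plState P I τ ω k (i + 1) = (plStep P I ω k i (plState P I τ ω k i)).val := rfl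

lemma plState_succ_x (ω : Tape Ξ S) (k i : ℕ) : (plState P I τ ω k (i + 1)).x
    = I.solver (P.model I.M (plState P I τ ω k i).x (plEstimate P I τ ω k i).1
        (plEstimate P I τ ω k i).2) I.εbar I.δbar (ω.2.2 (k, i)) := by
  rw [plState_succ, plStep, Counted.val_bind, Counted.val_pure]
  split_ifs <;> rfl

lemma plState_succ_memory (ω : Tape Ξ S) (k i : ℕ) :
    (plState P I τ ω k (i + 1)).xref = (plState P I τ ω k 0).x ∧
    (plState P I τ ω k (i + 1)).gref = (plEstimate P I τ ω k 0).1 ∧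
    (plState P I τ ω k (i + 1)).Jref = (plEstimate P I τ ω k 0).2 := by
  induction i with
  | zero => exact ⟨rfl, rfl, rfl⟩
  | succ i ih =>
    rw [plState_succ, plStep, Counted.val_bind, Counted.val_pure, if_neg (Nat.succ_ne_zero i)]
    exact ih

lemma plEstimate_zero (ω : Tape Ξ S) (k : ℕ) : plEstimate P I τ ω k 0 =
    ((I.θ.A : ℝ)⁻¹ • ∑ r ∈ Finset.range I.θ.A, P.G (ω.1 (k, 0, r)) (plState P I τ ω k 0).x,
     (I.θ.B : ℝ)⁻¹ • ∑ r ∈ Finset.range I.θ.B,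
        fderiv ℝ (P.G (ω.2.1 (k, 0, r))) (plState P I τ ω k 0).x) := rfl

lemma plEstimate_of_ne_zero (ω : Tape Ξ S) (k : ℕ) {i : ℕ} (hi : i ≠ 0) : plEstimate P I τ ω k i =
    ((I.θ.a : ℝ)⁻¹ • (∑ r ∈ Finset.range I.θ.a, (P.G (ω.1 (k, i, r)) (plState P I τ ω k i).x
        - P.G (ω.1 (k, i, r)) (plState P I τ ω k i).xref
        - fderiv ℝ (P.G (ω.1 (k, i, r))) (plState P I τ ω k i).xref
          ((plState P I τ ω k i).x - (plState P I τ ω k i).xref)))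
      + (plState P I τ ω k i).gref
      + (plState P I τ ω k i).Jref ((plState P I τ ω k i).x - (plState P I τ ω k i).xref),
     (I.θ.b : ℝ)⁻¹ • (∑ r ∈ Finset.range I.θ.b,
        (fderiv ℝ (P.G (ω.2.1 (k, i, r))) (plState P I τ ω k i).x
        - fderiv ℝ (P.G (ω.2.1 (k, i, r))) (plState P I τ ω k i).xref))
      + (plState P I τ ω k i).Jref) := by
  rw [plEstimate, estimator, if_neg hi]
  rfl

lemma mean_sub_const {V : Type*} [AddCommGroup V] [Module ℝ V] {N : ℕ} (hN : N ≠ 0) (v : ℕ → V)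
    (c : V) : (N : ℝ)⁻¹ • ∑ r ∈ Finset.range N, (v r - c)
      = (N : ℝ)⁻¹ • ∑ r ∈ Finset.range N, v r - c := by
  have hN' : (N : ℝ) ≠ 0 := Nat.cast_ne_zero.2 hN
  rw [Finset.sum_sub_distrib, smul_sub, Finset.sum_const, Finset.card_range, ← Nat.cast_smul_eq_nsmul ℝ,
    inv_smul_smul₀ hN']

/-- Splits the error of a corrected value into fresh centered noise and the two errors stored at the
start of the epoch. -/
lemma recenter_value {V : Type*} [AddCommGroup V] (s g j c e f : V) :
    s + g + j - c = s - (c - e - f) + (g - e) + (j - f) := by abel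

lemma recenter_jac {V : Type*} [AddCommGroup V] (s j c e : V) :
    s + j - c = s - (c - e) + (j - e) := by abel

lemma plEstimate_zero_fst_sub (ω : Tape Ξ S) (k : ℕ) (hA : I.θ.A ≠ 0) :
    (plEstimate P I τ ω k 0).1 - P.g (plState P I τ ω k 0).x
      = (I.θ.A : ℝ)⁻¹ • ∑ r ∈ Finset.range I.θ.A,
        (P.G (ω.1 (k, 0, r)) (plState P I τ ω k 0).x - P.g (plState P I τ ω k 0).x) := by
  rw [mean_sub_const hA, plEstimate_zero]

lemma plEstimate_zero_snd_sub (ω : Tape Ξ S) (k : ℕ) (hB : I.θ.B ≠ 0) :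
    (plEstimate P I τ ω k 0).2 - fderiv ℝ P.g (plState P I τ ω k 0).x
      = (I.θ.B : ℝ)⁻¹ • ∑ r ∈ Finset.range I.θ.B,
        (fderiv ℝ (P.G (ω.2.1 (k, 0, r))) (plState P I τ ω k 0).x
          - fderiv ℝ P.g (plState P I τ ω k 0).x) := by
  rw [mean_sub_const hB, plEstimate_zero]

lemma plEstimate_fst_sub (ω : Tape Ξ S) (k : ℕ) {i : ℕ} (hi : i ≠ 0) (ha : I.θ.a ≠ 0) :
    (plEstimate P I τ ω k i).1 - P.g (plState P I τ ω k i).x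
      = (I.θ.a : ℝ)⁻¹ • (∑ r ∈ Finset.range I.θ.a,
          P.valueNoise ((plState P I τ ω k i).x, (plState P I τ ω k i).xref) (ω.1 (k, i, r)))
        + ((plState P I τ ω k i).gref - P.g (plState P I τ ω k i).xref)
        + ((plState P I τ ω k i).Jref - fderiv ℝ P.g (plState P I τ ω k i).xref)
          ((plState P I τ ω k i).x - (plState P I τ ω k i).xref) := by
  simp only [CompositeProblem.valueNoise]
  rw [mean_sub_const ha, plEstimate_of_ne_zero P I τ ω k hi, sub_apply]
  exact recenter_value _ _ _ _ _ _

lemma plEstimate_snd_sub (ω : Tape Ξ S) (k : ℕ) {i : ℕ} (hi : i ≠ 0) (hb : I.θ.b ≠ 0) :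
    (plEstimate P I τ ω k i).2 - fderiv ℝ P.g (plState P I τ ω k i).x
      = (I.θ.b : ℝ)⁻¹ • (∑ r ∈ Finset.range I.θ.b,
          P.jacNoise ((plState P I τ ω k i).x, (plState P I τ ω k i).xref) (ω.2.1 (k, i, r)))
        + ((plState P I τ ω k i).Jref - fderiv ℝ P.g (plState P I τ ω k i).xref) := by
  simp only [CompositeProblem.jacNoise]
  rw [mean_sub_const hb, plEstimate_of_ne_zero P I τ ω k hi]
  exact recenter_jac _ _ _ _

/-! ### Dependence on the tape -/

/-- Two tapes carry the same randomness for iteration `(k, i)`. -/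
def TapeAgree (ω ω' : Tape Ξ S) (k i : ℕ) : Prop :=
  (∀ r, ω.1 (k, i, r) = ω'.1 (k, i, r)) ∧ (∀ r, ω.2.1 (k, i, r) = ω'.2.1 (k, i, r)) ∧
    ω.2.2 (k, i) = ω'.2.2 (k, i)

lemma plStep_congr {ω ω' : Tape Ξ S} {k i : ℕ} (h : TapeAgree ω ω' k i) (st : PLState n m) :
    plStep P I ω k i st = plStep P I ω' k i st := by
  rw [plStep, plStep, funext h.1, funext h.2.1, h.2.2]

lemma plInner_congr {ω ω' : Tape Ξ S} {k i : ℕ} (h : ∀ i' < i, TapeAgree ω ω' k i')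
    (st : PLState n m) : plInner P I ω k i st = plInner P I ω' k i st := by
  induction i with
  | zero => rfl
  | succ i ih =>
    rw [plInner, plInner, ih fun i' hi' => h i' (hi'.trans (Nat.lt_succ_self i))]
    congr 1
    funext st'
    exact plStep_congr P I (h i (Nat.lt_succ_self i)) st'

lemma plOuter_congr {ω ω' : Tape Ξ S} {k : ℕ} (h : ∀ k' < k, ∀ i, TapeAgree ω ω' k' i) :
    plOuter P I τ ω k = plOuter P I τ ω' k := by
  induction k with
  | zero => rfl
  | succ k ih =>
    rw [plOuter, plOuter, ih fun k' hk' => h k' (hk'.trans (Nat.lt_succ_self k))]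
    congr 1
    funext st'
    exact plInner_congr P I (fun i' _ => h k (Nat.lt_succ_self k) i') st'

/-- The state before iteration `(k, i)` only depends on the randomness of the other iterations. -/
lemma plState_congr {ω ω' : Tape Ξ S} {k i : ℕ}
    (h : ∀ k' i', (k', i') ≠ (k, i) → TapeAgree ω ω' k' i') :
    plState P I τ ω k i = plState P I τ ω' k i := by
  rw [plState, plState, plOuter_congr P I τ fun k' hk' i' => h k' i' fun he => by
    rw [Prod.mk.injEq] at he; omega]
  rw [plInner_congr P I fun i' hi' => h k i' fun he => by rw [Prod.mk.injEq] at he; omega]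

/-! ### Measurability -/

variable [MeasurableSpace S] {lf lg Lg : ℝ≥0} {ν : Measure S} {P I}

/-- All components of a random state are measurable. -/
structure MeasurableState (st : Tape Ξ S → PLState n m) : Prop where
  x : Measurable fun ω => (st ω).x
  xref : Measurable fun ω => (st ω).xref
  gref : Measurable fun ω => (st ω).gref
  Jref : Measurable fun ω => (st ω).Jref

lemma measurable_estimator (hP : P.Standing lf lg Lg) (θ : BatchSizes) (k i : ℕ)
    {st : Tape Ξ S → PLState n m} (hst : MeasurableState st) :
    Measurable fun ω : Tape Ξ S =>
      (estimator P θ (fun r => ω.1 (k, i, r)) (fun r => ω.2.1 (k, i, r)) i (st ω)).val := by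
  have hz1 : ∀ r, Measurable fun ω : Tape Ξ S => ω.1 (k, i, r) := fun r =>
    (measurable_pi_apply _).comp measurable_fst
  have hz2 : ∀ r, Measurable fun ω : Tape Ξ S => ω.2.1 (k, i, r) := fun r =>
    (measurable_pi_apply _).comp (measurable_fst.comp measurable_snd)
  have hG : ∀ {z : Tape Ξ S → Ξ} {x : Tape Ξ S → Vec n}, Measurable z → Measurable x →
      Measurable fun ω => P.G (z ω) (x ω) := fun hz hx => hP.measurable_G.comp (hz.prodMk hx)
  have hJ : ∀ {z : Tape Ξ S → Ξ} {x : Tape Ξ S → Vec n}, Measurable z → Measurable x →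
      Measurable fun ω => fderiv ℝ (P.G (z ω)) (x ω) :=
    fun hz hx => hP.measurable_jac.comp (hz.prodMk hx)
  by_cases hi : i = 0
  · subst hi
    refine Measurable.prodMk ?_ ?_
    · exact (Finset.measurable_fun_sum _ fun r _ => hG (hz1 r) hst.x).const_smul ((θ.A : ℝ)⁻¹)
    · exact (Finset.measurable_fun_sum _ fun r _ => hJ (hz2 r) hst.x).const_smul ((θ.B : ℝ)⁻¹)
  · simp only [estimator, if_neg hi]
    refine Measurable.prodMk ?_ ?_
    · refine Measurable.add (Measurable.add ?_ hst.gref)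
        (CompositeProblem.measurable_clm_apply hst.Jref (hst.x.sub hst.xref))
      exact (Finset.measurable_fun_sum _ fun r _ =>
        ((hG (hz1 r) hst.x).sub (hG (hz1 r) hst.xref)).sub
          (CompositeProblem.measurable_clm_apply (hJ (hz1 r) hst.xref)
            (hst.x.sub hst.xref))).const_smul ((θ.a : ℝ)⁻¹)
    · refine Measurable.add ?_ hst.Jref
      exact (Finset.measurable_fun_sum _ fun r _ =>
        (hJ (hz2 r) hst.x).sub (hJ (hz2 r) hst.xref)).const_smul ((θ.b : ℝ)⁻¹)

lemma measurableState_plStep (hP : P.Standing lf lg Lg) (hS : I.solver.Valid ν P I.M)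
    (hε : 0 < I.εbar) (hδ : 0 < I.δbar) (k i : ℕ) {st : Tape Ξ S → PLState n m}
    (hst : MeasurableState st) : MeasurableState fun ω => (plStep P I ω k i (st ω)).val := by
  have he := measurable_estimator hP I.θ k i hst
  have hs : Measurable fun ω : Tape Ξ S => ω.2.2 (k, i) :=
    (measurable_pi_apply _).comp (measurable_snd.comp measurable_snd)
  have hx := (hS.measurable I.εbar I.δbar hε hδ).comp ((hst.x.prodMk he).prodMk hs)
  by_cases hi : i = 0
  · simp only [plStep, hi, if_true]
    rw [hi] at hx he
    exact ⟨hx, hst.x, he.fst, he.snd⟩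
  · simp only [plStep, hi, if_false]
    exact ⟨hx, hst.xref, hst.gref, hst.Jref⟩

lemma measurableState_plState (hP : P.Standing lf lg Lg) (hS : I.solver.Valid ν P I.M)
    (hε : 0 < I.εbar) (hδ : 0 < I.δbar) (k i : ℕ) :
    MeasurableState fun ω => plState P I τ ω k i := by
  have hstep : ∀ k, (MeasurableState fun ω => plState P I τ ω k 0) → ∀ i,
      MeasurableState fun ω => plState P I τ ω k i := by
    intro k h0 i
    induction i with
    | zero => exact h0
    | succ i ih => exact measurableState_plStep hP hS hε hδ k i ih
  have hzero : ∀ k, MeasurableState fun ω => plState P I τ ω k 0 := by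
    intro k
    induction k with
    | zero => exact ⟨measurable_const, measurable_const, measurable_const, measurable_const⟩
    | succ k ih => exact hstep k ih (τ k)
  exact hstep k (hzero k) i

end Trajectory

/-! ### Deviation events of batch means. -/

section BatchDeviation

variable {n : ℕ} {Ξ : Type u} {V : Type*} [NormedAddCommGroup V] [NormedSpace ℝ V]

/-- The event that a batch mean at the points `z` exceeds its tolerance. -/
def batchDeviation (X : Vec n × Vec n → Ξ → V) (R : Vec n × Vec n → ℝ) (C : ℝ) (N k i : ℕ) :
    Set ((Vec n × Vec n) × (ℕ × ℕ × ℕ → Ξ)) :=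
  {q | 12 * R q.1 ^ 2 / C
    < ‖(N : ℝ)⁻¹ • ∑ r ∈ Finset.range N, X q.1 (q.2 (k, i, r))‖ ^ 2}

lemma batchDeviation_congr {X : Vec n × Vec n → Ξ → V} {R : Vec n × Vec n → ℝ} {C : ℝ}
    {N k i : ℕ} (z : Vec n × Vec n)
    (a a' : ℕ × ℕ × ℕ → Ξ) (h : ∀ j ∈ {j : ℕ × ℕ × ℕ | (j.1, j.2.1) = (k, i)}, a j = a' j)
    (hz : (z, a) ∈ batchDeviation X R C N k i) : (z, a') ∈ batchDeviation X R C N k i := by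
  have : ∀ r, a' (k, i, r) = a (k, i, r) := fun r => (h _ rfl).symm
  rw [batchDeviation, Set.mem_ofPred_eq] at hz ⊢
  simpa only [this] using hz

lemma batchIndex_injective (k i : ℕ) : Function.Injective fun r : ℕ => (k, i, r) := fun r r' h => by
  simpa using h

lemma norm_le_of_not_mem_batchDeviation {X : Vec n × Vec n → Ξ → V} {R : Vec n × Vec n → ℝ}
    {C : ℝ} {N k i : ℕ} {z : Vec n × Vec n}
    {a : ℕ × ℕ × ℕ → Ξ} (h : (z, a) ∉ batchDeviation X R C N k i) :
    ‖(N : ℝ)⁻¹ • ∑ r ∈ Finset.range N, X z (a (k, i, r))‖ ^ 2 ≤ 12 * R z ^ 2 / C := by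
  rw [batchDeviation, Set.mem_ofPred_eq, not_lt] at h
  exact h

end BatchDeviation

/-! ### Probability that an iteration is inaccurate. -/

section BatchEvents

variable {n m : ℕ} {Ξ : Type u} [MeasurableSpace Ξ] {S : Type v} [MeasurableSpace S]
  {P : CompositeProblem n m Ξ} {I : PLInput n S} {τ : ℕ → ℕ} {lf lg Lg : ℝ≥0}
  {ν : Measure S}

lemma isProbabilityMeasure_tapeMeasure (D : Measure Ξ) [IsProbabilityMeasure D]
    [IsProbabilityMeasure ν] : IsProbabilityMeasure (tapeMeasure D ν) := by
  unfold tapeMeasure; infer_instance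

/-- The current iterate and the reference point of iteration `(k, i)`. -/
def plPoints (P : CompositeProblem n m Ξ) (I : PLInput n S) (τ : ℕ → ℕ) (k i : ℕ)
    (ω : Tape Ξ S) : Vec n × Vec n :=
  ((plState P I τ ω k i).x, (plState P I τ ω k i).xref)

lemma measurable_plPoints (hP : P.Standing lf lg Lg) (hS : I.solver.Valid ν P I.M)
    (hε : 0 < I.εbar) (hδ : 0 < I.δbar) (k i : ℕ) : Measurable (plPoints P I τ k i) :=
  have h := measurableState_plState τ hP hS hε hδ k i
  h.x.prodMk h.xref

lemma measurableSet_batchDeviation {V : Type*} [NormedAddCommGroup V] [NormedSpace ℝ V]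
    [MeasurableSpace V] [BorelSpace V] [SecondCountableTopology V]
    {X : Vec n × Vec n → Ξ → V} (hX : Measurable fun q : (Vec n × Vec n) × Ξ => X q.1 q.2)
    {R : Vec n × Vec n → ℝ} (hR : Measurable R) (C : ℝ) (N k i : ℕ) :
    MeasurableSet (batchDeviation X R C N k i) := by
  refine measurableSet_lt ?_ ?_
  · exact (((hR.comp measurable_fst).pow_const 2).const_mul 12).div_const C
  · refine (Measurable.norm (Measurable.const_smul
      (Finset.measurable_fun_sum _ fun r _ => ?_) ((N : ℝ)⁻¹))).pow_const 2
    exact hX.comp (measurable_fst.prodMk ((measurable_pi_apply (k, i, r)).comp measurable_snd))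

variable [IsProbabilityMeasure ν]

/-- With the rest of the tape fixed, the points of iteration `(k, i)` do not depend on its own value
samples. By `measure_fresh_le` they may be treated as constants, and the tail bound for fixed points
applies. -/
lemma measure_value_deviation_le (hP : P.Standing lf lg Lg) (hS : I.solver.Valid ν P I.M)
    (hε : 0 < I.εbar) (hδ : 0 < I.δbar) (k i : ℕ) {X : Vec n × Vec n → Ξ → Vec m}
    (hX : Measurable fun q : (Vec n × Vec n) × Ξ => X q.1 q.2)
    {R : Vec n × Vec n → ℝ} (hR : Measurable R) (hXR : ∀ p, ∀ᵐ ξ ∂P.D, ‖X p ξ‖ ≤ R p)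
    (h0 : ∀ p, ∫ ξ, X p ξ ∂P.D = 0) {N : ℕ} {C L : ℝ} (hC : 0 < C) (hL : 1 ≤ L) (hN : C * L ≤ N) :
    tapeMeasure P.D ν {ω | (plPoints P I τ k i ω, ω.1) ∈ batchDeviation X R C N k i}
      ≤ ENNReal.ofReal ((m + 1) * Real.exp (-L)) := by
  have := hP.prob
  have hY := measurable_plPoints (τ := τ) hP hS hε hδ k i
  have hB := measurableSet_batchDeviation hX hR C N k i
  refine measure_prod_le_of_left _ _ ((hY.prodMk measurable_fst) hB) fun b => ?_
  refine measure_fresh_le P.D {j | (j.1, j.2.1) = (k, i)}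
    (Y := fun a => plPoints P I τ k i (a, b)) (hY.comp measurable_prodMk_right) ?_ hB
    batchDeviation_congr fun z => ?_
  · intro a a' h
    simp only [plPoints]
    rw [plState_congr P I τ (ω := (a, b)) (ω' := (a', b)) fun k' i' hne =>
      ⟨fun r => h (k', i', r) hne, fun _ => rfl, rfl⟩]
  · exact measure_norm_mean_vec_gt_le (hX.comp measurable_prodMk_left).stronglyMeasurable (hXR z)
      (h0 z) (batchIndex_injective k i) hC hL hN

lemma measure_jac_deviation_le (hP : P.Standing lf lg Lg) (hS : I.solver.Valid ν P I.M)
    (hε : 0 < I.εbar) (hδ : 0 < I.δbar) (k i : ℕ) {X : Vec n × Vec n → Ξ → Jac n m}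
    (hX : Measurable fun q : (Vec n × Vec n) × Ξ => X q.1 q.2)
    {R : Vec n × Vec n → ℝ} (hR : Measurable R) (hXR : ∀ p, ∀ᵐ ξ ∂P.D, ‖X p ξ‖ ≤ R p)
    (h0 : ∀ p, ∫ ξ, X p ξ ∂P.D = 0) {N : ℕ} {C L : ℝ} (hC : 0 < C) (hL : 1 ≤ L) (hN : C * L ≤ N) :
    tapeMeasure P.D ν {ω | (plPoints P I τ k i ω, ω.2.1) ∈ batchDeviation X R C N k i}
      ≤ ENNReal.ofReal ((m + n) * Real.exp (-L)) := by
  have := hP.prob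
  have hY := measurable_plPoints (τ := τ) hP hS hε hδ k i
  have hB := measurableSet_batchDeviation hX hR C N k i
  have hset : MeasurableSet
      {ω : Tape Ξ S | (plPoints P I τ k i ω, ω.2.1) ∈ batchDeviation X R C N k i} :=
    (hY.prodMk (measurable_fst.comp measurable_snd)) hB
  refine measure_prod_le_of_right _ _ hset fun a₁ => ?_
  refine measure_prod_le_of_left _ _ (measurable_prodMk_left hset) fun b => ?_
  refine measure_fresh_le P.D {j | (j.1, j.2.1) = (k, i)}
    (Y := fun a => plPoints P I τ k i (a₁, a, b))
    (hY.comp (measurable_const.prodMk (measurable_id.prodMk measurable_const))) ?_ hB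
    batchDeviation_congr fun z => ?_
  · intro a a' h
    simp only [plPoints]
    rw [plState_congr P I τ (ω := (a₁, a, b)) (ω' := (a₁, a', b)) fun k' i' hne =>
      ⟨fun _ => rfl, fun r => h (k', i', r) hne, rfl⟩]
  · have := measure_norm_mean_gt_le (hX.comp measurable_prodMk_left).stronglyMeasurable (hXR z)
      (h0 z) (batchIndex_injective k i) hC hL hN
    rw [finrank_euclideanSpace_fin, finrank_euclideanSpace_fin] at this
    exact this

/-- The subproblem depends on the samples of iteration `(k, i)` but not on its seed, so only the
single seed coordinate is treated as fresh. -/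
lemma measure_solver_deviation_le (hP : P.Standing lf lg Lg) (hS : I.solver.Valid ν P I.M)
    (hε : 0 < I.εbar) (hδ : 0 < I.δbar) (k i : ℕ) :
    tapeMeasure P.D ν {ω | (((plState P I τ ω k i).x, plEstimate P I τ ω k i), ω.2.2 (k, i))
      ∈ P.solverFailure I.M I.solver I.εbar I.δbar} ≤ ENNReal.ofReal I.δbar := by
  have := hP.prob
  have hst := measurableState_plState τ hP hS hε hδ k i
  have hY : Measurable fun ω => ((plState P I τ ω k i).x, plEstimate P I τ ω k i) :=
    hst.x.prodMk (measurable_estimator hP I.θ k i hst)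
  have hF := hP.measurableSet_solverFailure hS hε hδ
  have hset : MeasurableSet {ω : Tape Ξ S | (((plState P I τ ω k i).x, plEstimate P I τ ω k i),
      ω.2.2 (k, i)) ∈ P.solverFailure I.M I.solver I.εbar I.δbar} :=
    (hY.prodMk ((measurable_pi_apply (k, i)).comp (measurable_snd.comp measurable_snd))) hF
  refine measure_prod_le_of_right _ _ hset fun a₁ => ?_
  refine measure_prod_le_of_right _ _ (measurable_prodMk_left hset) fun a₂ => ?_
  have hB : MeasurableSet {q : (Vec n × Vec m × Jac n m) × (ℕ × ℕ → S) | (q.1, q.2 (k, i))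
      ∈ P.solverFailure I.M I.solver I.εbar I.δbar} :=
    (measurable_fst.prodMk ((measurable_pi_apply (k, i)).comp measurable_snd)) hF
  refine measure_fresh_le ν {(k, i)}
    (Y := fun a => ((plState P I τ (a₁, a₂, a) k i).x, plEstimate P I τ (a₁, a₂, a) k i))
    (hY.comp (measurable_const.prodMk (measurable_const.prodMk measurable_id))) ?_ hB ?_
    fun z => ?_
  · intro a a' h
    have hs := plState_congr P I τ (ω := (a₁, a₂, a)) (ω' := (a₁, a₂, a')) (k := k) (i := i)
      fun k' i' hne => ⟨fun _ => rfl, fun _ => rfl, h (k', i') hne⟩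
    simp only [plEstimate, hs]
  · intro z a a' h hz
    rw [Set.mem_ofPred_eq] at hz ⊢
    have ha : a (k, i) = a' (k, i) := h (k, i) rfl
    simpa only [ha] using hz
  · have hm : MeasurableSet {s | (z, s) ∈ P.solverFailure I.M I.solver I.εbar I.δbar} :=
      measurable_prodMk_left hF
    refine le_trans (le_of_eq ?_) (hP.measure_solverFailure_le hS hε hδ z)
    exact (measurePreserving_eval_infinitePi (fun _ : ℕ × ℕ => ν) (k, i)).measure_preimage
      hm.nullMeasurableSet

/-- Iteration `(k, i)` has accurate estimates and a successful solver run. -/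
structure StepAccurate (P : CompositeProblem n m Ξ) (I : PLInput n S) (τ : ℕ → ℕ)
    (cA cB ca cb : ℝ) (ω : Tape Ξ S) (k i : ℕ) : Prop where
  value_start : i = 0 →
    ‖(plEstimate P I τ ω k i).1 - P.g (plState P I τ ω k i).x‖ ^ 2 ≤ cA
  jac_start : i = 0 →
    ‖(plEstimate P I τ ω k i).2 - fderiv ℝ P.g (plState P I τ ω k i).x‖ ^ 2 ≤ cB
  value : i ≠ 0 → ‖(plEstimate P I τ ω k i).1 - P.g (plState P I τ ω k i).x‖
    ≤ ca * ‖(plState P I τ ω k i).x - (plState P I τ ω k i).xref‖ ^ 2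
      + ‖(plState P I τ ω k i).gref - P.g (plState P I τ ω k i).xref‖
      + ‖(plState P I τ ω k i).Jref - fderiv ℝ P.g (plState P I τ ω k i).xref‖
        * ‖(plState P I τ ω k i).x - (plState P I τ ω k i).xref‖
  jac : i ≠ 0 → ‖(plEstimate P I τ ω k i).2 - fderiv ℝ P.g (plState P I τ ω k i).x‖
    ≤ cb * ‖(plState P I τ ω k i).x - (plState P I τ ω k i).xref‖
      + ‖(plState P I τ ω k i).Jref - fderiv ℝ P.g (plState P I τ ω k i).xref‖
  solver : P.model I.M (plState P I τ ω k i).x (plEstimate P I τ ω k i).1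
      (plEstimate P I τ ω k i).2 (plState P I τ ω k (i + 1)).x
    ≤ (⨅ y, P.model I.M (plState P I τ ω k i).x (plEstimate P I τ ω k i).1
      (plEstimate P I τ ω k i).2 y) + (I.εbar : EReal)

lemma natCast_ne_zero_of_le {C L : ℝ} {N : ℕ} (hC : 0 < C) (hL : 1 ≤ L) (hN : C * L ≤ N) :
    N ≠ 0 := by
  rintro rfl
  have : 0 < C * L := by positivity
  simp only [Nat.cast_zero] at hN
  linarith

variable {lhat Lhat : ℝ≥0} {σg σJ : ℝ}

/-- Every iteration is accurate up to an event of small probability. -/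
lemma exists_stepAccurate (hP : P.Standing lf lg Lg) (hD : P.BoundedDeviation σg σJ)
    (hU : P.UniformlyLipschitz lhat Lhat) (hS : I.solver.Valid ν P I.M)
    (hε : 0 < I.εbar) (hδ : 0 < I.δbar) {CA CB Ca Cb L₁ L₂ : ℝ} (hCA : 0 < CA) (hCB : 0 < CB)
    (hCa : 0 < Ca) (hCb : 0 < Cb) (hL₁ : 1 ≤ L₁) (hL₂ : 1 ≤ L₂) (hA : CA * L₁ ≤ I.θ.A)
    (hB : CB * L₂ ≤ I.θ.B) (ha : Ca * L₁ ≤ I.θ.a) (hb : Cb * L₂ ≤ I.θ.b)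
    {cA cB ca cb : ℝ} (hcA : 12 * σg ^ 2 / CA ≤ cA) (hcB : 12 * σJ ^ 2 / CB ≤ cB)
    (hca0 : 0 ≤ ca) (hcb0 : 0 ≤ cb) (hca : 12 * ((Lhat : ℝ) + Lg) ^ 2 / Ca ≤ ca ^ 2)
    (hcb : 12 * ((Lhat : ℝ) + Lg) ^ 2 / Cb ≤ cb ^ 2) (k i : ℕ) :
    ∃ U : Set (Tape Ξ S), tapeMeasure P.D ν U ≤ ENNReal.ofReal ((m + 1) * Real.exp (-L₁))
        + ENNReal.ofReal ((m + n) * Real.exp (-L₂)) + ENNReal.ofReal I.δbar ∧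
      ∀ ω ∉ U, StepAccurate P I τ cA cB ca cb ω k i := by
  set Us : Set (Tape Ξ S) := {ω | (((plState P I τ ω k i).x, plEstimate P I τ ω k i), ω.2.2 (k, i))
      ∈ P.solverFailure I.M I.solver I.εbar I.δbar} with hUs
  have hUs_le := measure_solver_deviation_le (τ := τ) hP hS hε hδ k i
  have hsolver : ∀ ω ∉ Us, P.model I.M (plState P I τ ω k i).x (plEstimate P I τ ω k i).1
      (plEstimate P I τ ω k i).2 (plState P I τ ω k (i + 1)).x
    ≤ (⨅ y, P.model I.M (plState P I τ ω k i).x (plEstimate P I τ ω k i).1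
      (plEstimate P I τ ω k i).2 y) + (I.εbar : EReal) := by
    intro ω hω
    rw [hUs, Set.mem_ofPred_eq, CompositeProblem.solverFailure, Set.mem_ofPred_eq, not_not] at hω
    rw [plState_succ_x]
    exact hω
  have union_le : ∀ {U V : Set (Tape Ξ S)} {a b : ENNReal}, tapeMeasure P.D ν U ≤ a →
      tapeMeasure P.D ν V ≤ b →
      tapeMeasure P.D ν (U ∪ V ∪ Us) ≤ a + b + ENNReal.ofReal I.δbar := fun {U V a b} h1 h2 =>
    (measure_union_le _ _).trans (add_le_add ((measure_union_le _ _).trans (add_le_add h1 h2)) hUs_le)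
  by_cases hi : i = 0
  · subst hi
    have h1 := measure_value_deviation_le (τ := τ) hP hS hε hδ k 0 hP.measurable_value_sub
      (R := fun _ => σg) measurable_const (fun p => hD.value.mono fun ξ h => h p.1)
      (fun p => hP.integral_value_sub p.1) hCA hL₁ hA
    have h2 := measure_jac_deviation_le (τ := τ) hP hS hε hδ k 0 hP.measurable_jac_sub
      (R := fun _ => σJ) measurable_const (fun p => hD.jac.mono fun ξ h => h p.1)
      (fun p => hP.integral_jac_sub hU p.1) hCB hL₂ hB
    refine ⟨_, union_le h1 h2, fun ω hω => ?_⟩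
    simp only [Set.mem_union, not_or] at hω
    refine ⟨fun _ => ?_, fun _ => ?_, fun h => (h rfl).elim, fun h => (h rfl).elim,
      hsolver ω hω.2⟩
    · rw [plEstimate_zero_fst_sub P I τ ω k (natCast_ne_zero_of_le hCA hL₁ hA)]
      have hv : (plPoints P I τ k 0 ω, ω.1) ∉
        batchDeviation (fun p ξ => P.G ξ p.1 - P.g p.1) (fun _ => σg) CA I.θ.A k 0 := hω.1.1
      exact (norm_le_of_not_mem_batchDeviation hv).trans hcA
    · rw [plEstimate_zero_snd_sub P I τ ω k (natCast_ne_zero_of_le hCB hL₂ hB)]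
      have hJ : (plPoints P I τ k 0 ω, ω.2.1) ∉ batchDeviation
        (fun p ξ => fderiv ℝ (P.G ξ) p.1 - fderiv ℝ P.g p.1) (fun _ => σJ) CB I.θ.B k 0 := hω.1.2
      exact (norm_le_of_not_mem_batchDeviation hJ).trans hcB
  · have hnorm : Measurable fun p : Vec n × Vec n => ‖p.1 - p.2‖ :=
      (measurable_fst.sub measurable_snd).norm
    have h1 := measure_value_deviation_le (τ := τ) hP hS hε hδ k i hP.measurable_valueNoise
      (R := fun p => (Lhat + Lg) * ‖p.1 - p.2‖ ^ 2) ((hnorm.pow_const 2).const_mul _)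
      (hP.norm_valueNoise_le hU) (hP.integral_valueNoise hU) hCa hL₁ ha
    have h2 := measure_jac_deviation_le (τ := τ) hP hS hε hδ k i hP.measurable_jacNoise
      (R := fun p => (Lhat + Lg) * ‖p.1 - p.2‖) (hnorm.const_mul _)
      (hP.norm_jacNoise_le hU) (hP.integral_jacNoise hU) hCb hL₂ hb
    refine ⟨_, union_le h1 h2, fun ω hω => ?_⟩
    simp only [Set.mem_union, not_or] at hω
    refine ⟨fun h => (hi h).elim, fun h => (hi h).elim, fun _ => ?_, fun _ => ?_, hsolver ω hω.2⟩
    · rw [plEstimate_fst_sub P I τ ω k hi (natCast_ne_zero_of_le hCa hL₁ ha)]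
      refine (norm_add_le _ _).trans (add_le_add ((norm_add_le _ _).trans (add_le_add ?_ le_rfl))
        (ContinuousLinearMap.le_opNorm _ _))
      have hv : (plPoints P I τ k i ω, ω.1) ∉ batchDeviation P.valueNoise
        (fun p => (Lhat + Lg) * ‖p.1 - p.2‖ ^ 2) Ca I.θ.a k i := hω.1.1
      refine le_of_sq_le_sq ((norm_le_of_not_mem_batchDeviation hv).trans ?_) (by positivity)
      rw [plPoints, mul_pow, mul_pow]
      calc _ = 12 * ((Lhat : ℝ) + Lg) ^ 2 / Ca
            * (‖(plState P I τ ω k i).x - (plState P I τ ω k i).xref‖ ^ 2) ^ 2 := by ring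
        _ ≤ _ := by gcongr
    · rw [plEstimate_snd_sub P I τ ω k hi (natCast_ne_zero_of_le hCb hL₂ hb)]
      refine (norm_add_le _ _).trans (add_le_add ?_ le_rfl)
      have hJ : (plPoints P I τ k i ω, ω.2.1) ∉ batchDeviation P.jacNoise
        (fun p => (Lhat + Lg) * ‖p.1 - p.2‖) Cb I.θ.b k i := hω.1.2
      refine le_of_sq_le_sq ((norm_le_of_not_mem_batchDeviation hJ).trans ?_) (by positivity)
      rw [plPoints, mul_pow, mul_pow]
      calc _ = 12 * ((Lhat : ℝ) + Lg) ^ 2 / Cb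
            * ‖(plState P I τ ω k i).x - (plState P I τ ω k i).xref‖ ^ 2 := by ring
        _ ≤ _ := by gcongr

end BatchEvents

/-! ### Average stationarity of an accurate run. -/

section Stationarity

variable {n m : ℕ} {Ξ : Type u} [MeasurableSpace Ξ] {S : Type v}
  {P : CompositeProblem n m Ξ} {I : PLInput n S} {τ : ℕ} {lf lg Lg : ℝ≥0}

lemma genGrad_norm_sq {M : ℝ} (x : Vec n) :
    ‖P.genGrad M x‖ ^ 2 = (M * ‖P.proxLinear M x - x‖) ^ 2 := by
  rw [CompositeProblem.genGrad, norm_smul, mul_pow, Real.norm_eq_abs, sq_abs, norm_sub_rev, mul_pow]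

/-- A run all of whose iterations are accurate is stationary on average. -/
lemma average_genGrad_le (hP : P.Standing lf lg Lg) (hinf : ⊥ < ⨅ x, P.Φ x) {gap ε : ℝ}
    (hgap : P.Φ I.x₀ ≤ (⨅ x, P.Φ x) + (gap : EReal)) (hM : 5 * (lf : ℝ) * Lg < I.M) (hε : 0 < ε)
    (hεbar : I.εbar = ε / (150 * I.M)) {K : ℕ} (hτ : 0 < τ)
    (hKτ : 8 * I.M * (|gap| + 1) * ε⁻¹ ≤ K * τ) (ω : Tape Ξ S)
    (hω : ∀ k < K, ∀ i < τ, StepAccurate P I (fun _ => τ) ((ε / (80 * I.M * (lf + 1))) ^ 2)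
      (ε / (1080 * (lf + 1) ^ 2) / τ ^ 2) (I.M / (40 * (lf + 1)) / τ ^ 2)
      (I.M / (9 * (lf + 1)) / τ) ω k i) :
    1 / ((K : ℝ) * τ) * ∑ k ∈ Finset.range K, ∑ i ∈ Finset.range τ,
      ‖P.genGrad I.M (plIterate P I (fun _ => τ) ω k i)‖ ^ 2 ≤ ε := by
  have hlL : (0 : ℝ) ≤ lf * Lg := by positivity
  have hM0 : 0 < I.M := lt_of_le_of_lt (by positivity) hM
  have hM2 : 2 * (lf : ℝ) * Lg < I.M := by linarith
  have hτ1 : (1 : ℝ) ≤ τ := by exact_mod_cast hτ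
  have hτ0 : (0 : ℝ) < τ := by linarith
  set y : ℕ → ℕ → Vec n := fun k i => (plState P I (fun _ => τ) ω k i).x with hy
  -- `realΦ` is meaningful only where `h` is finite, so finiteness is propagated along with the
  -- descent.
  have hstep : ∀ k < K, ∀ i < τ, P.h (y k i) ≠ ⊤ → P.h (y k (i + 1)) ≠ ⊤ ∧
      P.realΦ (y k (i + 1)) ≤ P.realΦ (y k i) - I.M / 4 * ‖P.proxLinear I.M (y k i) - y k i‖ ^ 2
        - I.M / 5 * ‖y k (i + 1) - y k i‖ ^ 2 + I.M / 5 * (‖y k i - y k 0‖ / τ) ^ 2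
        + (ε / (20 * I.M) + ε / (150 * I.M)) := by
    intro k hk i hi hfin
    have acc := hω k hk i hi
    have acc0 := hω k hk 0 hτ
    obtain ⟨h1, h2⟩ := hP.inexact_step hinf hM2 hfin acc.solver
    refine ⟨h1, ?_⟩
    have h3 := descent_of_young hM0 hM h2
    set e₀g := ‖(plEstimate P I (fun _ => τ) ω k 0).1 - P.g (y k 0)‖ with he₀g
    set e₀J := ‖(plEstimate P I (fun _ => τ) ω k 0).2 - fderiv ℝ P.g (y k 0)‖ with he₀J
    have hδ : (τ : ℝ) * (‖y k i - y k 0‖ / τ) = ‖y k i - y k 0‖ := mul_div_cancel₀ _ hτ0.ne'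
    have hval : ‖(plEstimate P I (fun _ => τ) ω k i).1 - P.g (y k i)‖
        ≤ I.M / (40 * (lf + 1)) * (‖y k i - y k 0‖ / τ) ^ 2 + e₀g
          + e₀J * (τ * (‖y k i - y k 0‖ / τ)) := by
      -- At `i = 0` the distance vanishes and the estimate is itself the stored one; for `i > 0` the
      -- memory holds the data of iteration 0.
      rcases Nat.eq_zero_or_eq_succ_pred i with h0 | h0
      · subst h0
        rw [← he₀g, sub_self]
        simp
      · have hmem := plState_succ_memory P I (fun _ => τ) ω k i.pred
        rw [← Nat.succ_eq_add_one, ← h0] at hmem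
        have := acc.value (by omega)
        rw [hmem.1, hmem.2.1, hmem.2.2] at this
        rw [hδ]
        refine this.trans (le_of_eq ?_)
        rw [div_pow, mul_div_assoc', div_mul_eq_mul_div]
    have hjac : ‖(plEstimate P I (fun _ => τ) ω k i).2 - fderiv ℝ P.g (y k i)‖
        ≤ I.M / (9 * (lf + 1)) * (‖y k i - y k 0‖ / τ) + e₀J := by
      rcases Nat.eq_zero_or_eq_succ_pred i with h0 | h0
      · subst h0
        rw [← he₀J, sub_self]
        simp
      · have hmem := plState_succ_memory P I (fun _ => τ) ω k i.pred
        rw [← Nat.succ_eq_add_one, ← h0] at hmem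
        have := acc.jac (by omega)
        rw [hmem.1, hmem.2.2] at this
        refine this.trans (le_of_eq ?_)
        rw [mul_div_assoc', div_mul_eq_mul_div]
    have hg0 : e₀g ≤ ε / (80 * I.M * (lf + 1)) :=
      le_of_sq_le_sq (acc0.value_start rfl) (by positivity)
    have hJ0 : ((τ : ℝ) * e₀J) ^ 2 ≤ ε / (1080 * ((lf : ℝ) + 1) ^ 2) := by
      rw [mul_pow, ← le_div_iff₀' (by positivity)]
      exact acc0.jac_start rfl
    have h4 := error_le hM0 lf.coe_nonneg (by positivity) hτ1 (norm_nonneg _) (norm_nonneg _) rfl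
      hval hjac hg0 hJ0
    rw [hεbar] at h3
    change P.realΦ (y k (i + 1)) ≤ _ at h3
    linarith
  have hepoch : ∀ k < K, P.h (y k 0) ≠ ⊤ → ∀ i ≤ τ, P.h (y k i) ≠ ⊤ := by
    intro k hk h0 i
    induction i with
    | zero => exact fun _ => h0
    | succ i ih => exact fun hi => (hstep k hk i hi (ih (by omega))).1
  obtain ⟨c, hc, hcle⟩ := hP.exists_iInf_eq hinf
  have hx₀ : P.h I.x₀ ≠ ⊤ := by
    refine CompositeProblem.h_ne_top_of_Φ fun h => ?_
    rw [hc, ← EReal.coe_add, h] at hgap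
    exact EReal.coe_ne_top _ (top_le_iff.1 hgap)
  have hfin : ∀ k ≤ K, P.h (y k 0) ≠ ⊤ := by
    intro k
    induction k with
    | zero => exact fun _ => hx₀
    | succ k ih => exact fun hk => hepoch k hk (ih (by omega)) τ le_rfl
  have hgap' : P.realΦ (y 0 0) - P.realΦ (y K 0) ≤ gap := by
    have h1 := hcle _ (hfin K le_rfl)
    have h2 : P.realΦ I.x₀ ≤ c + gap := by
      rw [← EReal.coe_le_coe_iff, hP.coe_realΦ hx₀, EReal.coe_add, ← hc]
      exact hgap
    change P.realΦ I.x₀ - _ ≤ gap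
    linarith
  simp only [genGrad_norm_sq]
  refine average_le_of_descent hM0 hε hKτ (fun k => P.realΦ (y k 0))
    (fun k i => ‖P.proxLinear I.M (y k i) - y k i‖) hgap' fun k hk => ?_
  exact epoch_descent hM0 hτ (y k) P.realΦ (fun i => ‖P.proxLinear I.M (y k i) - y k i‖)
    fun i hi => (hstep k hk i hi (hepoch k hk (hfin k hk.le) i hi.le)).2

end Stationarity

/-! ### Two-sided bounds for the oracle complexities. -/

section Complexity

lemma natCeil_mul_le {c s x y : ℝ} (hx0 : 0 ≤ x) (hx : x ≤ c * s) (hs : 1 ≤ s) (hy : 1 ≤ y) :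
    (⌈x * y⌉₊ : ℝ) ≤ (c + 1) * s * y := by
  refine (natCeil_le_of_one_le hx0 hy).trans ?_
  gcongr
  linarith

lemma log_factor_lower {d N Δ : ℝ} (hd : 1 ≤ d) (hN : 1 ≤ N) (hΔ : 0 < Δ) (hΔ1 : Δ < 1) :
    1 ≤ Real.log (4 * d * N / Δ) ∧ Real.log (1 / Δ) ≤ Real.log (4 * d * N / Δ) ∧
      d * Real.exp (-Real.log (4 * d * N / Δ)) = Δ / (4 * N) := by
  have hdN : 1 ≤ d * N := one_le_mul_of_one_le_of_one_le hd hN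
  refine ⟨?_, ?_, ?_⟩
  · rw [Real.le_log_iff_exp_le (by positivity), le_div_iff₀ hΔ]
    have := Real.exp_one_lt_d9
    nlinarith [Real.exp_pos 1]
  · refine Real.log_le_log (by positivity) ?_
    gcongr
    linarith
  · rw [Real.exp_neg, Real.exp_log (by positivity)]
    field_simp

set_option maxHeartbeats 1000000 in
/-- Bounds for the total numbers of oracle calls. -/
lemma exists_complexity_bounds {CK CA CB Ca Cb : ℝ} (hCK : 0 < CK) (hCA : 0 < CA) (hCB : 0 < CB)
    (hCa : 0 < Ca) (hCb : 0 < Cb) {n m : ℕ} (hmn : 0 < m + n) {cτ Δ₀ : ℝ} (hcτ : 0 < cτ)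
    (hΔ₀ : 0 < Δ₀) (hΔ₁ : Δ₀ < 1) :
    ∃ c C : ℝ, 0 < c ∧ 0 < C ∧ ∀ (Δ ε : ℝ) (τ : ℕ), 0 < Δ → Δ ≤ Δ₀ → 0 < ε → ε < 1 / 2 → 0 < τ →
      (τ : ℝ) ≤ cτ * ε⁻¹ → ∀ (K : ℕ) (θ : BatchSizes),
      K = ⌈CK * ε⁻¹ / τ⌉₊ →
      θ.A = ⌈CA * (ε ^ 2)⁻¹ * Real.log (4 * (m + 1) * K * τ / Δ)⌉₊ →
      θ.B = ⌈CB * (τ : ℝ) ^ 2 * ε⁻¹ * Real.log (4 * (m + n) * K * τ / Δ)⌉₊ →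
      θ.a = ⌈Ca * (τ : ℝ) ^ 4 * Real.log (4 * (m + 1) * K * τ / Δ)⌉₊ →
      θ.b = ⌈Cb * (τ : ℝ) ^ 2 * Real.log (4 * (m + n) * K * τ / Δ)⌉₊ →
      (c * (((ε ^ 3)⁻¹ * (τ : ℝ)⁻¹ + ε⁻¹ * (τ : ℝ) ^ 4) * Real.log (1 / Δ))
          ≤ K * (θ.A + 2 * θ.a * ((τ : ℝ) - 1)) ∧
        K * (θ.A + 2 * θ.a * ((τ : ℝ) - 1))
          ≤ C * (((ε ^ 3)⁻¹ * (τ : ℝ)⁻¹ + ε⁻¹ * (τ : ℝ) ^ 4) * Real.log (1 / Δ)) *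
            Real.log (1 / ε) ^ 1) ∧
      (c * (((ε ^ 2)⁻¹ * (τ : ℝ) + ε⁻¹ * (τ : ℝ) ^ 4) * Real.log (1 / Δ))
          ≤ K * (θ.B + (θ.a + 2 * θ.b) * ((τ : ℝ) - 1)) ∧
        K * (θ.B + (θ.a + 2 * θ.b) * ((τ : ℝ) - 1))
          ≤ C * (((ε ^ 2)⁻¹ * (τ : ℝ) + ε⁻¹ * (τ : ℝ) ^ 4) * Real.log (1 / Δ)) *
            Real.log (1 / ε) ^ 1) := by
  have l0 : 0 < Real.log (1 / Δ₀) := Real.log_pos (by rw [lt_div_iff₀ hΔ₀]; linarith)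
  have e0 : 0 < Real.log 2 := Real.log_pos (by norm_num)
  set q : ℝ → ℝ := fun d => |Real.log (4 * d * (CK + cτ))| / (Real.log (1 / Δ₀) * Real.log 2)
      + 1 / Real.log (1 / Δ₀) + 1 / Real.log 2 with hq
  have hq0 : ∀ d, 0 < q d := fun d => by simp only [hq]; positivity
  set c₁ := CK * min (CA / 2) (2 * Ca / 2) with hc₁
  set c₂ := CK * min (CB / 2) (Ca / 2) with hc₂
  set C₁ := (CK + cτ) * ((CA + 1) + 2 * (Ca + 1)) * q (m + 1) with hC₁
  set C₂ := (CK + cτ) * ((CB + 1) + ((Ca + 1) + 2 * (Cb + 1))) * (q (m + 1) + q (m + n)) with hC₂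
  have p1 := hq0 (m + 1)
  have p2 := hq0 (m + n)
  have hC₁0 : 0 < C₁ := by positivity
  refine ⟨min c₁ c₂, max C₁ C₂, by positivity, lt_max_of_lt_left hC₁0, ?_⟩
  intro Δ ε τ hΔ hΔle hε hε2 hτ hτle K θ hK hA hB ha hb
  obtain ⟨u, hu⟩ : ∃ u, u = ε⁻¹ := ⟨_, rfl⟩
  obtain ⟨t, ht⟩ : ∃ t : ℝ, t = τ := ⟨_, rfl⟩
  obtain ⟨l, hl⟩ : ∃ l, l = Real.log (1 / Δ) := ⟨_, rfl⟩
  obtain ⟨e, he⟩ : ∃ e, e = Real.log (1 / ε) := ⟨_, rfl⟩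
  have hΔ1 : Δ < 1 := hΔle.trans_lt hΔ₁
  have hl0 : 0 < l := by rw [hl]; exact Real.log_pos (by rw [lt_div_iff₀ hΔ]; linarith)
  have hee : 0 < e := by rw [he]; exact Real.log_pos (by rw [lt_div_iff₀ hε]; linarith)
  have hu1 : 1 ≤ u := by rw [hu]; exact (one_le_inv₀ hε).2 (by linarith)
  have hu0 : 0 < u := by linarith
  have ht1 : 1 ≤ t := by rw [ht]; exact_mod_cast hτ
  have ht0 : 0 < t := by linarith
  have hKl : CK * (u / t) ≤ K := by
    rw [hu, ht, hK, mul_div_assoc']; exact Nat.le_ceil _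
  have hK1 : (1 : ℝ) ≤ K := by
    have : 0 < K := by rw [hK]; exact Nat.ceil_pos.2 (by positivity)
    exact_mod_cast this
  have hKu : (K : ℝ) ≤ (CK + cτ) * (u / t) := by
    have h1 : (K : ℝ) ≤ CK * (u / t) + 1 := by
      rw [hu, ht, hK, mul_div_assoc']; exact (Nat.ceil_lt_add_one (by positivity)).le
    -- The assumption `τ = O(ε⁻¹)` serves here: it absorbs the rounding of `K`.
    have h2 : 1 ≤ cτ * (u / t) := by
      rw [mul_div_assoc', le_div_iff₀ ht0, one_mul, hu, ht]; exact hτle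
    linarith
  have hN1 : 1 ≤ (K : ℝ) * t := one_le_mul_of_one_le_of_one_le hK1 ht1
  have hNu : (K : ℝ) * t ≤ (CK + cτ) * ε⁻¹ := by
    rw [← hu]
    calc (K : ℝ) * t ≤ (CK + cτ) * (u / t) * t := by gcongr
      _ = _ := by field_simp
  have hd1 : (1 : ℝ) ≤ (m : ℝ) + 1 := by linarith [(Nat.cast_nonneg m : (0 : ℝ) ≤ m)]
  have hd2 : (1 : ℝ) ≤ (m : ℝ) + n := by exact_mod_cast hmn
  obtain ⟨hL₁1, hL₁l, -⟩ := log_factor_lower hd1 hN1 hΔ hΔ1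
  obtain ⟨hL₂1, hL₂l, -⟩ := log_factor_lower hd2 hN1 hΔ hΔ1
  have hL₁u := log_factor_bounds hd1 hN1 hNu hΔ hΔle hΔ₁ hε hε2
  have hL₂u := log_factor_bounds hd2 hN1 hNu hΔ hΔle hΔ₁ hε hε2
  rw [← ht] at hA hB ha hb ⊢
  rw [mul_assoc (4 * ((m : ℝ) + 1))] at hA ha
  rw [mul_assoc (4 * ((m : ℝ) + n))] at hB hb
  set L₁ := Real.log (4 * ((m : ℝ) + 1) * (K * t) / Δ)
  set L₂ := Real.log (4 * ((m : ℝ) + n) * (K * t) / Δ)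
  rw [← hl] at hL₁l hL₂l
  rw [← hl, ← he] at hL₁u hL₂u
  change L₁ ≤ q (m + 1) * (l * e) at hL₁u
  change L₂ ≤ q (m + n) * (l * e) at hL₂u
  rw [← inv_pow, ← hu] at hA
  rw [← hu] at hB
  have lA : CA * u ^ 2 * L₁ ≤ θ.A := by rw [hA]; exact Nat.le_ceil _
  have lB : CB * t ^ 2 * u * L₂ ≤ θ.B := by rw [hB]; exact Nat.le_ceil _
  have la : Ca * t ^ 4 * L₁ ≤ θ.a := by rw [ha]; exact Nat.le_ceil _
  have hu2 : 1 ≤ u ^ 2 := one_le_pow₀ hu1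
  have ht2 : 1 ≤ t ^ 2 := one_le_pow₀ ht1
  have ht4 : 1 ≤ t ^ 4 := one_le_pow₀ ht1
  have htu : 1 ≤ t ^ 2 * u := one_le_mul_of_one_le_of_one_le ht2 hu1
  have uA : (θ.A : ℝ) ≤ (CA + 1) * u ^ 2 * L₁ := by
    rw [hA]; exact natCeil_mul_le (by positivity) le_rfl hu2 hL₁1
  have uB : (θ.B : ℝ) ≤ (CB + 1) * (t ^ 2 * u) * L₂ := by
    rw [hB]; exact natCeil_mul_le (by positivity) (mul_assoc _ _ _).le htu hL₂1
  have ua : (θ.a : ℝ) ≤ (Ca + 1) * t ^ 4 * L₁ := by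
    rw [ha]; exact natCeil_mul_le (by positivity) le_rfl ht4 hL₁1
  have ub : (θ.b : ℝ) ≤ (Cb + 1) * t ^ 4 * L₂ := by
    rw [hb]
    refine natCeil_mul_le (by positivity) ?_ ht4 hL₂1
    exact mul_le_mul_of_nonneg_left (pow_le_pow_right₀ ht1 (by norm_num)) hCb.le
  have hL₁0 : 0 ≤ L₁ := by linarith
  have hL₂0 : 0 ≤ L₂ := by linarith
  have eT₁ : u ^ 3 * t⁻¹ * t / u = u ^ 2 := by field_simp
  have eT₂ : u ^ 2 * t * t / u = t ^ 2 * u := by field_simp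
  have hu3 : (ε ^ 3)⁻¹ = u ^ 3 := by rw [hu, inv_pow]
  have hu2' : (ε ^ 2)⁻¹ = u ^ 2 := by rw [hu, inv_pow]
  rw [hu3, hu2', ← hu, ← hl, ← he, pow_one]
  refine ⟨⟨?_, ?_⟩, ?_, ?_⟩
  · have h := complexity_lower (CK := CK) (C₀ := CA) (C₁ := 2 * Ca) (u := u) (t := t) (l := l)
      (T := u ^ 3 * t⁻¹) (K := K) (N₀ := θ.A) (N := 2 * θ.a) hτ ht hCK hCA (by positivity) hu0
      hl0.le (by positivity)
      (fun h => by
        have : t = 1 := by rw [ht, h]; norm_num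
        rw [this, inv_one, mul_one]
        exact le_self_pow₀ hu1 (by norm_num))
      hKl
      (by rw [eT₁]; exact le_trans (by gcongr) lA)
      (by
        have : Ca * t ^ 4 * l ≤ Ca * t ^ 4 * L₁ := by gcongr
        linarith)
    refine le_trans ?_ h
    gcongr
    exact min_le_left _ _
  · have h := complexity_upper (CK := CK + cτ) (C₀ := CA + 1) (C₁ := 2 * (Ca + 1)) (u := u) (t := t)
      (l := L₁) (T := u ^ 3 * t⁻¹) (K := K) (N₀ := θ.A) (N := 2 * θ.a) ht1 (by positivity)
      (by positivity) (by positivity) hu0 hL₁0 (by positivity) (by positivity) hKu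
      (by rw [eT₁]; exact uA) (by linarith)
    refine h.trans ?_
    calc _ ≤ (CK + cτ) * ((CA + 1) + 2 * (Ca + 1)) * ((u ^ 3 * t⁻¹ + u * t ^ 4)
            * (q (m + 1) * (l * e))) := by gcongr
      _ = C₁ * ((u ^ 3 * t⁻¹ + u * t ^ 4) * l) * e := by rw [hC₁]; ring
      _ ≤ _ := by gcongr; exact le_max_left _ _
  · have h := complexity_lower (CK := CK) (C₀ := CB) (C₁ := Ca) (u := u) (t := t) (l := l)
      (T := u ^ 2 * t) (K := K) (N₀ := θ.B) (N := θ.a + 2 * θ.b) hτ ht hCK hCB hCa hu0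
      hl0.le (by positivity)
      (fun h => by
        have : t = 1 := by rw [ht, h]; norm_num
        rw [this, mul_one]
        exact le_self_pow₀ hu1 (by norm_num))
      hKl
      (by rw [eT₂, ← mul_assoc]; exact le_trans (by gcongr) lB)
      (by
        have : Ca * t ^ 4 * l ≤ Ca * t ^ 4 * L₁ := by gcongr
        have : (0 : ℝ) ≤ θ.b := Nat.cast_nonneg _
        linarith)
    refine le_trans ?_ h
    gcongr
    exact min_le_right _ _
  -- The Jacobian count mixes `a`, with logarithm `L₁`, and `B` and `b`, with `L₂`; the sum `L₁ +
  -- L₂` serves for all three.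
  · have h := complexity_upper (CK := CK + cτ) (C₀ := CB + 1) (C₁ := (Ca + 1) + 2 * (Cb + 1))
      (u := u) (t := t)
      (l := L₁ + L₂) (T := u ^ 2 * t) (K := K) (N₀ := θ.B) (N := θ.a + 2 * θ.b) ht1 (by positivity)
      (by positivity) (by positivity) hu0 (by positivity) (by positivity) (by positivity) hKu
      (by
        rw [eT₂]
        refine uB.trans ?_
        gcongr
        linarith)
      (by
        have h1 : (Ca + 1) * t ^ 4 * L₁ ≤ (Ca + 1) * t ^ 4 * (L₁ + L₂) := by gcongr; linarith
        have h2 : (Cb + 1) * t ^ 4 * L₂ ≤ (Cb + 1) * t ^ 4 * (L₁ + L₂) := by gcongr; linarith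
        linarith)
    refine h.trans ?_
    calc _ ≤ (CK + cτ) * ((CB + 1) + ((Ca + 1) + 2 * (Cb + 1))) * ((u ^ 2 * t + u * t ^ 4)
            * (q (m + 1) * (l * e) + q (m + n) * (l * e))) := by gcongr
      _ = C₂ * ((u ^ 2 * t + u * t ^ 4) * l) * e := by rw [hC₂]; ring
      _ ≤ _ := by gcongr; exact le_max_right _ _

end Complexity

/-! ### Union bound over the iterations. -/

section UnionBound

lemma ofReal_one_sub_le_measure {Ω : Type*} [MeasurableSpace Ω] {μ : Measure Ω}
    [IsProbabilityMeasure μ] {K τ : ℕ} {Δ : ℝ} (hΔ : 0 < Δ) (hN : 0 < (K : ℝ) * τ)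
    {U : ℕ → ℕ → Set Ω} (hU : ∀ k i, μ (U k i) ≤ ENNReal.ofReal (Δ / (K * τ))) {G : Set Ω}
    (hG : ∀ ω, (∀ k < K, ∀ i < τ, ω ∉ U k i) → ω ∈ G) : ENNReal.ofReal (1 - Δ) ≤ μ G := by
  set B : Set Ω := ⋃ k ∈ Finset.range K, ⋃ i ∈ Finset.range τ, U k i with hB
  have hBle : μ B ≤ ENNReal.ofReal Δ := by
    calc μ B ≤ ∑ k ∈ Finset.range K, ∑ i ∈ Finset.range τ, μ (U k i) :=
          (measure_biUnion_finset_le _ _).trans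
            (Finset.sum_le_sum fun k _ => measure_biUnion_finset_le _ _)
      _ ≤ ∑ k ∈ Finset.range K, ∑ i ∈ Finset.range τ, ENNReal.ofReal (Δ / (K * τ)) :=
          Finset.sum_le_sum fun k _ => Finset.sum_le_sum fun i _ => hU k i
      _ = ENNReal.ofReal Δ := by
          simp only [Finset.sum_const, Finset.card_range, nsmul_eq_mul]
          rw [← mul_assoc, ← ENNReal.ofReal_natCast, ← ENNReal.ofReal_natCast,
            ← ENNReal.ofReal_mul (by positivity), ← ENNReal.ofReal_mul hN.le,
            mul_div_cancel₀ _ hN.ne']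
  -- Covering the whole space instead of taking complements avoids measurability of `G` and of the
  -- sets `U k i`.
  have hcover : Set.univ ⊆ G ∪ B := by
    intro ω _
    by_cases h : ω ∈ B
    · exact Or.inr h
    · refine Or.inl (hG ω fun k hk i hi hmem => h ?_)
      simp only [hB, Set.mem_iUnion, Finset.mem_range]
      exact ⟨k, hk, i, hi, hmem⟩
  rw [ENNReal.ofReal_sub _ hΔ.le, ENNReal.ofReal_one, tsub_le_iff_right]
  calc (1 : ENNReal) = μ Set.univ := measure_univ.symm
    _ ≤ μ (G ∪ B) := measure_mono hcover
    _ ≤ μ G + μ B := measure_union_le _ _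
    _ ≤ μ G + ENNReal.ofReal Δ := by gcongr

end UnionBound

end

/-! ### The theorem: choice of constants and assembly. -/

theorem corollary4 (lf lg Lg lhat Lhat : ℝ≥0) (σg σJ M gap : ℝ)
    (hM : 5 * (lf : ℝ) * (Lg : ℝ) < M) :
    -- constants that depend on the numbers above only
    ∃ CK CA CB Ca Cb ε₀ : ℝ,
      0 < CK ∧ 0 < CA ∧ 0 < CB ∧ 0 < Ca ∧ 0 < Cb ∧ 0 < ε₀ ∧ ε₀ < 1 ∧
    ∀ n m : ℕ, 0 < m + n →
    -- the constants `c`, `C`, `p` hidden in the asymptotic notation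
    ∀ cτ Δ₀ : ℝ, 0 < cτ → 0 < Δ₀ → Δ₀ < 1 →
    ∃ (c C : ℝ) (p : ℕ), 0 < c ∧ 0 < C ∧
    -- any problem
    ∀ (Ξ : Type u) [MeasurableSpace Ξ] (P : CompositeProblem n m Ξ) (x₀ : Vec n),
      P.Standing lf lg Lg → P.BoundedDeviation σg σJ → P.UniformlyLipschitz lhat Lhat →
      ⊥ < (⨅ x, P.Φ x) → P.Φ x₀ ≤ (⨅ x, P.Φ x) + (gap : EReal) →
    -- any solver
    ∀ (S : Type v) [MeasurableSpace S] (ν : Measure S) [IsProbabilityMeasure ν]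
      (solver : Solver n S), solver.Valid ν P M →
    ∀ (Δ ε : ℝ) (τ : ℕ), 0 < Δ → Δ < 1 → 0 < ε → ε < ε₀ → 0 < τ →
    ∀ (K : ℕ) (θ : BatchSizes) (εbar δbar : ℝ),
      K = ⌈CK * ε⁻¹ / τ⌉₊ →
      θ.A = ⌈CA * (ε ^ 2)⁻¹ * Real.log (4 * (m + 1) * K * τ / Δ)⌉₊ →
      θ.B = ⌈CB * (τ : ℝ) ^ 2 * ε⁻¹ * Real.log (4 * (m + n) * K * τ / Δ)⌉₊ →
      θ.a = ⌈Ca * (τ : ℝ) ^ 4 * Real.log (4 * (m + 1) * K * τ / Δ)⌉₊ →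
      θ.b = ⌈Cb * (τ : ℝ) ^ 2 * Real.log (4 * (m + n) * K * τ / Δ)⌉₊ →
      δbar = Δ / (2 * K * τ) →
      εbar = ε / (5 * (30 * M)) →
      -- (i) average stationarity with probability at least `1 - Δ`
      ENNReal.ofReal (1 - Δ) ≤
        tapeMeasure P.D ν {ω | 1 / ((K : ℝ) * τ) * ∑ k ∈ Finset.range K, ∑ i ∈ Finset.range τ,
          ‖P.genGrad M (plIterate P ⟨M, θ, solver, εbar, δbar, x₀⟩ (fun _ => τ) ω k i)‖ ^ 2
            ≤ ε} ∧
      -- (ii) oracle complexities of the run of `K` epochs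
      (Δ ≤ Δ₀ → (τ : ℝ) ≤ cτ * ε⁻¹ → ∀ ω : Tape Ξ S,
        (c * (((ε ^ 3)⁻¹ * (τ : ℝ)⁻¹ + ε⁻¹ * (τ : ℝ) ^ 4) * Real.log (1 / Δ)) ≤
            ((plOuter P ⟨M, θ, solver, εbar, δbar, x₀⟩ (fun _ => τ) ω K).evals : ℝ) ∧
          ((plOuter P ⟨M, θ, solver, εbar, δbar, x₀⟩ (fun _ => τ) ω K).evals : ℝ) ≤
            C * (((ε ^ 3)⁻¹ * (τ : ℝ)⁻¹ + ε⁻¹ * (τ : ℝ) ^ 4) * Real.log (1 / Δ)) *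
              Real.log (1 / ε) ^ p) ∧
        (c * (((ε ^ 2)⁻¹ * (τ : ℝ) + ε⁻¹ * (τ : ℝ) ^ 4) * Real.log (1 / Δ)) ≤
            ((plOuter P ⟨M, θ, solver, εbar, δbar, x₀⟩ (fun _ => τ) ω K).jacs : ℝ) ∧
          ((plOuter P ⟨M, θ, solver, εbar, δbar, x₀⟩ (fun _ => τ) ω K).jacs : ℝ) ≤
            C * (((ε ^ 2)⁻¹ * (τ : ℝ) + ε⁻¹ * (τ : ℝ) ^ 4) * Real.log (1 / Δ)) *
              Real.log (1 / ε) ^ p)) := by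
  have hM0 : 0 < M := lt_of_le_of_lt (by positivity) hM
  -- The constants combine the 12 of the tail bounds with the tolerances required in `error_le`;
  -- each `+ 1` keeps them positive when a noise level, a Lipschitz constant or the gap vanishes.
  set CK : ℝ := 8 * M * (|gap| + 1) with hCK
  set CA : ℝ := 12 * (σg ^ 2 + 1) * (80 * M * (lf + 1)) ^ 2 with hCA
  set CB : ℝ := 12 * (σJ ^ 2 + 1) * (1080 * ((lf : ℝ) + 1) ^ 2) with hCB
  set Ca : ℝ := 12 * (((Lhat : ℝ) + Lg) ^ 2 + 1) / (M / (40 * (lf + 1))) ^ 2 with hCa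
  set Cb : ℝ := 12 * (((Lhat : ℝ) + Lg) ^ 2 + 1) / (M / (9 * (lf + 1))) ^ 2 with hCb
  have hCK0 : 0 < CK := by positivity
  have hCA0 : 0 < CA := by positivity
  have hCB0 : 0 < CB := by positivity
  have hCa0 : 0 < Ca := by positivity
  have hCb0 : 0 < Cb := by positivity
  refine ⟨CK, CA, CB, Ca, Cb, 1 / 2, hCK0, hCA0, hCB0, hCa0, hCb0, by norm_num, by norm_num, ?_⟩
  intro n m hmn cτ Δ₀ hcτ hΔ₀ hΔ₀1
  obtain ⟨c, C, hc, hC, hcount⟩ :=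
    exists_complexity_bounds hCK0 hCA0 hCB0 hCa0 hCb0 hmn hcτ hΔ₀ hΔ₀1
  refine ⟨c, C, 1, hc, hC, ?_⟩
  intro Ξ _ P x₀ hP hD hU hinf hgap S _ ν _ solver hS Δ ε τ hΔ hΔ1 hε hε2 hτ K θ εbar δbar
    hK hA hB ha hb hδbar hεbar
  refine ⟨?_, fun hΔle hτle ω => ?_⟩
  · have := hP.prob
    have := isProbabilityMeasure_tapeMeasure (ν := ν) P.D
    have hτ1 : (1 : ℝ) ≤ τ := by exact_mod_cast hτ
    have hτ0 : (0 : ℝ) < τ := by linarith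
    have hKl : CK * ε⁻¹ ≤ K * τ := by
      rw [← div_le_iff₀ hτ0, hK]; exact Nat.le_ceil _
    have hK1 : (1 : ℝ) ≤ K := by
      have : 0 < K := by rw [hK]; exact Nat.ceil_pos.2 (by positivity)
      exact_mod_cast this
    have hN1 : 1 ≤ (K : ℝ) * τ := one_le_mul_of_one_le_of_one_le hK1 hτ1
    have hN0 : 0 < (K : ℝ) * τ := by linarith
    have hd1 : (1 : ℝ) ≤ (m : ℝ) + 1 := by linarith [(Nat.cast_nonneg m : (0 : ℝ) ≤ m)]
    have hd2 : (1 : ℝ) ≤ (m : ℝ) + n := by exact_mod_cast hmn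
    obtain ⟨hL₁, -, hL₁e⟩ := log_factor_lower hd1 hN1 hΔ hΔ1
    obtain ⟨hL₂, -, hL₂e⟩ := log_factor_lower hd2 hN1 hΔ hΔ1
    rw [mul_assoc (4 * ((m : ℝ) + 1))] at hA ha
    rw [mul_assoc (4 * ((m : ℝ) + n))] at hB hb
    have hεbar' : εbar = ε / (150 * M) := by rw [hεbar]; ring
    have hεbar0 : 0 < εbar := by rw [hεbar']; positivity
    have hδbar0 : 0 < δbar := by rw [hδbar, mul_assoc]; positivity
    have hacc := exists_stepAccurate (I := ⟨M, θ, solver, εbar, δbar, x₀⟩) (τ := fun _ => τ)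
      hP hD hU hS hεbar0 hδbar0
      (CA := CA * (ε ^ 2)⁻¹) (CB := CB * (τ : ℝ) ^ 2 * ε⁻¹) (Ca := Ca * (τ : ℝ) ^ 4)
      (Cb := Cb * (τ : ℝ) ^ 2) (by positivity) (by positivity) (by positivity) (by positivity)
      hL₁ hL₂ (by rw [hA]; exact Nat.le_ceil _) (by rw [hB]; exact Nat.le_ceil _)
      (by rw [ha]; exact Nat.le_ceil _) (by rw [hb]; exact Nat.le_ceil _)
      (cA := (ε / (80 * M * (lf + 1))) ^ 2) (cB := ε / (1080 * (lf + 1) ^ 2) / τ ^ 2)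
      (ca := M / (40 * (lf + 1)) / τ ^ 2) (cb := M / (9 * (lf + 1)) / τ)
      (by
        rw [div_le_iff₀ (by positivity)]
        calc 12 * σg ^ 2 ≤ 12 * (σg ^ 2 + 1) := by linarith
          _ = _ := by rw [hCA]; field_simp)
      (by
        rw [div_le_iff₀ (by positivity)]
        calc 12 * σJ ^ 2 ≤ 12 * (σJ ^ 2 + 1) := by linarith
          _ = _ := by rw [hCB]; field_simp)
      (by positivity) (by positivity)
      (by
        rw [div_le_iff₀ (by positivity)]
        calc 12 * ((Lhat : ℝ) + Lg) ^ 2 ≤ 12 * (((Lhat : ℝ) + Lg) ^ 2 + 1) := by linarith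
          _ = _ := by rw [hCa]; field_simp)
      (by
        rw [div_le_iff₀ (by positivity)]
        calc 12 * ((Lhat : ℝ) + Lg) ^ 2 ≤ 12 * (((Lhat : ℝ) + Lg) ^ 2 + 1) := by linarith
          _ = _ := by rw [hCb]; field_simp)
    choose U hUle hUacc using hacc
    refine ofReal_one_sub_le_measure hΔ hN0 (U := U) (fun k i => (hUle k i).trans (le_of_eq ?_))
      fun ω hω => ?_
    -- Per iteration, the two batches cost `Δ / (4 * K * τ)` each and the solver `Δ / (2 * K * τ)`,
    -- which sums to the share `Δ / (K * τ)`.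
    · rw [hL₁e, hL₂e, ← ENNReal.ofReal_add (by positivity) (by positivity),
        ← ENNReal.ofReal_add (by positivity) hδbar0.le]
      congr 1
      rw [hδbar]
      field_simp
      ring
    · exact average_genGrad_le (I := ⟨M, θ, solver, εbar, δbar, x₀⟩) hP hinf hgap hM hε hεbar' hτ
        hKl ω fun k hk i hi => hUacc k i ω (hω k hk i hi)
  · rw [plOuter_evals P _ hτ ω K, plOuter_jacs P _ hτ ω K]
    exact hcount Δ ε τ hΔ hΔle hε hε2 hτ hτle K θ hK hA hB ha hb
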